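/- Let $n\ge 2$. Equip $\mathbb C^{n+1}$ with the Hermitian form $\langle w,v\rangle = w_1\bar v_{n+1}+\sum_{j=2}^{n} w_j\bar v_j+w_{n+1}\bar v_1$, let $U(1,n)=\{g\in GL(n+1,\mathbb C): gHg^*=H\}$ be its unitary group ($H$ the matrix of the form), $PU(1,n)$ the image of $U(1,n)$ in $GL(n+1,\mathbb C)/\mathbb C^*$, and $\mathbb H^n_{\mathbb C}=\{[w]\in\mathbb P^n_{\mathbb C}:\langle w,w\rangle<0\}$. Let $\Gamma\subset PU(1,n)$ be a discrete subgroup. Its Chen–Greenberg limit set $\Lambda_{CG}(\Gamma)$ is the set of accumulation points in $\partial\mathbb H^n_{\mathbb C}$ of the $\Gamma$-orbits of points of $\mathbb H^n_{\mathbb C}$; assume that $\Gamma$ is non-elementary, i.e. $\Lambda_{CG}(\Gamma)$ is infinite. Notation. For $p\in\partial\mathbb H^n_{\mathbb C}$, $p^\perp\subset\mathbb P^n_{\mathbb C}$ is the hyperplane orthogonal to $p$ and $p^\perp(p)$ is the set of projective lines $\ell$ with $p\in\ell\subset p^\perp$; $\mathrm{Span}(S)$ is the smallest projective subspace containing $S$;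 and for distinct $x=[\tilde x],y=[\tilde y],z=[\tilde z]$ in $\partial\mathbb H^n_{\mathbb C}$ the Cartan angular invariant is $\mathbb A(x,y,z)=\arg(-\langle \tilde x,\tilde y\rangle\langle \tilde y,\tilde z\rangle\langle \tilde z,\tilde x\rangle)$. A sequence $(\gamma_m)$ of distinct elements of $PU(1,n)$ tends simply to infinity if there are $k_m,k_m'\in U(n+1)\cap U(1,n)$ and $\lambda_m\ge 0$ with $\gamma_m=[k_m\,\mathrm{diag}(e^{\lambda_m},1,\dots,1,e^{-\lambda_m})\,k'_m]$ such that $(k_m)$ and $(k_m')$ converge in $U(n+1)\cap U(1,n)$ and $\lambda_m\to\infty$. For $w\in\mathbb P^n_{\mathbb C}$, $\mathcal D_{(\gamma_m)}(w)$ is the union, over all sequences $w_m\to w$, of the sets of accumulation points of $(\gamma_m(w_m))$. For $x,y\in\Lambda_{CG}(\Gamma)$, $\Gamma(y,x)$ is the set of bijections $\mu:y^\perp(y)\to x^\perp(x)$ (Cartan maps) for which there is a sequence $(\gamma_m)\subset\Gamma$ tending simply to infinity such that $\gamma_m\to x$ uniformly on compact subsets of $\mathbb P^n_{\mathbb C}\setminus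 y^\perp$; $\gamma_m^{-1}\to y$ uniformly on compact subsets of $\mathbb P^n_{\mathbb C}\setminus x^\perp$; $\mathcal D_{(\gamma_m)}(w)=\mu(\ell)$ for all $\ell\in y^\perp(y)$ and $w\in\ell\setminus\{y\}$; and $\mathcal D_{(\gamma_m^{-1})}(w)=\mu^{-1}(\ell)$ for all $\ell\in x^\perp(x)$ and $w\in\ell\setminus\{x\}$. Theorem. Let $x,y,z\in\Lambda_{CG}(\Gamma)$ be three distinct points. Then the formulas $$\phi_{xyz}:x^\perp\cap z^\perp\to x^\perp\cap z^\perp,\qquad \phi_{xyz}(w)=\mathrm{Span}\Big(\big(\mathrm{Span}\big((\mathrm{Span}(\{w,z\})\cap y^\perp)\cup\{y\}\big)\cap x^\perp\big)\cup\{x\}\Big)\cap z^\perp,$$ $$\Phi_{xyz}:z^\perp(z)\to z^\perp(z),\qquad \Phi_{xyz}(\ell)=\mathrm{Span}\big(\phi_{xyz}(\ell\cap x^\perp)\cup\{z\}\big)$$ give well-defined maps (the right-hand side of the first is a single point, that of the second a line of $z^\perp(z)$), and: 1. There is an ordered basis $v_1,\dots,v_{n-1}$ of the linear subspace of $\mathbb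 C^{n+1}$ underlying $x^\perp\cap z^\perp$ such that, for all $(\alpha_1,\dots,\alpha_{n-1})\ne0$, $$\phi_{xyz}\Big(\Big[\sum_{j=1}^{n-1}\alpha_jv_j\Big]\Big)=\Big[e^{i\mathbb A(x,y,z)}\alpha_{n-1}v_{n-1}-\sum_{j=1}^{n-2}e^{i\mathbb A(y,x,z)}\alpha_jv_j\Big].$$ 2. $\Phi_{xyz}$ is bijective and belongs to $\Gamma(z,z)$. -/

import Mathlib

open scoped Topology Matrix MatrixGroups LinearAlgebra.Projectivization
open Filter

noncomputable section

namespace CHyp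

/-- The vector space `ℂ^{n+1}`; the coordinates `1, …, n+1` are numbered `0, …, n` here. -/
abbrev Vec (n : ℕ) : Type := Fin (n + 1) → ℂ

/-- Complex projective space of dimension `n`. -/
abbrev Proj (n : ℕ) : Type := ℙ ℂ (Vec n)

/-- The general linear group `GL(n+1, ℂ)`. -/
abbrev GLn (n : ℕ) : Type := GL (Fin (n + 1)) ℂ

/-- The group of projective transformations, `GL(n+1, ℂ)` modulo the scalars. -/
abbrev PGLn (n : ℕ) : Type := PGL(Fin (n + 1), ℂ)

/-- The class in `PGL` of an invertible matrix. -/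
abbrev toPGL {n : ℕ} (g : GLn n) : PGLn n := Matrix.ProjGenLinGroup.mk g

/-- The quotient topology on projective space. -/
instance projTopology (n : ℕ) : TopologicalSpace (Proj n) :=
  TopologicalSpace.coinduced (Projectivization.mk' ℂ : {v : Vec n // v ≠ 0} → Proj n)
    inferInstance

/-- The quotient topology on the projective linear group. -/
instance pglTopology (n : ℕ) : TopologicalSpace (PGLn n) :=
  TopologicalSpace.coinduced (toPGL : GLn n → PGLn n) inferInstance

/-! ### The Hermitian form, its unitary group, and the complex ball -/

/-- The matrix with ones in the two corners `(1, n+1)`, `(n+1, 1)` and at the diagonal places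
`2, …, n`, and zeros elsewhere. -/
def formMatrix (n : ℕ) : Matrix (Fin (n + 1)) (Fin (n + 1)) ℂ :=
  Matrix.of fun i j => if j = Equiv.swap 0 (Fin.last n) i then 1 else 0

/-- The Hermitian form `⟨w, v⟩`, linear in `w` and conjugate linear in `v`. -/
def herm {n : ℕ} (w v : Vec n) : ℂ := w ⬝ᵥ (formMatrix n *ᵥ star v)

theorem herm_eq {n : ℕ} (w v : Vec n) :
    herm w v = ∑ i, w i * star (v (Equiv.swap 0 (Fin.last n) i)) := by
  simp [herm, formMatrix, dotProduct, Matrix.mulVec]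

theorem herm_add_left {n : ℕ} (w w' v : Vec n) : herm (w + w') v = herm w v + herm w' v := by
  simp [herm, add_dotProduct]

theorem herm_smul_left {n : ℕ} (c : ℂ) (w v : Vec n) : herm (c • w) v = c * herm w v := by
  simp [herm, smul_dotProduct]

theorem herm_smul_right {n : ℕ} (c : ℂ) (w v : Vec n) :
    herm w (c • v) = star c * herm w v := by
  simp [herm, Matrix.mulVec_smul, dotProduct_smul]

/-- `U(1,n)`: the invertible matrices with `g H g* = H`. -/
def unitary1n (n : ℕ) : Subgroup (GLn n) where
  carrier := {g | (g : Matrix (Fin (n + 1)) (Fin (n + 1)) ℂ) * formMatrix n *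
    (g : Matrix (Fin (n + 1)) (Fin (n + 1)) ℂ)ᴴ = formMatrix n}
  one_mem' := by simp
  mul_mem' := by
    intro a b ha hb
    simp only [Set.mem_ofPred_eq, Units.val_mul, Matrix.conjTranspose_mul] at *
    calc _ = (a : Matrix (Fin (n + 1)) (Fin (n + 1)) ℂ) * ((b : Matrix _ _ ℂ) * formMatrix n *
          (b : Matrix _ _ ℂ)ᴴ) * (a : Matrix _ _ ℂ)ᴴ := by simp only [Matrix.mul_assoc]
      _ = _ := by rw [hb, ha]
  inv_mem' := by
    intro a ha
    simp only [Set.mem_ofPred_eq] at *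
    have h1 : ((a⁻¹ : GLn n) : Matrix (Fin (n + 1)) (Fin (n + 1)) ℂ) * (a : Matrix _ _ ℂ) = 1 := by
      rw [← Units.val_mul, inv_mul_cancel, Units.val_one]
    have h2 : (a : Matrix (Fin (n + 1)) (Fin (n + 1)) ℂ)ᴴ *
        ((a⁻¹ : GLn n) : Matrix (Fin (n + 1)) (Fin (n + 1)) ℂ)ᴴ = 1 := by
      rw [← Matrix.conjTranspose_mul, h1, Matrix.conjTranspose_one]
    calc _ = ((a⁻¹ : GLn n) : Matrix (Fin (n + 1)) (Fin (n + 1)) ℂ) *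
          ((a : Matrix _ _ ℂ) * formMatrix n * (a : Matrix _ _ ℂ)ᴴ) *
          ((a⁻¹ : GLn n) : Matrix (Fin (n + 1)) (Fin (n + 1)) ℂ)ᴴ := by rw [ha]
      _ = (((a⁻¹ : GLn n) : Matrix (Fin (n + 1)) (Fin (n + 1)) ℂ) * (a : Matrix _ _ ℂ)) *
          formMatrix n * ((a : Matrix (Fin (n + 1)) (Fin (n + 1)) ℂ)ᴴ *
          ((a⁻¹ : GLn n) : Matrix (Fin (n + 1)) (Fin (n + 1)) ℂ)ᴴ) := by
            simp only [Matrix.mul_assoc]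
      _ = _ := by rw [h1, h2, one_mul, mul_one]

/-- `PU(1,n)`: the image of `U(1,n)` in the group of projective transformations. -/
def PU1n (n : ℕ) : Subgroup (PGLn n) := (unitary1n n).map Matrix.ProjGenLinGroup.mk

/-- Complex hyperbolic space: the negative points of projective space. -/
def ball (n : ℕ) : Set (Proj n) := {p | (herm p.rep p.rep).re < 0}

/-- The Chen–Greenberg limit set: the accumulation points, in the boundary of the ball, of the
orbits of points of the ball. -/
def limitSet {n : ℕ} (Γ : Subgroup (PGLn n)) : Set (Proj n) :=
  {p | p ∈ frontier (ball n) ∧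
    ∃ o ∈ ball n, AccPt p (𝓟 {q | ∃ g ∈ Γ, q = g • o})}

/-- The Cartan angular invariant `arg (-⟨x,y⟩⟨y,z⟩⟨z,x⟩)` of a triple of points. -/
def cartanAngle {n : ℕ} (x y z : Proj n) : ℝ :=
  Complex.arg (-(herm x.rep y.rep * herm y.rep z.rep * herm z.rep x.rep))

/-- The angular invariant may be computed from arbitrary lifts of the three points. -/
theorem cartanAngle_mk {n : ℕ} (x y z : Vec n) (hx : x ≠ 0) (hy : y ≠ 0) (hz : z ≠ 0) :
    cartanAngle (.mk ℂ x hx) (.mk ℂ y hy) (.mk ℂ z hz) =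
      Complex.arg (-(herm x y * herm y z * herm z x)) := by
  obtain ⟨a, ha⟩ := Projectivization.exists_smul_eq_mk_rep ℂ x hx
  obtain ⟨b, hb⟩ := Projectivization.exists_smul_eq_mk_rep ℂ y hy
  obtain ⟨c, hc⟩ := Projectivization.exists_smul_eq_mk_rep ℂ z hz
  rw [cartanAngle, ← ha, ← hb, ← hc]
  simp only [Units.smul_def, herm_smul_left, herm_smul_right]
  have hpos : 0 < Complex.normSq (a : ℂ) * Complex.normSq (b : ℂ) * Complex.normSq (c : ℂ) := by
    have h1 := Complex.normSq_pos.2 a.ne_zero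
    have h2 := Complex.normSq_pos.2 b.ne_zero
    have h3 := Complex.normSq_pos.2 c.ne_zero
    positivity
  rw [← Complex.arg_real_mul (-(herm x y * herm y z * herm z x)) hpos]
  congr 1
  push_cast
  rw [← Complex.mul_conj, ← Complex.mul_conj, ← Complex.mul_conj]
  simp only [Complex.star_def]
  ring

/-- The scalars `(-e^{iA(y,x,z)}, …, -e^{iA(y,x,z)}, e^{iA(x,y,z)})`, of length `n-1`. -/
def cartanEigenvalue {n : ℕ} (x y z : Proj n) (j : Fin (n - 1)) : ℂ :=
  if (j : ℕ) + 1 = n - 1 then Complex.exp (Complex.I * cartanAngle x y z)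
  else -Complex.exp (Complex.I * cartanAngle y x z)

/-! ### Orthogonal complements and pencils of lines -/

/-- The linear subspace of all vectors `w` with `⟨w, v⟩ = 0` for every lift `v` of `p`. -/
def perpSubmodule {n : ℕ} (p : Proj n) : Submodule ℂ (Vec n) where
  carrier := {w | ∀ v ∈ p.submodule, herm w v = 0}
  zero_mem' := by intro v _; simp [herm]
  add_mem' := by
    intro a b ha hb v hv
    rw [herm_add_left, ha v hv, hb v hv, add_zero]
  smul_mem' := by
    intro c a ha v hv
    rw [herm_smul_left, ha v hv, mul_zero]

/-- The projective subspace `p^⊥`. -/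
def perp {n : ℕ} (p : Proj n) : Projectivization.Subspace ℂ (Vec n) :=
  (perpSubmodule p).projectivization

/-- `p^⊥(p)`: the projective lines through `p` that are contained in `p^⊥`. -/
def Pencil {n : ℕ} (p : Proj n) : Type :=
  {ℓ : Projectivization.Subspace ℂ (Vec n) //
    Module.finrank ℂ ℓ.submodule = 2 ∧ p ∈ ℓ ∧ ℓ ≤ perp p}

/-! ### Sequences tending simply to infinity, and Cartan maps -/

/-- The matrix `diag (e^t, 1, …, 1, e^{-t})`, for `n ≥ 1`. -/
def cartanMatrix (n : ℕ) (t : ℝ) : Matrix (Fin (n + 1)) (Fin (n + 1)) ℂ :=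
  Matrix.diagonal fun i =>
    if i = 0 then (Real.exp t : ℂ) else if i = Fin.last n then (Real.exp (-t) : ℂ) else 1

/-- The compact group `K = U(n+1) ∩ U(1,n)`. -/
def compactSubgroup (n : ℕ) : Set (GLn n) :=
  {g | (g : Matrix (Fin (n + 1)) (Fin (n + 1)) ℂ) ∈ Matrix.unitaryGroup (Fin (n + 1)) ℂ ∧
    g ∈ unitary1n n}

/-- A sequence of distinct projective transformations with Cartan decompositions
`γ_m = k_m diag (e^{t_m}, 1, …, 1, e^{-t_m}) k'_m` in which the compact factors converge in `K`
and `t_m → ∞`. -/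
def TendsSimplyToInfinity {n : ℕ} (γ : ℕ → PGLn n) : Prop :=
  Function.Injective γ ∧
  ∃ (k k' : ℕ → GLn n) (κ κ' : GLn n) (t : ℕ → ℝ),
    (∀ m, k m ∈ compactSubgroup n ∧ k' m ∈ compactSubgroup n ∧ 0 ≤ t m ∧
      ∃ g : GLn n, toPGL g = γ m ∧
        (g : Matrix (Fin (n + 1)) (Fin (n + 1)) ℂ) = k m * cartanMatrix n (t m) * k' m) ∧
    κ ∈ compactSubgroup n ∧ κ' ∈ compactSubgroup n ∧
    Tendsto k atTop (𝓝 κ) ∧ Tendsto k' atTop (𝓝 κ') ∧ Tendsto t atTop atTop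

/-- `D_{(γ_m)}(p)`: the union, over all sequences `(x_m)` converging to `p`, of the sets of
accumulation points of `(γ_m(x_m))`. -/
def dynSet {n : ℕ} (γ : ℕ → PGLn n) (p : Proj n) : Set (Proj n) :=
  {q | ∃ x : ℕ → Proj n, Tendsto x atTop (𝓝 p) ∧ MapClusterPt q atTop fun m => γ m • x m}

/-- `γ_m → x` uniformly on the compact subsets of the complement of `y^⊥`. The limit is the constant
map `x`, so uniform convergence on `C` (for any metric inducing the topology) means that every
neighbourhood of `x` contains `γ_m(C)` for all large `m`. -/
def ConvergesOff {n : ℕ} (γ : ℕ → PGLn n) (y x : Proj n) : Prop :=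
  ∀ C : Set (Proj n), IsCompact C → (∀ p ∈ C, p ∉ perp y) →
    ∀ U ∈ 𝓝 x, ∀ᶠ m in atTop, ∀ p ∈ C, γ m • p ∈ U

/-- `Γ(y,x)`: the set of Cartan maps `y^⊥(y) → x^⊥(x)` of `Γ`. -/
def cartanMaps {n : ℕ} (Γ : Subgroup (PGLn n)) (y x : Proj n) : Set (Pencil y ≃ Pencil x) :=
  {f | ∃ γ : ℕ → PGLn n, (∀ m, γ m ∈ Γ) ∧ TendsSimplyToInfinity γ ∧
    ConvergesOff γ y x ∧ ConvergesOff (fun m => (γ m)⁻¹) x y ∧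
    (∀ ℓ : Pencil y, ∀ w ∈ ℓ.1, w ≠ y → dynSet γ w = ((f ℓ).1 : Set (Proj n))) ∧
    (∀ ℓ : Pencil x, ∀ w ∈ ℓ.1, w ≠ x →
      dynSet (fun m => (γ m)⁻¹) w = ((f.symm ℓ).1 : Set (Proj n)))}

/-! ### The composed projection -/

/-- `Span((Span((Span({w,z}) ∩ y^⊥) ∪ {y}) ∩ x^⊥) ∪ {x}) ∩ z^⊥`, as a projective subspace. -/
def projChain {n : ℕ} (x y z w : Proj n) : Projectivization.Subspace ℂ (Vec n) :=
  let a := Projectivization.Subspace.span {w, z} ⊓ perp y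
  let b := Projectivization.Subspace.span ((a : Set (Proj n)) ∪ {y}) ⊓ perp x
  Projectivization.Subspace.span ((b : Set (Proj n)) ∪ {x}) ⊓ perp z

/-- `φ` is the composed projection `φ_{xyz}` on `x^⊥ ∩ z^⊥`: for each `w` the projective subspace
above consists of the single point `φ(w)`. -/
def IsComposedProjection {n : ℕ} (x y z : Proj n)
    (φ : {w : Proj n // w ∈ perp x ⊓ perp z} → {w : Proj n // w ∈ perp x ⊓ perp z}) : Prop :=
  ∀ w, (projChain x y z w.1 : Set (Proj n)) = {(φ w).1}

/-- `Φ` is the map `ℓ ↦ Span(φ(ℓ ∩ x^⊥) ∪ {z})` on `z^⊥(z)`. -/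
def IsInducedOnPencil {n : ℕ} (x z : Proj n)
    (φ : {w : Proj n // w ∈ perp x ⊓ perp z} → {w : Proj n // w ∈ perp x ⊓ perp z})
    (Φ : Pencil z → Pencil z) : Prop :=
  ∀ ℓ : Pencil z, (Φ ℓ).1 = Projectivization.Subspace.span
    ({q : Proj n | ∃ w, w.1 ∈ ℓ.1 ⊓ perp x ∧ q = (φ w).1} ∪ {z})

end CHyp

end

noncomputable section

namespace CHyp

/-! Lift `x`, `y`, `z` to null vectors `X`, `Y`, `Z`. Distinct null lines are never orthogonal, so
each "span, then intersect" step in the definition of `φ` is a linear projection along one of these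
vectors onto the complement of another (`submodule_inf_perp`). Let `η` be the component of `Y`
orthogonal to `X` and `Z`. The composition of the three projections on `{X, Z}^⊥` is `v ↦ v + c ⟨v,
η⟩ η` (`exists_steps`). It is the identity on `η^⊥` and multiplies `η` by `-k / k̄`, where `k =
⟨X,Y⟩⟨Y,Z⟩⟨Z,X⟩` (`reflMap_factor`). Up to a common scalar these eigenvalues are the two
exponentials of Cartan angles (`exp_cartanAngle`), and positivity of the form on `{X, Z}^⊥` provides
a basis of eigenvectors (`exists_basis`).

For membership in `Γ(z,z)` the dynamics of a sequence of lifts `G m` in `U(1,n)` is recorded by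
`limGraph`, the linear relation of pairs `(w, u)` with `w_m → w` and `G m w_m → u`. The pair `(0,
x)` marks an attracting point and `(y, 0)` a repelling one. A nonzero attracting vector forces a
subsequence with convergent Cartan decomposition (`exists_cartanSeq`), and along it the sets `D(w)`
and the uniform convergence can be read off the relation. Thus a bijection of pencils compatible
with such a relation is a Cartan map (`mem_cartanMaps_of_limGraph`). Under a transversality
condition these relations compose (`limGraph_mul`).

It remains to realise projections by sequences in `Γ`. A discrete group with infinite limit set
fixes no boundary point (`not_forall_eigenvector`), so sequences attracted to `y` and to `z` can be
combined, after inserting one element of `Γ`, into a sequence attracted to `y` and repelled from `z`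
(`exists_seq_attr_rep`). It induces an isometry of the positive definite space `{y, z}^⊥`.
Isometries of such a space have powers close to the identity, so a diagonal choice of powers induces
the projection itself (`exists_seq_projection`). With `D` doing this for the pair `(y, z)` and `E`
for `(z, x)`, the products `E m * D m` reproduce the three projections, hence `Φ`. -/

theorem smul_vec_def {n : ℕ} (g : GLn n) (v : Vec n) : g • v = g.1 *ᵥ v := rfl

theorem zero_ne_last {n : ℕ} (hn : 2 ≤ n) : (0 : Fin (n + 1)) ≠ Fin.last n := by
  intro h
  have := congrArg Fin.val h
  simp at this
  omega

/-! ### Algebra of the Hermitian form -/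

theorem star_herm {n : ℕ} (w v : Vec n) : star (herm w v) = herm v w := by
  rw [herm_eq, herm_eq, star_sum,
    ← Equiv.sum_comp (Equiv.swap 0 (Fin.last n)) (fun i => v i * star (w _))]
  refine Finset.sum_congr rfl fun i _ => ?_
  rw [star_mul, star_star, Equiv.swap_apply_self]

theorem herm_add_right {n : ℕ} (w v v' : Vec n) : herm w (v + v') = herm w v + herm w v' := by
  rw [← star_herm, herm_add_left, star_add, star_herm, star_herm]

theorem herm_zero_left {n : ℕ} (v : Vec n) : herm 0 v = 0 := by
  simpa using herm_smul_left 0 (0 : Vec n) v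

theorem herm_sub_left {n : ℕ} (w w' v : Vec n) : herm (w - w') v = herm w v - herm w' v := by
  rw [eq_sub_iff_add_eq, ← herm_add_left, sub_add_cancel]

theorem herm_sub_right {n : ℕ} (w v v' : Vec n) : herm w (v - v') = herm w v - herm w v' := by
  rw [eq_sub_iff_add_eq, ← herm_add_right, sub_add_cancel]

theorem herm_eq_zero_comm {n : ℕ} {w v : Vec n} : herm w v = 0 ↔ herm v w = 0 := by
  rw [← star_herm, star_eq_zero]

/-- The form as a linear functional of its first argument. -/
def hermLeft {n : ℕ} (v : Vec n) : Vec n →ₗ[ℂ] ℂ where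
  toFun w := herm w v
  map_add' w w' := herm_add_left w w' v
  map_smul' c w := herm_smul_left c w v

theorem formMatrix_mul_self (n : ℕ) : formMatrix n * formMatrix n = 1 := by
  ext i j
  rw [Matrix.mul_apply, Finset.sum_eq_single (Equiv.swap 0 (Fin.last n) i)]
  · simp [formMatrix, Matrix.one_apply, eq_comm]
  · intro k _ hk
    simp [formMatrix, hk]
  · simp

theorem formMatrix_conjTranspose (n : ℕ) : (formMatrix n)ᴴ = formMatrix n := by
  ext i j
  simp only [formMatrix, Matrix.conjTranspose_apply, Matrix.of_apply]
  have : (i = Equiv.swap 0 (Fin.last n) j) ↔ (j = Equiv.swap 0 (Fin.last n) i) := by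
    constructor <;> rintro rfl <;> simp
  by_cases h : j = Equiv.swap 0 (Fin.last n) i
  · rw [if_pos h, if_pos (this.2 h), star_one]
  · rw [if_neg h, if_neg (fun h' => h (this.1 h')), star_zero]

theorem formMatrix_mulVec {n : ℕ} (v : Vec n) (i : Fin (n + 1)) :
    (formMatrix n *ᵥ v) i = v (Equiv.swap 0 (Fin.last n) i) := by
  simp [formMatrix, Matrix.mulVec, dotProduct]

theorem unitary1n_mul_conj {n : ℕ} {g : GLn n} (hg : g ∈ unitary1n n) :
    g.1 * formMatrix n * g.1ᴴ = formMatrix n := hg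

theorem unitary1n_inv_eq {n : ℕ} {g : GLn n} (hg : g ∈ unitary1n n) :
    (g⁻¹).1 = formMatrix n * g.1ᴴ * formMatrix n := by
  have h : g.1 * (formMatrix n * g.1ᴴ * formMatrix n) = 1 := by
    rw [← Matrix.mul_assoc, ← Matrix.mul_assoc, unitary1n_mul_conj hg, formMatrix_mul_self]
  exact Units.inv_eq_of_mul_eq_one_right h

theorem unitary1n_conj_mul {n : ℕ} {g : GLn n} (hg : g ∈ unitary1n n) :
    g.1ᴴ * formMatrix n * g.1 = formMatrix n := by
  have h : (g⁻¹).1 * g.1 = 1 := by rw [← Units.val_mul, inv_mul_cancel, Units.val_one]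
  rw [unitary1n_inv_eq hg] at h
  have h2 := congrArg (formMatrix n * ·) h
  simpa only [← Matrix.mul_assoc, formMatrix_mul_self, Matrix.one_mul, Matrix.mul_one] using h2

theorem herm_smul_smul {n : ℕ} {g : GLn n} (hg : g ∈ unitary1n n) (w v : Vec n) :
    herm (g • w) (g • v) = herm w v := by
  have h : g.1ᵀ * formMatrix n * g.1.map star = formMatrix n := by
    have h1 := congrArg (fun A => (Aᴴ)ᵀ) (unitary1n_conj_mul hg)
    have h2 : (formMatrix n)ᵀ = formMatrix n := by
      ext i j
      have := congrFun (congrFun (formMatrix_conjTranspose n) i) j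
      simp only [Matrix.conjTranspose_apply] at this
      rw [Matrix.transpose_apply, ← this]
      simp only [formMatrix, Matrix.of_apply]
      split_ifs <;> simp
    simp only [Matrix.conjTranspose_mul, Matrix.transpose_mul, Matrix.conjTranspose_conjTranspose,
      formMatrix_conjTranspose, h2] at h1
    exact h1
  have h3 : star (g.1 *ᵥ v) = g.1.map star *ᵥ star v := by
    ext i
    simp [Matrix.mulVec, dotProduct]
  rw [herm, herm, smul_vec_def, smul_vec_def, h3, Matrix.mulVec_mulVec,
    ← Matrix.vecMul_transpose, ← Matrix.dotProduct_mulVec, Matrix.mulVec_mulVec,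
    ← Matrix.mul_assoc, h]

/-- The two corner terms sum to `2 Re(v₀ v̄_last) = |v₀|² + |v_last|² - |v₀ - v_last|²`. So the form
is the Euclidean one minus a single square, and it is positive wherever that one linear functional
vanishes. -/
theorem herm_self_eq {n : ℕ} (hn : 2 ≤ n) (v : Vec n) :
    herm v v = ((∑ i, Complex.normSq (v i) - Complex.normSq (v 0 - v (Fin.last n)) : ℝ) : ℂ) := by
  have h0 := zero_ne_last hn
  have h1 : herm v v = ∑ i, v i * star (v i) -
      (v 0 - v (Fin.last n)) * star (v 0 - v (Fin.last n)) := by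
    rw [herm_eq, ← sub_eq_zero, sub_sub_eq_add_sub, sub_eq_zero, add_comm]
    have h2 : ∀ f : Fin (n + 1) → ℂ, ∑ i, f i = f 0 + f (Fin.last n) +
        ∑ i ∈ (Finset.univ.erase 0).erase (Fin.last n), f i := by
      intro f
      rw [← Finset.add_sum_erase Finset.univ f (Finset.mem_univ 0),
        ← Finset.add_sum_erase _ f (Finset.mem_erase.2 ⟨h0.symm, Finset.mem_univ _⟩), add_assoc]
    rw [h2, h2 (fun i => v i * star (v i))]
    have h3 : ∀ i ∈ (Finset.univ.erase 0).erase (Fin.last n),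
        v i * star (v (Equiv.swap 0 (Fin.last n) i)) = v i * star (v i) := by
      intro i hi
      rw [Finset.mem_erase, Finset.mem_erase] at hi
      rw [Equiv.swap_apply_of_ne_of_ne hi.2.1 hi.1]
    rw [Finset.sum_congr rfl h3, Equiv.swap_apply_left, Equiv.swap_apply_right, star_sub]
    ring
  rw [h1]
  push_cast
  simp only [Complex.star_def, Complex.mul_conj]

theorem herm_self_ofReal_re {n : ℕ} (v : Vec n) : ((herm v v).re : ℂ) = herm v v := by
  have h := star_herm v v
  rw [Complex.star_def] at h
  exact Complex.conj_eq_iff_re.1 h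

theorem sum_normSq_pos {ι : Type*} [Fintype ι] {v : ι → ℂ} (hv : v ≠ 0) :
    0 < ∑ i, Complex.normSq (v i) := by
  obtain ⟨i, hi⟩ := Function.ne_iff.1 hv
  exact Finset.sum_pos' (fun i _ => Complex.normSq_nonneg _)
    ⟨i, Finset.mem_univ _, Complex.normSq_pos.2 hi⟩

/-- On the complement of a null vector the form is nonnegative, and it vanishes only on the
multiples of that vector. -/
theorem herm_self_perp_null {n : ℕ} (hn : 2 ≤ n) {x w : Vec n} (hx : x ≠ 0) (hxx : herm x x = 0)
    (hwx : herm w x = 0) : 0 ≤ (herm w w).re ∧ (herm w w = 0 → ∃ c : ℂ, w = c • x) := by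
  set d : Vec n → ℂ := fun v => v 0 - v (Fin.last n) with hd
  have hdx : d x ≠ 0 := by
    intro h
    have h1 := herm_self_eq hn x
    change x 0 - x (Fin.last n) = 0 at h
    rw [hxx, h, map_zero, sub_zero] at h1
    have h2 : ∑ i, Complex.normSq (x i) = 0 := by exact_mod_cast h1.symm
    exact (sum_normSq_pos hx).ne' h2
  -- Subtracting this multiple of `x` kills the only negative square without changing the value of
  -- the form, because `x` is null and orthogonal to `w`.
  set v := w - (d w / d x) • x with hv
  have hdv : d v = 0 := by
    have : d v = d w - d w / d x * d x := by simp only [hd, hv]; simp; ring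
    rw [this, div_mul_cancel₀ _ hdx, sub_self]
  have hvv : herm v v = herm w w := by
    rw [hv, herm_sub_left, herm_sub_right, herm_sub_right, herm_smul_left, herm_smul_right,
      herm_smul_left, herm_smul_right, hxx, hwx, herm_eq_zero_comm.1 hwx]
    ring
  have h1 := herm_self_eq hn v
  change v 0 - v (Fin.last n) = 0 at hdv
  rw [hdv, map_zero, sub_zero, hvv] at h1
  refine ⟨?_, fun h => ⟨d w / d x, ?_⟩⟩
  · rw [h1, Complex.ofReal_re]
    exact Finset.sum_nonneg fun i _ => Complex.normSq_nonneg _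
  · by_contra hne
    have hv0 : v ≠ 0 := fun h0 => hne (sub_eq_zero.1 h0)
    rw [h] at h1
    have h2 : ∑ i, Complex.normSq (v i) = 0 := by exact_mod_cast h1.symm
    exact (sum_normSq_pos hv0).ne' h2

/-- Two non-proportional null vectors are not orthogonal. -/
theorem herm_ne_zero_of_null {n : ℕ} (hn : 2 ≤ n) {x y : Vec n} (hx : x ≠ 0)
    (hxx : herm x x = 0) (hyy : herm y y = 0) (hne : ∀ c : ℂ, y ≠ c • x) : herm y x ≠ 0 := by
  intro h
  obtain ⟨c, hc⟩ := (herm_self_perp_null hn hx hxx h).2 hyy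
  exact hne c hc

/-- The form is positive on nonzero vectors orthogonal to two non-orthogonal null vectors. -/
theorem herm_self_pos {n : ℕ} (hn : 2 ≤ n) {x y w : Vec n}
    (hxx : herm x x = 0) (hxy : herm x y ≠ 0) (hwx : herm w x = 0)
    (hwy : herm w y = 0) (hw : w ≠ 0) : 0 < (herm w w).re := by
  have hx : x ≠ 0 := by rintro rfl; exact hxy (herm_zero_left y)
  obtain ⟨h1, h2⟩ := herm_self_perp_null hn hx hxx hwx
  refine lt_of_le_of_ne h1 fun h => ?_
  obtain ⟨c, rfl⟩ := h2 (by rw [← herm_self_ofReal_re, ← h, Complex.ofReal_zero])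
  rw [herm_smul_left] at hwy
  rcases mul_eq_zero.1 hwy with hc | hc
  · exact hw (by rw [hc, zero_smul])
  · exact hxy hc

/-! ### Limits -/

theorem tendsto_herm {n : ℕ} {ι : Type*} {l : Filter ι} {a b : ι → Vec n} {a₀ b₀ : Vec n}
    (ha : Tendsto a l (𝓝 a₀)) (hb : Tendsto b l (𝓝 b₀)) :
    Tendsto (fun i => herm (a i) (b i)) l (𝓝 (herm a₀ b₀)) := by
  simp only [herm_eq]
  exact tendsto_finsetSum _ fun i _ =>
    (tendsto_pi_nhds.1 ha i).mul (tendsto_pi_nhds.1 hb _).star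

theorem tendsto_mulVec {n : ℕ} {ι : Type*} {l : Filter ι}
    {A : ι → Matrix (Fin (n + 1)) (Fin (n + 1)) ℂ}
    {A₀ : Matrix (Fin (n + 1)) (Fin (n + 1)) ℂ} {v : ι → Vec n} {v₀ : Vec n}
    (hA : Tendsto A l (𝓝 A₀)) (hv : Tendsto v l (𝓝 v₀)) :
    Tendsto (fun i => A i *ᵥ v i) l (𝓝 (A₀ *ᵥ v₀)) := by
  refine tendsto_pi_nhds.2 fun i => ?_
  simp only [Matrix.mulVec, dotProduct]
  exact tendsto_finsetSum _ fun j _ =>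
    (((continuous_id.matrix_elem i j).tendsto A₀).comp hA).mul (tendsto_pi_nhds.1 hv j)

/-- The limit of the graphs of a sequence of matrices along a filter. -/
def limGraph {n : ℕ} (l : Filter ℕ) (G : ℕ → GLn n) : Submodule ℂ (Vec n × Vec n) where
  carrier := {p | ∃ w : ℕ → Vec n, Tendsto w l (𝓝 p.1) ∧ Tendsto (fun m => G m • w m) l (𝓝 p.2)}
  zero_mem' := ⟨fun _ => 0, tendsto_const_nhds, by simpa using tendsto_const_nhds⟩
  add_mem' := by
    rintro p q ⟨w, hw, hw'⟩ ⟨v, hv, hv'⟩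
    exact ⟨fun m => w m + v m, hw.add hv, by
      simp only [smul_add]
      exact hw'.add hv'⟩
  smul_mem' := by
    rintro c p ⟨w, hw, hw'⟩
    refine ⟨fun m => c • w m, hw.const_smul c, ?_⟩
    simp only [smul_comm _ c]
    exact hw'.const_smul c

theorem limGraph_mono {n : ℕ} {l l' : Filter ℕ} (h : l' ≤ l) (G : ℕ → GLn n) :
    limGraph l G ≤ limGraph l' G := by
  rintro p ⟨w, hw, hw'⟩
  exact ⟨w, hw.mono_left h, hw'.mono_left h⟩

theorem limGraph_comp {n : ℕ} {l l' : Filter ℕ} {φ : ℕ → ℕ} (h : Tendsto φ l' l)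
    (G : ℕ → GLn n) : limGraph l G ≤ limGraph l' (G ∘ φ) := by
  rintro p ⟨w, hw, hw'⟩
  exact ⟨w ∘ φ, hw.comp h, hw'.comp h⟩

theorem mem_limGraph_inv {n : ℕ} {l : Filter ℕ} {G : ℕ → GLn n} {w u : Vec n} :
    (u, w) ∈ limGraph l (fun m => (G m)⁻¹) ↔ (w, u) ∈ limGraph l G := by
  constructor
  · rintro ⟨v, hv, hv'⟩
    exact ⟨fun m => (G m)⁻¹ • v m, hv', by simpa only [smul_inv_smul] using hv⟩
  · rintro ⟨v, hv, hv'⟩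
    exact ⟨fun m => G m • v m, hv', by simpa only [inv_smul_smul] using hv⟩

/-- Unitarity passes to the limit. This is what makes the limiting map between orthogonal
complements an isometry. -/
theorem herm_limGraph {n : ℕ} {l : Filter ℕ} [l.NeBot] {G : ℕ → GLn n}
    (hG : ∀ m, G m ∈ unitary1n n) {w u w' u' : Vec n} (h : (w, u) ∈ limGraph l G)
    (h' : (w', u') ∈ limGraph l G) : herm u u' = herm w w' := by
  obtain ⟨v, hv, hv'⟩ := h
  obtain ⟨s, hs, hs'⟩ := h'
  refine tendsto_nhds_unique (tendsto_herm hv' hs') ?_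
  simpa only [herm_smul_smul (hG _)] using tendsto_herm hv hs

/-! ### The topology of projective space -/

/-- The saturation of an open set is the union of its preimages under scalings, each of which is
open. -/
theorem isOpenMap_mk' (n : ℕ) :
    IsOpenMap (Projectivization.mk' ℂ : {v : Vec n // v ≠ 0} → Proj n) := by
  intro U hU
  change IsOpen (Projectivization.mk' ℂ ⁻¹' (Projectivization.mk' ℂ '' U))
  have h : Projectivization.mk' ℂ ⁻¹' (Projectivization.mk' ℂ '' U) =
      ⋃ c : ℂˣ, (fun v : {v : Vec n // v ≠ 0} =>
        (⟨c • v.1, (smul_ne_zero_iff_ne c).2 v.2⟩ : {v : Vec n // v ≠ 0})) ⁻¹' U := by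
    ext v
    simp only [Set.mem_preimage, Set.mem_image, Set.mem_iUnion, Projectivization.mk'_eq_mk,
      Projectivization.mk_eq_mk_iff]
    constructor
    · rintro ⟨u, hu, c, hc⟩
      exact ⟨c, by simpa only [hc] using hu⟩
    · rintro ⟨c, hc⟩
      exact ⟨_, hc, c, rfl⟩
  rw [h]
  refine isOpen_iUnion fun c => hU.preimage ?_
  exact (continuous_subtype_val.const_smul c).subtype_mk _

theorem nhds_mk {n : ℕ} (v : Vec n) (hv : v ≠ 0) :
    𝓝 (Projectivization.mk ℂ v hv : Proj n) = map (Projectivization.mk' ℂ) (𝓝 ⟨v, hv⟩) :=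
  le_antisymm ((isOpenMap_mk' n).nhds_le ⟨v, hv⟩) (continuous_coinduced_rng.tendsto _)

theorem tendsto_mk {n : ℕ} {ι : Type*} {l : Filter ι} {u : ι → Vec n} {v : Vec n}
    (hu : ∀ i, u i ≠ 0) (hv : v ≠ 0) (h : Tendsto u l (𝓝 v)) :
    Tendsto (fun i => (Projectivization.mk ℂ (u i) (hu i) : Proj n)) l
      (𝓝 (Projectivization.mk ℂ v hv)) := by
  have h1 : Tendsto (fun i => (⟨u i, hu i⟩ : {v : Vec n // v ≠ 0})) l (𝓝 ⟨v, hv⟩) :=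
    tendsto_subtype_rng.2 h
  have h2 := (continuous_coinduced_rng (f := (Projectivization.mk' ℂ : _ → Proj n))).tendsto ⟨v, hv⟩
  exact h2.comp h1

/-- Needed to extract sequences from accumulation points of orbits. -/
instance {n : ℕ} (p : Proj n) : (𝓝 p).IsCountablyGenerated := by
  rw [← p.mk_rep, nhds_mk]
  infer_instance

/-- A convergent family of points of projective space has a convergent family of lifts. -/
theorem exists_lift_tendsto {n : ℕ} {ι : Type*} {l : Filter ι} {p : ι → Proj n} {v : Vec n}
    (hv : v ≠ 0) (h : Tendsto p l (𝓝 (Projectivization.mk ℂ v hv))) :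
    ∃ (u : ι → Vec n) (hu : ∀ i, u i ≠ 0),
      (∀ i, p i = Projectivization.mk ℂ (u i) (hu i)) ∧ Tendsto u l (𝓝 v) := by
  obtain ⟨j, hj⟩ := Function.ne_iff.1 hv
  have hj : v j ≠ 0 := hj
  classical
  -- A local section near `[v]`: the lift is normalised so that its `j`-th coordinate equals `v j`.
  -- Where that coordinate vanishes, away from `[v]`, an arbitrary lift is used.
  let s : Proj n → Vec n := fun q => if q.rep j = 0 then q.rep else (v j / q.rep j) • q.rep
  have hs0 : ∀ q, s q ≠ 0 := by
    intro q
    by_cases hq : q.rep j = 0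
    · simp only [s, if_pos hq]; exact q.rep_nonzero
    · simp only [s, if_neg hq]; exact smul_ne_zero (div_ne_zero hj hq) q.rep_nonzero
  have hsq : ∀ q, q = Projectivization.mk ℂ (s q) (hs0 q) := by
    intro q
    conv_lhs => rw [← q.mk_rep]
    rw [Projectivization.mk_eq_mk_iff']
    by_cases hq : q.rep j = 0
    · exact ⟨1, by simp only [s, if_pos hq, one_smul]⟩
    · refine ⟨q.rep j / v j, ?_⟩
      simp only [s, if_neg hq, smul_smul]
      rw [div_mul_div_cancel₀ hj, div_self hq, one_smul]
  have hsv : Tendsto s (𝓝 (Projectivization.mk ℂ v hv)) (𝓝 v) := by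
    rw [nhds_mk, tendsto_map'_iff]
    have h1 : Tendsto (fun u : {v : Vec n // v ≠ 0} => u.1) (𝓝 ⟨v, hv⟩) (𝓝 v) :=
      continuous_subtype_val.tendsto _
    have h1j := tendsto_pi_nhds.1 h1 j
    have h2 : Tendsto (fun u : {v : Vec n // v ≠ 0} => (v j / u.1 j) • u.1) (𝓝 ⟨v, hv⟩) (𝓝 v) := by
      have h3 := ((tendsto_const_nhds (x := v j)).div h1j hj).smul h1
      rwa [div_self hj, one_smul] at h3
    refine h2.congr' ?_
    filter_upwards [h1j.eventually_ne hj] with u hu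
    obtain ⟨a, ha⟩ := Projectivization.exists_smul_eq_mk_rep ℂ u.1 u.2
    have hr : (Projectivization.mk' ℂ u).rep = (a : ℂ) • u.1 := ha.symm
    have ha0 := a.ne_zero
    have hne : ((a : ℂ) • u.1) j ≠ 0 := by
      simp only [Pi.smul_apply, smul_eq_mul]; exact mul_ne_zero ha0 hu
    simp only [Function.comp_apply, s, hr, if_neg hne, smul_smul]
    congr 1
    simp only [Pi.smul_apply, smul_eq_mul]
    field_simp
  exact ⟨fun i => s (p i), fun i => hs0 _, fun i => hsq _, hsv.comp h⟩

/-- The Hermitian form at a lift of a boundary point of the ball is zero. -/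
theorem herm_self_of_mem_frontier {n : ℕ} {p : Proj n} (hp : p ∈ frontier (ball n)) :
    herm p.rep p.rep = 0 := by
  have hb : ∀ u : {v : Vec n // v ≠ 0},
      Projectivization.mk' ℂ u ∈ ball n ↔ (herm u.1 u.1).re < 0 := by
    intro u
    obtain ⟨a, ha⟩ := Projectivization.exists_smul_eq_mk_rep ℂ u.1 u.2
    have h1 : herm (Projectivization.mk' ℂ u).rep (Projectivization.mk' ℂ u).rep =
        ((Complex.normSq a : ℝ) : ℂ) * herm u.1 u.1 := by
      change herm (Projectivization.mk ℂ u.1 u.2).rep (Projectivization.mk ℂ u.1 u.2).rep = _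
      rw [← ha, Units.smul_def, herm_smul_left, herm_smul_right, ← mul_assoc, Complex.star_def,
        Complex.mul_conj]
    change (herm (Projectivization.mk' ℂ u).rep (Projectivization.mk' ℂ u).rep).re < 0 ↔ _
    have ha0 : 0 < Complex.normSq (a : ℂ) := Complex.normSq_pos.2 a.ne_zero
    rw [h1, Complex.re_ofReal_mul]
    constructor
    · intro h; by_contra h2; exact absurd (mul_nonneg ha0.le (not_lt.1 h2)) (not_le.2 h)
    · exact fun h => mul_neg_of_pos_of_neg ha0 h
  have ht : Tendsto (fun u : {v : Vec n // v ≠ 0} => (herm u.1 u.1).re) (𝓝 ⟨p.rep, p.rep_nonzero⟩)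
      (𝓝 (herm p.rep p.rep).re) := by
    have h1 : Tendsto (fun u : {v : Vec n // v ≠ 0} => u.1) (𝓝 ⟨p.rep, p.rep_nonzero⟩) (𝓝 p.rep) :=
      continuous_subtype_val.tendsto _
    exact (Complex.continuous_re.tendsto _).comp (tendsto_herm h1 h1)
  have hn : 𝓝 p = map (Projectivization.mk' ℂ) (𝓝 ⟨p.rep, p.rep_nonzero⟩) := by
    rw [← nhds_mk, p.mk_rep]
  rw [← herm_self_ofReal_re, Complex.ofReal_eq_zero]
  rw [frontier_eq_closure_inter_closure, Set.mem_inter_iff, mem_closure_iff_frequently,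
    mem_closure_iff_frequently, hn, frequently_map, frequently_map] at hp
  rcases lt_trichotomy (herm p.rep p.rep).re 0 with h | h | h
  · refine absurd ?_ hp.2
    filter_upwards [ht.eventually_lt_const h] with u hu
    exact not_not.2 ((hb u).2 hu)
  · exact h
  · refine absurd ?_ hp.1
    filter_upwards [ht.eventually_const_lt h] with u hu
    exact fun h2 => absurd ((hb u).1 h2) hu.not_gt

/-! ### Convergence in the unitary group -/

theorem tendsto_smul_vec {n : ℕ} {ι : Type*} {l : Filter ι} {g : ι → GLn n} {g₀ : GLn n}
    {v : ι → Vec n} {v₀ : Vec n} (hg : Tendsto g l (𝓝 g₀)) (hv : Tendsto v l (𝓝 v₀)) :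
    Tendsto (fun i => g i • v i) l (𝓝 (g₀ • v₀)) :=
  tendsto_mulVec ((Units.continuous_val.tendsto g₀).comp hg) hv

/-- The inverse is `H g* H`, a continuous function of the entries. So entrywise convergence already
gives an invertible limit and convergence in the topology of the units. -/
theorem exists_tendsto_of_tendsto_val {n : ℕ} {ι : Type*} {l : Filter ι} [l.NeBot]
    {g : ι → GLn n} (hg : ∀ i, g i ∈ unitary1n n) {A : Matrix (Fin (n + 1)) (Fin (n + 1)) ℂ}
    (h : Tendsto (fun i => (g i).1) l (𝓝 A)) :
    ∃ g₀ ∈ unitary1n n, g₀.1 = A ∧ Tendsto g l (𝓝 g₀) := by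
  have hs : Tendsto (fun i => (g i).1ᴴ) l (𝓝 Aᴴ) :=
    (continuous_id.matrix_conjTranspose.tendsto A).comp h
  have hA : A * formMatrix n * Aᴴ = formMatrix n := by
    have h1 := (h.mul (tendsto_const_nhds (x := formMatrix n))).mul hs
    refine tendsto_nhds_unique h1 ?_
    simp only [fun i => unitary1n_mul_conj (hg i)]
    exact tendsto_const_nhds
  have h1 : A * (formMatrix n * Aᴴ * formMatrix n) = 1 := by
    rw [← Matrix.mul_assoc, ← Matrix.mul_assoc, hA, formMatrix_mul_self]
  refine ⟨⟨A, formMatrix n * Aᴴ * formMatrix n, h1, mul_eq_one_comm.1 h1⟩, hA, rfl, ?_⟩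
  rw [Units.isEmbedding_embedProduct.isInducing.tendsto_nhds_iff]
  refine h.prodMk_nhds ((MulOpposite.continuous_op.tendsto _).comp ?_)
  simp only [fun i => unitary1n_inv_eq (hg i)]
  exact (tendsto_const_nhds.mul hs).mul tendsto_const_nhds

theorem exists_subseq_tendsto_of_bounded {n : ℕ} {g : ℕ → GLn n} (hg : ∀ i, g i ∈ unitary1n n)
    {R : ℝ} (hR : ∀ m i j, ‖(g m).1 i j‖ ≤ R) :
    ∃ g₀ ∈ unitary1n n, ∃ φ : ℕ → ℕ, StrictMono φ ∧ Tendsto (g ∘ φ) atTop (𝓝 g₀) := by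
  let S : Set (Fin (n + 1) → Fin (n + 1) → ℂ) :=
    Set.univ.pi fun _ => Set.univ.pi fun _ => Metric.closedBall 0 R
  have hS : IsCompact S := isCompact_univ_pi fun _ => isCompact_univ_pi fun _ =>
    isCompact_closedBall _ _
  obtain ⟨A, -, φ, hφ, hA⟩ := hS.tendsto_subseq (x := fun m => fun i j => (g m).1 i j)
    (fun m i _ j _ => by simpa using hR m i j)
  obtain ⟨g₀, h0, -, h⟩ := exists_tendsto_of_tendsto_val (l := atTop) (g := g ∘ φ)
    (fun i => hg _) (A := Matrix.of A) hA
  exact ⟨g₀, h0, φ, hφ, h⟩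

/-! ### The maximal compact subgroup -/

theorem mem_compactSubgroup_iff {n : ℕ} {g : GLn n} :
    g ∈ compactSubgroup n ↔ g.1 * g.1ᴴ = 1 ∧ g ∈ unitary1n n :=
  and_congr_left' Matrix.mem_unitaryGroup_iff

theorem compactSubgroup_mul {n : ℕ} {g h : GLn n} (hg : g ∈ compactSubgroup n)
    (hh : h ∈ compactSubgroup n) : g * h ∈ compactSubgroup n :=
  ⟨mul_mem hg.1 hh.1, mul_mem hg.2 hh.2⟩

theorem compactSubgroup_inv {n : ℕ} {g : GLn n} (hg : g ∈ compactSubgroup n) :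
    g⁻¹ ∈ compactSubgroup n := by
  refine mem_compactSubgroup_iff.2 ⟨?_, inv_mem hg.2⟩
  have h1 : (g⁻¹).1 = g.1ᴴ := Units.inv_eq_of_mul_eq_one_right (mem_compactSubgroup_iff.1 hg).1
  have h2 : g⁻¹.1 * g.1 = 1 := by rw [← Units.val_mul, inv_mul_cancel, Units.val_one]
  rw [h1, Matrix.conjTranspose_conjTranspose, ← h1, h2]

theorem exists_mem_compactSubgroup {n : ℕ} {A : Matrix (Fin (n + 1)) (Fin (n + 1)) ℂ}
    (h1 : A * Aᴴ = 1) (h2 : A * formMatrix n = formMatrix n * A) :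
    ∃ g ∈ compactSubgroup n, g.1 = A := by
  refine ⟨⟨A, Aᴴ, h1, mul_eq_one_comm.1 h1⟩, mem_compactSubgroup_iff.2 ⟨h1, ?_⟩, rfl⟩
  change A * formMatrix n * Aᴴ = formMatrix n
  rw [h2, Matrix.mul_assoc, h1, Matrix.mul_one]

/-- The matrix of the form, as an element of the compact group. -/
def formGL (n : ℕ) : GLn n :=
  ⟨formMatrix n, formMatrix n, formMatrix_mul_self n, formMatrix_mul_self n⟩

theorem formGL_mem (n : ℕ) : formGL n ∈ compactSubgroup n := by
  refine mem_compactSubgroup_iff.2 ⟨?_, ?_⟩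
  · change formMatrix n * (formMatrix n)ᴴ = 1
    rw [formMatrix_conjTranspose, formMatrix_mul_self]
  · change formMatrix n * formMatrix n * (formMatrix n)ᴴ = formMatrix n
    rw [formMatrix_conjTranspose, formMatrix_mul_self, Matrix.one_mul]

theorem formGL_smul {n : ℕ} (v : Vec n) (i : Fin (n + 1)) :
    (formGL n • v) i = v (Equiv.swap 0 (Fin.last n) i) := formMatrix_mulVec v i

theorem sum_normSq_eq {n : ℕ} (v : Vec n) :
    ((∑ i, Complex.normSq (v i) : ℝ) : ℂ) = star v ⬝ᵥ v := by
  simp only [dotProduct, Pi.star_apply, Complex.star_def, Complex.ofReal_sum,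
    Complex.normSq_eq_conj_mul_self]

theorem sum_normSq_smul {n : ℕ} {g : GLn n} (hg : g ∈ compactSubgroup n) (v : Vec n) :
    ∑ i, Complex.normSq ((g • v) i) = ∑ i, Complex.normSq (v i) := by
  have h : g.1ᴴ * g.1 = 1 := mul_eq_one_comm.1 (mem_compactSubgroup_iff.1 hg).1
  have h2 : ((∑ i, Complex.normSq ((g • v) i) : ℝ) : ℂ) = ((∑ i, Complex.normSq (v i) : ℝ) : ℂ) := by
    rw [sum_normSq_eq, sum_normSq_eq, smul_vec_def, Matrix.star_mulVec, ← Matrix.dotProduct_mulVec,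
      Matrix.mulVec_mulVec, h, Matrix.one_mulVec]
  exact_mod_cast h2

/-! ### The diagonal group -/

theorem cartanMatrix_mul (n : ℕ) (s t : ℝ) :
    cartanMatrix n s * cartanMatrix n t = cartanMatrix n (s + t) := by
  rw [cartanMatrix, cartanMatrix, cartanMatrix, Matrix.diagonal_mul_diagonal]
  congr 1
  ext i
  split_ifs
  · rw [Real.exp_add, Complex.ofReal_mul]
  · rw [neg_add, Real.exp_add, Complex.ofReal_mul]
  · rw [one_mul]

theorem cartanMatrix_zero (n : ℕ) : cartanMatrix n 0 = 1 := by
  rw [cartanMatrix, ← Matrix.diagonal_one]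
  congr 1
  ext i
  split_ifs <;> simp

/-- The matrix `diag (e^t, 1, …, 1, e^{-t})` as an invertible matrix. -/
def cartanGL (n : ℕ) (t : ℝ) : GLn n :=
  ⟨cartanMatrix n t, cartanMatrix n (-t),
    by rw [cartanMatrix_mul, add_neg_cancel, cartanMatrix_zero],
    by rw [cartanMatrix_mul, neg_add_cancel, cartanMatrix_zero]⟩

theorem cartanGL_inv (n : ℕ) (t : ℝ) : (cartanGL n t)⁻¹ = cartanGL n (-t) := by
  rw [inv_eq_iff_mul_eq_one]
  ext1
  change cartanMatrix n t * cartanMatrix n (-t) = 1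
  rw [cartanMatrix_mul, add_neg_cancel, cartanMatrix_zero]

theorem cartanGL_smul_zero {n : ℕ} (t : ℝ) (v : Vec n) :
    (cartanGL n t • v) 0 = Real.exp t * v 0 := by
  rw [smul_vec_def]
  simp [cartanGL, cartanMatrix, Matrix.mulVec_diagonal]

theorem cartanGL_smul_last {n : ℕ} (hn : 2 ≤ n) (t : ℝ) (v : Vec n) :
    (cartanGL n t • v) (Fin.last n) = Real.exp (-t) * v (Fin.last n) := by
  rw [smul_vec_def]
  simp only [cartanGL, cartanMatrix, Matrix.mulVec_diagonal, if_neg (zero_ne_last hn).symm, if_true]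

theorem cartanGL_smul_mid {n : ℕ} (t : ℝ) (v : Vec n) {i : Fin (n + 1)} (h0 : i ≠ 0)
    (hl : i ≠ Fin.last n) : (cartanGL n t • v) i = v i := by
  rw [smul_vec_def]
  simp only [cartanGL, cartanMatrix, Matrix.mulVec_diagonal, if_neg h0, if_neg hl, one_mul]

theorem ext_vec {n : ℕ} {v w : Vec n} (h0 : v 0 = w 0)
    (hm : ∀ i, i ≠ 0 → i ≠ Fin.last n → v i = w i) (hl : v (Fin.last n) = w (Fin.last n)) :
    v = w := by
  ext i
  by_cases h : i = 0
  · rw [h, h0]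
  by_cases h' : i = Fin.last n
  · rw [h', hl]
  exact hm i h h'

theorem ext_GL {n : ℕ} {g h : GLn n} (H : ∀ v : Vec n, g • v = h • v) : g = h := by
  apply Units.ext
  exact Matrix.ext_of_mulVec_single fun i => H (Pi.single i 1)

/-- The form matrix exchanges the two extreme coordinates. Since it lies in the compact group, it
turns the decomposition of an inverse, whose parameter is `-t`, into one with parameter `t ≥ 0`. -/
theorem formGL_conj_cartanGL {n : ℕ} (hn : 2 ≤ n) (t : ℝ) :
    formGL n * cartanGL n t * formGL n = cartanGL n (-t) := by
  refine ext_GL fun v => ?_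
  rw [mul_smul, mul_smul]
  refine ext_vec ?_ (fun i h0 hl => ?_) ?_
  · rw [formGL_smul, Equiv.swap_apply_left, cartanGL_smul_last hn, formGL_smul,
      Equiv.swap_apply_right, cartanGL_smul_zero]
  · rw [formGL_smul, Equiv.swap_apply_of_ne_of_ne h0 hl, cartanGL_smul_mid _ _ h0 hl, formGL_smul,
      Equiv.swap_apply_of_ne_of_ne h0 hl, cartanGL_smul_mid _ _ h0 hl]
  · rw [formGL_smul, Equiv.swap_apply_right, cartanGL_smul_zero, formGL_smul,
      Equiv.swap_apply_left, cartanGL_smul_last hn, neg_neg]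

theorem formGL_mul_self (n : ℕ) : formGL n * formGL n = 1 := Units.ext (formMatrix_mul_self n)

theorem cartanGL_mem {n : ℕ} (hn : 2 ≤ n) (t : ℝ) : cartanGL n t ∈ unitary1n n := by
  have h1 : (cartanGL n t).1ᴴ = (cartanGL n t).1 := by
    change (cartanMatrix n t)ᴴ = cartanMatrix n t
    rw [cartanMatrix, Matrix.diagonal_conjTranspose]
    congr 1
    ext i
    simp only [Pi.star_apply]
    split_ifs <;> simp only [Complex.star_def, Complex.conj_ofReal, map_one]
  change (cartanGL n t).1 * (formGL n).1 * (cartanGL n t).1ᴴ = (formGL n).1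
  rw [h1, ← Units.val_mul, ← Units.val_mul]
  congr 1
  have h2 := formGL_conj_cartanGL hn t
  have h3 : formGL n * cartanGL n t = cartanGL n (-t) * formGL n := by
    rw [← h2, mul_assoc _ (formGL n), formGL_mul_self, mul_one]
  rw [mul_assoc, h3, ← cartanGL_inv, mul_inv_cancel_left]

/-! ### The Cartan decomposition -/

/-- A unitary reflection that takes a vector to a given vector of the same length. -/
theorem exists_compactSubgroup_smul_eq {n : ℕ} {f u : Vec n} (hf : formMatrix n *ᵥ f = f)
    (hu : formMatrix n *ᵥ u = u)
    (hfu : ∑ i, Complex.normSq (f i) = ∑ i, Complex.normSq (u i)) :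
    ∃ k ∈ compactSubgroup n, k • f = u ∧ ∀ o : Vec n, formMatrix n *ᵥ o = -o → k • o = o := by
  rcases eq_or_ne f u with rfl | hne
  · exact ⟨1, mem_compactSubgroup_iff.2 ⟨by simp, one_mem _⟩, one_smul _ _, fun o _ => one_smul _ _⟩
  set w : Vec n := f - u with hw
  have hw0 : w ≠ 0 := sub_ne_zero.2 hne
  have hHw : formMatrix n *ᵥ w = w := by rw [hw, Matrix.mulVec_sub, hf, hu]
  have hwH : star w ᵥ* formMatrix n = star w := by
    conv_lhs => rw [← formMatrix_conjTranspose n]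
    rw [← Matrix.star_mulVec, hHw]
  set c : ℂ := star w ⬝ᵥ f with hc
  set r : ℂ := star w ⬝ᵥ w with hr
  -- Equality of the lengths of `f` and `u` gives `|w|² = 2 Re c`, which is exactly the condition
  -- for `1 - c⁻¹ w w*` to be unitary.
  have hrc : r = c + star c := by
    have h1 := congrArg (fun x : ℝ => (x : ℂ)) hfu
    simp only [sum_normSq_eq] at h1
    have h2 : star c = star f ⬝ᵥ w := by
      rw [hc, Matrix.star_dotProduct, star_star, dotProduct_comm]
    rw [h2, hc, hr, hw]
    simp only [star_sub, sub_dotProduct, dotProduct_sub]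
    rw [h1]; ring
  have hr0 : r ≠ 0 := by
    rw [hr, ← sum_normSq_eq]
    exact_mod_cast (sum_normSq_pos hw0).ne'
  have hc0 : c ≠ 0 := by
    rintro h
    rw [h, star_zero, add_zero] at hrc
    exact hr0 hrc
  have hc0' : star c ≠ 0 := star_ne_zero.2 hc0
  set A : Matrix (Fin (n + 1)) (Fin (n + 1)) ℂ := 1 - c⁻¹ • Matrix.vecMulVec w (star w) with hA
  have hWW : Matrix.vecMulVec w (star w) * Matrix.vecMulVec w (star w) =
      r • Matrix.vecMulVec w (star w) := by
    rw [Matrix.vecMulVec_mul_vecMulVec, ← hr, Matrix.vecMulVec_smul]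
  have hAv : ∀ v, A *ᵥ v = v - (c⁻¹ * (star w ⬝ᵥ v)) • w := by
    intro v
    rw [hA, Matrix.sub_mulVec, Matrix.one_mulVec, Matrix.smul_mulVec, Matrix.vecMulVec_mulVec,
      op_smul_eq_smul, smul_smul]
  have hAs : Aᴴ = 1 - (star c)⁻¹ • Matrix.vecMulVec w (star w) := by
    rw [hA, Matrix.conjTranspose_sub, Matrix.conjTranspose_one, Matrix.conjTranspose_smul,
      Matrix.conjTranspose_vecMulVec, star_star, star_inv₀]
  obtain ⟨k, hk, hkA⟩ := exists_mem_compactSubgroup (n := n) (A := A) (by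
    rw [hAs, hA, Matrix.sub_mul, Matrix.mul_sub, Matrix.mul_sub, Matrix.mul_one, Matrix.mul_one,
      Matrix.one_mul, Matrix.smul_mul, Matrix.mul_smul, hWW, smul_smul, smul_smul, hrc]
    have : c⁻¹ * (star c)⁻¹ * (c + star c) = (star c)⁻¹ + c⁻¹ := by
      field_simp
    rw [this, add_smul]
    abel) (by
    rw [hA, Matrix.sub_mul, Matrix.mul_sub, Matrix.smul_mul, Matrix.mul_smul,
      Matrix.vecMulVec_mul, Matrix.mul_vecMulVec, hwH, hHw, Matrix.mul_one, Matrix.one_mul])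
  refine ⟨k, hk, ?_, fun o ho => ?_⟩
  · rw [smul_vec_def, hkA, hAv, ← hc, inv_mul_cancel₀ hc0, one_smul, hw, sub_sub_cancel]
  -- The vectors `w` and `o` lie in the eigenspaces of the form matrix for `1` and `-1`, so they are
  -- Euclidean orthogonal and the reflection fixes `o`.
  · have h1 : star w ⬝ᵥ o = 0 := by
      have h2 : star w ⬝ᵥ (formMatrix n *ᵥ o) = star w ⬝ᵥ o := by
        rw [Matrix.dotProduct_mulVec, hwH]
      rw [ho, dotProduct_neg] at h2
      exact self_eq_neg.1 h2.symm
    rw [smul_vec_def, hkA, hAv, h1, mul_zero, zero_smul, sub_zero]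

theorem herm_single_zero {n : ℕ} (v : Vec n) : herm v (Pi.single 0 1) = v (Fin.last n) := by
  rw [herm_eq, Finset.sum_eq_single (Fin.last n)]
  · simp
  · intro i _ hi
    have : Equiv.swap 0 (Fin.last n) i ≠ 0 := by
      intro h
      rw [Equiv.swap_apply_eq_iff, Equiv.swap_apply_left] at h
      exact hi h
    simp [this]
  · simp

theorem herm_single_last {n : ℕ} (v : Vec n) : herm v (Pi.single (Fin.last n) 1) = v 0 := by
  rw [herm_eq, Finset.sum_eq_single 0]
  · simp
  · intro i _ hi
    have : Equiv.swap 0 (Fin.last n) i ≠ Fin.last n := by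
      intro h
      rw [Equiv.swap_apply_eq_iff, Equiv.swap_apply_right] at h
      exact hi h
    simp [this]
  · simp

/-- The base point of the ball: a negative vector fixed up to scalars by the compact group. -/
def baseVec (n : ℕ) : Vec n := Pi.single 0 1 - Pi.single (Fin.last n) 1

theorem herm_baseVec {n : ℕ} (v : Vec n) : herm v (baseVec n) = v (Fin.last n) - v 0 := by
  rw [baseVec, herm_sub_right, herm_single_zero, herm_single_last]

theorem baseVec_zero {n : ℕ} (hn : 2 ≤ n) : baseVec n 0 = 1 := by
  simp [baseVec, zero_ne_last hn]

theorem baseVec_last {n : ℕ} (hn : 2 ≤ n) : baseVec n (Fin.last n) = -1 := by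
  simp [baseVec, (zero_ne_last hn).symm]

theorem baseVec_mid {n : ℕ} {i : Fin (n + 1)} (h0 : i ≠ 0) (hl : i ≠ Fin.last n) :
    baseVec n i = 0 := by
  simp [baseVec, h0, hl]

/-- The Euclidean form is the indefinite form plus the square of the pairing with the base vector.
Hence an element of `U(1,n)` that fixes this vector up to a unit scalar preserves both forms. -/
theorem formMatrix_add_baseVec {n : ℕ} (hn : 2 ≤ n) :
    formMatrix n + Matrix.vecMulVec (baseVec n) (star (baseVec n)) = 1 := by
  refine Matrix.ext_of_mulVec_single fun j => ?_
  rw [Matrix.add_mulVec, Matrix.vecMulVec_mulVec, op_smul_eq_smul, Matrix.one_mulVec,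
    dotProduct_single_one, Pi.star_apply]
  have h0 := zero_ne_last hn
  refine ext_vec ?_ (fun i hi hi' => ?_) ?_
  · rw [Pi.add_apply, formMatrix_mulVec, Equiv.swap_apply_left, Pi.smul_apply, baseVec_zero hn]
    by_cases hj : j = 0
    · rw [hj, baseVec_zero hn]; simp [h0.symm]
    by_cases hj' : j = Fin.last n
    · rw [hj', baseVec_last hn]; simp [h0]
    · rw [baseVec_mid hj hj']; simp [Ne.symm hj, Ne.symm hj']
  · rw [Pi.add_apply, formMatrix_mulVec, Equiv.swap_apply_of_ne_of_ne hi hi', Pi.smul_apply,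
      baseVec_mid hi hi', smul_zero, add_zero]
  · rw [Pi.add_apply, formMatrix_mulVec, Equiv.swap_apply_right, Pi.smul_apply, baseVec_last hn]
    by_cases hj : j = 0
    · rw [hj, baseVec_zero hn]; simp [h0.symm]
    by_cases hj' : j = Fin.last n
    · rw [hj', baseVec_last hn]; simp [h0]
    · rw [baseVec_mid hj hj']; simp [Ne.symm hj, Ne.symm hj']

/-- An element of `U(1,n)` that fixes the base point belongs to the compact group. -/
theorem mem_compactSubgroup_of_smul_baseVec {n : ℕ} (hn : 2 ≤ n) {g : GLn n}
    (hg : g ∈ unitary1n n) {θ : ℂ} (hθ : θ * star θ = 1) (h : g • baseVec n = θ • baseVec n) :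
    g ∈ compactSubgroup n := by
  refine mem_compactSubgroup_iff.2 ⟨?_, hg⟩
  have h1 : g.1 * (formMatrix n + Matrix.vecMulVec (baseVec n) (star (baseVec n))) * g.1ᴴ =
      formMatrix n + Matrix.vecMulVec (baseVec n) (star (baseVec n)) := by
    rw [Matrix.mul_add, Matrix.add_mul, unitary1n_mul_conj hg, Matrix.mul_vecMulVec,
      Matrix.vecMulVec_mul, ← Matrix.star_mulVec, ← smul_vec_def, h, star_smul,
      Matrix.smul_vecMulVec, Matrix.vecMulVec_smul, smul_smul, hθ, one_smul]
  rwa [formMatrix_add_baseVec hn, Matrix.mul_one] at h1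

/-- The Cartan decomposition of `U(1,n)`. -/
theorem exists_cartan_decomposition {n : ℕ} (hn : 2 ≤ n) {g : GLn n} (hg : g ∈ unitary1n n) :
    ∃ k ∈ compactSubgroup n, ∃ k' ∈ compactSubgroup n, ∃ t : ℝ, 0 ≤ t ∧
      g = k * cartanGL n t * k' := by
  have h0 := zero_ne_last hn
  set o := baseVec n with ho
  set p := g • o with hp
  -- This is the component of `p` along `o`. The remainder `v` is fixed by the form matrix, and `⟨p,
  -- p⟩ = ⟨o, o⟩ = -2` becomes `|v|² = 2(|α|² - 1)`. Thus `|α|` and `s` below play the roles of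
  -- `cosh t` and `sinh t`.
  set α : ℂ := (p 0 - p (Fin.last n)) / 2 with hα
  set v : Vec n := p - α • o with hv
  have hv0 : v 0 = (p 0 + p (Fin.last n)) / 2 := by
    simp only [hv, Pi.sub_apply, Pi.smul_apply, ho, baseVec_zero hn, hα, smul_eq_mul]; ring
  have hvl : v (Fin.last n) = (p 0 + p (Fin.last n)) / 2 := by
    simp only [hv, Pi.sub_apply, Pi.smul_apply, ho, baseVec_last hn, hα, smul_eq_mul]; ring
  have hHv : formMatrix n *ᵥ v = v := by
    refine ext_vec ?_ (fun i hi hi' => ?_) ?_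
    · rw [formMatrix_mulVec, Equiv.swap_apply_left, hv0, hvl]
    · rw [formMatrix_mulVec, Equiv.swap_apply_of_ne_of_ne hi hi']
    · rw [formMatrix_mulVec, Equiv.swap_apply_right, hv0, hvl]
  have hoo : herm o o = -2 := by
    rw [ho, herm_baseVec, baseVec_zero hn, baseVec_last hn]; norm_num
  have hpo : herm p o = -2 * α := by rw [ho, herm_baseVec, hα]; ring
  have hvn : ∑ i, Complex.normSq (v i) = 2 * (Complex.normSq α - 1) := by
    have h1 := herm_self_eq hn v
    rw [hv0, hvl, sub_self, map_zero, sub_zero] at h1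
    have h2 : herm v v = 2 * ((Complex.normSq α : ℝ) - 1 : ℂ) := by
      rw [hv, herm_sub_left, herm_sub_right, herm_sub_right, herm_smul_left, herm_smul_right,
        herm_smul_left, herm_smul_right, hoo, ← star_herm p o, hpo, hp, herm_smul_smul hg, hoo,
        ← Complex.mul_conj]
      simp only [Complex.star_def, map_mul, map_neg, map_ofNat]
      ring
    rw [h2] at h1
    exact_mod_cast h1.symm
  have hα1 : 1 ≤ Complex.normSq α := by
    have : 0 ≤ ∑ i, Complex.normSq (v i) := Finset.sum_nonneg fun i _ => Complex.normSq_nonneg _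
    linarith
  have hα0 : α ≠ 0 := by
    rintro h
    rw [h, map_zero] at hα1
    linarith
  set a : ℝ := ‖α‖ with ha
  have haa : a * a = Complex.normSq α := by rw [Complex.normSq_eq_norm_sq, sq]
  have ha0 : 0 < a := norm_pos_iff.2 hα0
  have ha1 : 1 ≤ a := by nlinarith
  set s : ℝ := Real.sqrt (a * a - 1) with hs
  have hss : s * s = a * a - 1 := Real.mul_self_sqrt (by nlinarith)
  have hs0 : 0 ≤ s := Real.sqrt_nonneg _
  set θ : ℂ := α / a with hθ
  have haC : (a : ℂ) ≠ 0 := by exact_mod_cast ha0.ne'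
  have hθα : θ * a = α := div_mul_cancel₀ _ haC
  have hθ1 : θ * star θ = 1 := by
    rw [Complex.star_def, Complex.mul_conj, hθ, Complex.normSq_div, Complex.normSq_ofReal, ← haa,
      div_self (by positivity)]
    simp
  have hθ0 : θ ≠ 0 := left_ne_zero_of_mul_eq_one hθ1
  set f : Vec n := Pi.single 0 1 + Pi.single (Fin.last n) 1 with hf
  have hf0 : f 0 = 1 := by simp [hf, h0]
  have hfl : f (Fin.last n) = 1 := by simp [hf, h0.symm]
  have hfm : ∀ i, i ≠ 0 → i ≠ Fin.last n → f i = 0 := by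
    intro i hi hi'; simp [hf, hi, hi']
  have hHf : formMatrix n *ᵥ f = f := by
    refine ext_vec ?_ (fun i hi hi' => ?_) ?_
    · rw [formMatrix_mulVec, Equiv.swap_apply_left, hf0, hfl]
    · rw [formMatrix_mulVec, Equiv.swap_apply_of_ne_of_ne hi hi']
    · rw [formMatrix_mulVec, Equiv.swap_apply_right, hf0, hfl]
  have hff : ∑ i, Complex.normSq (f i) = 2 := by
    have h1 := herm_self_eq hn f
    rw [hf0, hfl, sub_self, map_zero, sub_zero] at h1
    have h2 : herm f f = 2 := by
      have h3 : herm f f = herm f (Pi.single 0 1 + Pi.single (Fin.last n) 1) := rfl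
      rw [h3, herm_add_right, herm_single_zero, herm_single_last, hf0, hfl]
      norm_num
    rw [h2] at h1
    exact_mod_cast h1.symm
  -- The direction of `v`, scaled to the length of `f`. If `s = 0` then `v = 0` and any such vector
  -- serves, for instance `f`.
  obtain ⟨u, hHu, huu, hvu⟩ : ∃ u : Vec n, formMatrix n *ᵥ u = u ∧
      ∑ i, Complex.normSq (f i) = ∑ i, Complex.normSq (u i) ∧ v = (θ * s) • u := by
    by_cases hs' : s = 0
    · refine ⟨f, hHf, rfl, ?_⟩
      by_contra hne
      rw [hs', Complex.ofReal_zero, mul_zero, zero_smul] at hne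
      have h1 := sum_normSq_pos hne
      rw [hvn, ← haa] at h1
      rw [hs'] at hss
      linarith
    · have hsC : θ * (s : ℂ) ≠ 0 := mul_ne_zero hθ0 (by exact_mod_cast hs')
      refine ⟨(θ * s)⁻¹ • v, by rw [Matrix.mulVec_smul, hHv], ?_, by
        rw [smul_smul, mul_inv_cancel₀ hsC, one_smul]⟩
      have hθn : Complex.normSq θ = 1 := by
        rw [Complex.star_def, Complex.mul_conj] at hθ1
        exact_mod_cast hθ1
      simp only [Pi.smul_apply, smul_eq_mul, Complex.normSq_mul, ← Finset.mul_sum, hvn, hff,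
        Complex.normSq_inv, Complex.normSq_ofReal, hθn, ← haa, one_mul]
      rw [show a * a - 1 = s * s from hss.symm]
      field_simp
  obtain ⟨k, hk, hkf, hko⟩ := exists_compactSubgroup_smul_eq hHf hHu huu
  have hko' : k • o = o := by
    refine hko o (ext_vec ?_ (fun i hi hi' => ?_) ?_)
    · rw [formMatrix_mulVec, Equiv.swap_apply_left, Pi.neg_apply, ho, baseVec_zero hn,
        baseVec_last hn]
    · rw [formMatrix_mulVec, Equiv.swap_apply_of_ne_of_ne hi hi', Pi.neg_apply, ho,
        baseVec_mid hi hi', neg_zero]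
    · rw [formMatrix_mulVec, Equiv.swap_apply_right, Pi.neg_apply, ho, baseVec_zero hn,
        baseVec_last hn, neg_neg]
  -- Chosen so that `cosh t = a` and `sinh t = s`. Then the diagonal matrix sends `o` to `a • o + s
  -- • f`, and `k` carries this to `p` up to the phase `θ`.
  set t : ℝ := Real.log (a + s) with ht
  have has : 0 < a + s := by linarith
  have hexp : Real.exp t = a + s := Real.exp_log has
  have hexp' : Real.exp (-t) = a - s := by
    rw [Real.exp_neg, hexp]
    refine inv_eq_of_mul_eq_one_right ?_
    linarith
  have hat : cartanGL n t • o = (a : ℂ) • o + (s : ℂ) • f := by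
    refine ext_vec ?_ (fun i hi hi' => ?_) ?_
    · rw [cartanGL_smul_zero, hexp]
      simp [ho, baseVec_zero hn, hf0]
    · rw [cartanGL_smul_mid _ _ hi hi']
      simp [ho, baseVec_mid hi hi', hfm i hi hi']
    · rw [cartanGL_smul_last hn, hexp']
      simp only [ho, Pi.add_apply, Pi.smul_apply, smul_eq_mul, baseVec_last hn, hfl]
      push_cast
      ring
  have hgo : g • o = θ • (k * cartanGL n t) • o := by
    rw [mul_smul, hat, smul_add, smul_comm k, smul_comm k, hko', hkf, smul_add, smul_smul,
      smul_smul, hθα, ← hvu, hv, add_sub_cancel]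
  refine ⟨k, hk, (k * cartanGL n t)⁻¹ * g, ?_, t, Real.log_nonneg (by linarith), by group⟩
  refine mem_compactSubgroup_of_smul_baseVec hn
    (mul_mem (inv_mem (mul_mem hk.2 (cartanGL_mem hn t))) hg) hθ1 ?_
  rw [mul_smul, ← ho, hgo, smul_comm _ θ, inv_smul_smul]

/-! ### Sequences with convergent Cartan decompositions -/

/-- A Cartan decomposition of a sequence with convergent compact factors and divergent
translation lengths. -/
structure CartanSeq {n : ℕ} (G : ℕ → GLn n) where
  k : ℕ → GLn n
  k' : ℕ → GLn n
  κ : GLn n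
  κ' : GLn n
  t : ℕ → ℝ
  k_mem : ∀ m, k m ∈ compactSubgroup n
  k'_mem : ∀ m, k' m ∈ compactSubgroup n
  t_nonneg : ∀ m, 0 ≤ t m
  eq : ∀ m, G m = k m * cartanGL n (t m) * k' m
  κ_mem : κ ∈ compactSubgroup n
  κ'_mem : κ' ∈ compactSubgroup n
  k_tendsto : Tendsto k atTop (𝓝 κ)
  k'_tendsto : Tendsto k' atTop (𝓝 κ')
  t_tendsto : Tendsto t atTop atTop

namespace CartanSeq

variable {n : ℕ} {G : ℕ → GLn n}

/-- The Cartan decomposition of the inverse sequence. -/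
def inv (hn : 2 ≤ n) (C : CartanSeq G) : CartanSeq fun m => (G m)⁻¹ where
  k m := (C.k' m)⁻¹ * formGL n
  k' m := formGL n * (C.k m)⁻¹
  κ := C.κ'⁻¹ * formGL n
  κ' := formGL n * C.κ⁻¹
  t := C.t
  k_mem m := compactSubgroup_mul (compactSubgroup_inv (C.k'_mem m)) (formGL_mem n)
  k'_mem m := compactSubgroup_mul (formGL_mem n) (compactSubgroup_inv (C.k_mem m))
  t_nonneg := C.t_nonneg
  eq m := by
    have h : ((C.k' m)⁻¹ * formGL n) * cartanGL n (C.t m) * (formGL n * (C.k m)⁻¹) =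
        (C.k' m)⁻¹ * (formGL n * cartanGL n (C.t m) * formGL n) * (C.k m)⁻¹ := by
      simp only [mul_assoc]
    rw [h, formGL_conj_cartanGL hn, C.eq, ← cartanGL_inv]
    simp only [mul_inv_rev, mul_assoc]
  κ_mem := compactSubgroup_mul (compactSubgroup_inv C.κ'_mem) (formGL_mem n)
  κ'_mem := compactSubgroup_mul (formGL_mem n) (compactSubgroup_inv C.κ_mem)
  k_tendsto := C.k'_tendsto.inv.mul tendsto_const_nhds
  k'_tendsto := tendsto_const_nhds.mul C.k_tendsto.inv
  t_tendsto := C.t_tendsto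

/-- The attracting vector. -/
def attr (C : CartanSeq G) : Vec n := C.κ • Pi.single 0 1

/-- The repelling vector. -/
def rep (C : CartanSeq G) : Vec n := C.κ'⁻¹ • Pi.single (Fin.last n) 1

theorem attr_ne_zero (C : CartanSeq G) : C.attr ≠ 0 := by
  rw [attr, smul_ne_zero_iff_ne]
  intro h
  have := congrFun h 0
  simp at this

theorem rep_ne_zero (C : CartanSeq G) : C.rep ≠ 0 := by
  rw [rep, smul_ne_zero_iff_ne]
  intro h
  have := congrFun h (Fin.last n)
  simp at this

theorem herm_rep (C : CartanSeq G) (w : Vec n) : herm w C.rep = (C.κ' • w) 0 := by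
  rw [rep, ← herm_smul_smul C.κ'_mem.2, smul_inv_smul, herm_single_last]

theorem herm_attr (C : CartanSeq G) (w : Vec n) : herm w C.attr = (C.κ⁻¹ • w) (Fin.last n) := by
  rw [attr, ← herm_smul_smul (compactSubgroup_inv C.κ_mem).2, inv_smul_smul, herm_single_zero]

theorem tendsto_exp_neg (C : CartanSeq G) :
    Tendsto (fun m => ((Real.exp (-C.t m) : ℝ) : ℂ)) atTop (𝓝 0) := by
  have h := Real.tendsto_exp_neg_atTop_nhds_zero.comp C.t_tendsto
  rw [← Complex.ofReal_zero]
  exact (Complex.continuous_ofReal.tendsto 0).comp h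

/-- Separates the rank-one leading term of the rescaled diagonal matrix from a remainder carrying a
factor `e^{-t}`. -/
theorem exp_neg_smul (hn : 2 ≤ n) (C : CartanSeq G) {m : ℕ} (v : Vec n) :
    ((Real.exp (-C.t m) : ℝ) : ℂ) • cartanGL n (C.t m) • v =
      v 0 • Pi.single 0 1 + ((Real.exp (-C.t m) : ℝ) : ℂ) •
        (v - v 0 • Pi.single 0 1 - v (Fin.last n) • Pi.single (Fin.last n) 1 +
          (((Real.exp (-C.t m) : ℝ) : ℂ) * v (Fin.last n)) • Pi.single (Fin.last n) 1) := by
  have h0 := zero_ne_last hn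
  refine ext_vec ?_ (fun i hi hi' => ?_) ?_
  · rw [Pi.smul_apply, cartanGL_smul_zero, smul_eq_mul, ← mul_assoc, ← Complex.ofReal_mul,
      ← Real.exp_add, neg_add_cancel]
    simp [h0]
  · rw [Pi.smul_apply, cartanGL_smul_mid _ _ hi hi']
    simp [hi, hi']
  · rw [Pi.smul_apply, cartanGL_smul_last hn]
    simp [h0.symm]

/-- After rescaling, the sequence converges to a map of rank one. -/
theorem tendsto_rescaled (hn : 2 ≤ n) (C : CartanSeq G) {ι : Type*} {l : Filter ι} {φ : ι → ℕ}
    (hφ : Tendsto φ l atTop) {v : ι → Vec n} {w : Vec n} (hv : Tendsto v l (𝓝 w)) :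
    Tendsto (fun i => ((Real.exp (-C.t (φ i)) : ℝ) : ℂ) • G (φ i) • v i) l
      (𝓝 (herm w C.rep • C.attr)) := by
  have h1 := tendsto_smul_vec (C.k'_tendsto.comp hφ) hv
  have he := C.tendsto_exp_neg.comp hφ
  have h2 : Tendsto (fun i => ((Real.exp (-C.t (φ i)) : ℝ) : ℂ) •
      cartanGL n (C.t (φ i)) • C.k' (φ i) • v i) l (𝓝 ((C.κ' • w) 0 • Pi.single 0 1)) := by
    simp only [C.exp_neg_smul hn]
    have h3 := tendsto_pi_nhds.1 h1 0
    have h4 := tendsto_pi_nhds.1 h1 (Fin.last n)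
    have h5 := (h3.smul_const (Pi.single 0 1 : Vec n)).add (he.smul (((h1.sub
      (h3.smul_const (Pi.single 0 1 : Vec n))).sub
        (h4.smul_const (Pi.single (Fin.last n) 1 : Vec n))).add
          ((he.mul h4).smul_const (Pi.single (Fin.last n) 1 : Vec n))))
    rw [zero_smul, add_zero] at h5
    exact h5
  have h3 := tendsto_smul_vec (C.k_tendsto.comp hφ) h2
  rw [smul_comm C.κ, ← herm_rep] at h3
  refine h3.congr fun i => ?_
  rw [C.eq, mul_smul, mul_smul]
  exact (smul_comm _ _ _)

/-- The constraints satisfied by the limits of the graphs. -/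
theorem of_mem_limGraph (hn : 2 ≤ n) (C : CartanSeq G) {l : Filter ℕ} [l.NeBot] (hl : l ≤ atTop)
    {w u : Vec n} (h : (w, u) ∈ limGraph l G) :
    (C.κ' • w) 0 = 0 ∧ (C.κ⁻¹ • u) (Fin.last n) = 0 ∧
      ∀ i, i ≠ 0 → i ≠ Fin.last n → (C.κ⁻¹ • u) i = (C.κ' • w) i := by
  obtain ⟨v, hv, hv'⟩ := h
  have hA := tendsto_smul_vec (C.k'_tendsto.mono_left hl) hv
  have hB := tendsto_smul_vec (C.k_tendsto.inv.mono_left hl) hv'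
  have he := C.tendsto_exp_neg.mono_left hl
  have hAB : ∀ m, (C.k m)⁻¹ • G m • v m = cartanGL n (C.t m) • C.k' m • v m := by
    intro m
    rw [C.eq, mul_smul, mul_smul, inv_smul_smul]
  simp only [hAB] at hB
  refine ⟨?_, ?_, fun i hi hi' => ?_⟩
  · refine tendsto_nhds_unique (tendsto_pi_nhds.1 hA 0) ?_
    have h1 := he.mul (tendsto_pi_nhds.1 hB 0)
    rw [zero_mul] at h1
    refine h1.congr fun m => ?_
    rw [cartanGL_smul_zero, ← mul_assoc, ← Complex.ofReal_mul, ← Real.exp_add, neg_add_cancel]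
    simp
  · refine tendsto_nhds_unique (tendsto_pi_nhds.1 hB (Fin.last n)) ?_
    have h1 := he.mul (tendsto_pi_nhds.1 hA (Fin.last n))
    rw [zero_mul] at h1
    exact h1.congr fun m => (cartanGL_smul_last hn _ _).symm
  · refine tendsto_nhds_unique (tendsto_pi_nhds.1 hB i) ?_
    refine (tendsto_pi_nhds.1 hA i).congr fun m => ?_
    rw [cartanGL_smul_mid _ _ hi hi']

theorem herm_attr_of_mem (hn : 2 ≤ n) (C : CartanSeq G) {l : Filter ℕ} [l.NeBot] (hl : l ≤ atTop)
    {w u : Vec n} (h : (w, u) ∈ limGraph l G) : herm u C.attr = 0 := by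
  rw [herm_attr, (C.of_mem_limGraph hn hl h).2.1]

/-- The middle coordinates are copied from the first vector, here zero, and the last one is
contracted to zero. Only the expanded coordinate stays free. -/
theorem exists_smul_attr (hn : 2 ≤ n) (C : CartanSeq G) {l : Filter ℕ} [l.NeBot] (hl : l ≤ atTop)
    {u : Vec n} (h : (0, u) ∈ limGraph l G) : ∃ c : ℂ, u = c • C.attr := by
  obtain ⟨-, h2, h3⟩ := C.of_mem_limGraph hn hl h
  refine ⟨(C.κ⁻¹ • u) 0, ?_⟩
  rw [attr, smul_comm, ← inv_smul_eq_iff]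
  refine ext_vec (by simp) (fun i hi hi' => ?_) ?_
  · rw [h3 i hi hi', smul_zero]
    simp [hi]
  · rw [h2]
    simp [(zero_ne_last hn).symm]

theorem exists_smul_rep (hn : 2 ≤ n) (C : CartanSeq G) {l : Filter ℕ} [l.NeBot] (hl : l ≤ atTop)
    {w : Vec n} (h : (w, 0) ∈ limGraph l G) : ∃ c : ℂ, w = c • C.rep := by
  obtain ⟨h1, -, h3⟩ := C.of_mem_limGraph hn hl h
  refine ⟨(C.κ' • w) (Fin.last n), ?_⟩
  rw [rep, smul_comm, eq_inv_smul_iff]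
  refine ext_vec ?_ (fun i hi hi' => ?_) (by simp)
  · rw [h1]
    simp [zero_ne_last hn]
  · rw [← h3 i hi hi', smul_zero]
    simp [hi']

/-- Vectors of size `e^{-t}` that are not orthogonal to the repelling vector are stretched back to a
finite multiple of the attracting one. -/
theorem attr_mem_limGraph (hn : 2 ≤ n) (C : CartanSeq G) : (0, C.attr) ∈ limGraph atTop G := by
  set v : Vec n := C.κ'⁻¹ • Pi.single 0 1 with hv
  have h1 : herm v C.rep = 1 := by
    rw [herm_rep, hv, smul_inv_smul]
    simp
  refine ⟨fun m => ((Real.exp (-C.t m) : ℝ) : ℂ) • v, ?_, ?_⟩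
  · simpa using C.tendsto_exp_neg.smul_const v
  · have h2 := C.tendsto_rescaled hn tendsto_id (tendsto_const_nhds (x := v) (f := atTop))
    rw [h1, one_smul] at h2
    exact h2.congr fun m => smul_comm _ _ _

theorem rep_mem_limGraph (hn : 2 ≤ n) (C : CartanSeq G) : (C.rep, 0) ∈ limGraph atTop G := by
  have h := (C.inv hn).attr_mem_limGraph hn
  have h2 : (C.inv hn).attr = C.rep := by
    change (C.κ'⁻¹ * formGL n) • Pi.single 0 1 = C.κ'⁻¹ • Pi.single (Fin.last n) 1
    rw [mul_smul]
    congr 1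
    ext i
    rw [formGL_smul, Pi.single_apply, Pi.single_apply]
    refine if_congr ?_ rfl rfl
    rw [Equiv.swap_apply_eq_iff, Equiv.swap_apply_left]
  rw [h2] at h
  exact mem_limGraph_inv.1 h

/-- The middle components of a vector. -/
def mid (n : ℕ) : Vec n →ₗ[ℂ] Vec n where
  toFun v i := if i = 0 ∨ i = Fin.last n then 0 else v i
  map_add' v w := by ext i; simp only [Pi.add_apply]; split_ifs <;> simp
  map_smul' c v := by ext i; simp only [Pi.smul_apply, RingHom.id_apply]; split_ifs <;> simp

/-- A linear lift of the limiting map between the orthogonal complements of the repelling and the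
attracting vectors. -/
def lift (C : CartanSeq G) : Vec n →ₗ[ℂ] Vec n where
  toFun w := C.κ • mid n (C.κ' • w)
  map_add' v w := by rw [smul_add, map_add, smul_add]
  map_smul' c v := by rw [smul_comm, map_smul, smul_comm, RingHom.id_apply]

/-- The approximating vectors are chosen with `k' m • w_m` constant. The expanded coordinate of this
constant vector is exactly zero, so nothing escapes to infinity. With `of_mem_limGraph` this shows
that the domain of the relation is the whole complement of the repelling vector. -/
theorem lift_mem_limGraph (hn : 2 ≤ n) (C : CartanSeq G) {w : Vec n} (hw : herm w C.rep = 0) :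
    (w, C.lift w) ∈ limGraph atTop G := by
  rw [herm_rep] at hw
  refine ⟨fun m => (C.k' m)⁻¹ • C.κ' • w, ?_, ?_⟩
  · have h := tendsto_smul_vec C.k'_tendsto.inv (tendsto_const_nhds (x := C.κ' • w))
    rwa [inv_smul_smul] at h
  · have h1 : Tendsto (fun m => cartanGL n (C.t m) • C.κ' • w) atTop (𝓝 (mid n (C.κ' • w))) := by
      refine tendsto_pi_nhds.2 fun i => ?_
      by_cases hi : i = 0
      · subst hi
        simp only [cartanGL_smul_zero, hw, mul_zero]
        simp [mid]
      by_cases hi' : i = Fin.last n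
      · subst hi'
        simp only [cartanGL_smul_last hn]
        simpa [mid] using C.tendsto_exp_neg.mul_const ((C.κ' • w) (Fin.last n))
      · simp only [cartanGL_smul_mid _ _ hi hi']
        simp [mid, hi, hi']
    refine (tendsto_smul_vec C.k_tendsto h1).congr fun m => ?_
    rw [C.eq, mul_smul, mul_smul, smul_inv_smul]

end CartanSeq

/-- A sequence in `U(1,n)` some of whose images of short vectors stay long has a subsequence with
a convergent Cartan decomposition. -/
theorem exists_cartanSeq {n : ℕ} (hn : 2 ≤ n) {G : ℕ → GLn n} (hG : ∀ m, G m ∈ unitary1n n)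
    {x : Vec n} (hx : x ≠ 0) (h : (0, x) ∈ limGraph atTop G) :
    ∃ φ : ℕ → ℕ, StrictMono φ ∧ Nonempty (CartanSeq (G ∘ φ)) := by
  choose k hk k' hk' t ht hGe using fun m => exists_cartan_decomposition hn (hG m)
  obtain ⟨a, ha, ha'⟩ := h
  let N : Vec n → ℝ := fun v => ∑ i, Complex.normSq (v i)
  have hN : Continuous N :=
    continuous_finsetSum _ fun i _ => Complex.continuous_normSq.comp (continuous_apply i)
  -- The compact factors preserve the Euclidean norm and the diagonal one expands it by at most
  -- `e^t`. Since `a m → 0` while the images tend to `x ≠ 0`, this forces `t → ∞`.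
  have hbound : ∀ m, N (G m • a m) ≤ Real.exp (2 * t m) * N (a m) := by
    intro m
    have h1 : N (G m • a m) = N (cartanGL n (t m) • k' m • a m) := by
      rw [hGe, mul_smul, mul_smul]
      exact sum_normSq_smul (hk m) _
    have h2 : N (a m) = N (k' m • a m) := (sum_normSq_smul (hk' m) _).symm
    rw [h1, h2]
    simp only [N, Finset.mul_sum]
    have hexp : Real.exp (2 * t m) = Real.exp (t m) * Real.exp (t m) := by
      rw [← Real.exp_add, two_mul]
    have he1 : 1 ≤ Real.exp (t m) := Real.one_le_exp (ht m)
    have he2 : Real.exp (-t m) ≤ 1 := Real.exp_le_one_iff.2 (by linarith [ht m])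
    refine Finset.sum_le_sum fun i _ => ?_
    have hq := Complex.normSq_nonneg ((k' m • a m) i)
    by_cases hi : i = 0
    · subst hi
      rw [cartanGL_smul_zero, Complex.normSq_mul, Complex.normSq_ofReal, hexp]
    by_cases hi' : i = Fin.last n
    · subst hi'
      rw [cartanGL_smul_last hn, Complex.normSq_mul, Complex.normSq_ofReal, hexp]
      refine mul_le_mul_of_nonneg_right ?_ hq
      have := Real.exp_pos (-t m)
      nlinarith
    · rw [cartanGL_smul_mid _ _ hi hi', hexp]
      exact le_mul_of_one_le_left hq (by nlinarith)
  have ht' : Tendsto t atTop atTop := by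
    have h1 : Tendsto (fun m => N (a m)) atTop (𝓝 0) := by
      have := (hN.tendsto 0).comp ha
      rwa [show N 0 = 0 by simp [N]] at this
    have h2 : Tendsto (fun m => N (G m • a m)) atTop (𝓝 (N x)) := (hN.tendsto x).comp ha'
    have hNx : 0 < N x := sum_normSq_pos hx
    rw [tendsto_atTop]
    intro b
    have h3 : ∀ᶠ m in atTop, N (a m) < N x / 2 * Real.exp (-(2 * b)) :=
      h1.eventually_lt_const (by positivity)
    filter_upwards [h3, h2.eventually_const_lt (half_lt_self hNx)] with m hm hm'
    by_contra hb
    have h4 : Real.exp (2 * t m) ≤ Real.exp (2 * b) := Real.exp_le_exp.2 (by linarith)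
    have h5 := hbound m
    have h6 : 0 ≤ N (a m) := Finset.sum_nonneg fun i _ => Complex.normSq_nonneg _
    have h7 : Real.exp (2 * t m) * N (a m) ≤ Real.exp (2 * b) * (N x / 2 * Real.exp (-(2 * b))) :=
      mul_le_mul h4 hm.le h6 (Real.exp_pos _).le
    have h8 : Real.exp (2 * b) * (N x / 2 * Real.exp (-(2 * b))) = N x / 2 := by
      rw [mul_left_comm, ← Real.exp_add, add_neg_cancel, Real.exp_zero, mul_one]
    linarith
  have hcpt : ∀ g : ℕ → GLn n, (∀ m, g m ∈ compactSubgroup n) →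
      ∃ g₀ ∈ compactSubgroup n, ∃ φ : ℕ → ℕ, StrictMono φ ∧ Tendsto (g ∘ φ) atTop (𝓝 g₀) := by
    intro g hg
    obtain ⟨g₀, h0, φ, hφ, hlim⟩ := exists_subseq_tendsto_of_bounded (fun m => (hg m).2) (R := 1)
      (fun m i j => entry_norm_bound_of_unitary (hg m).1 i j)
    refine ⟨g₀, mem_compactSubgroup_iff.2 ⟨?_, h0⟩, φ, hφ, hlim⟩
    have hv := (Units.continuous_val.tendsto g₀).comp hlim
    have hs := (continuous_id.matrix_conjTranspose.tendsto g₀.1).comp hv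
    refine tendsto_nhds_unique (hv.mul hs) ?_
    refine tendsto_const_nhds.congr fun m => ?_
    exact (mem_compactSubgroup_iff.1 (hg (φ m))).1.symm
  obtain ⟨κ, hκ, φ, hφ, hφlim⟩ := hcpt k hk
  obtain ⟨κ', hκ', ψ, hψ, hψlim⟩ := hcpt (k' ∘ φ) fun m => hk' _
  refine ⟨φ ∘ ψ, hφ.comp hψ, ⟨⟨k ∘ φ ∘ ψ, k' ∘ φ ∘ ψ, κ, κ', t ∘ φ ∘ ψ, fun m => hk _,
    fun m => hk' _, fun m => ht _, fun m => hGe _, hκ, hκ', hφlim.comp hψ.tendsto_atTop, hψlim,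
    ht'.comp (hφ.comp hψ).tendsto_atTop⟩⟩⟩

/-! ### Orthogonal complements and pencils -/

theorem mem_perpSubmodule_mk {n : ℕ} {r : Vec n} (hr : r ≠ 0) {w : Vec n} :
    w ∈ perpSubmodule (Projectivization.mk ℂ r hr) ↔ herm w r = 0 := by
  change (∀ v ∈ (Projectivization.mk ℂ r hr).submodule, herm w v = 0) ↔ _
  rw [Projectivization.submodule_mk]
  constructor
  · exact fun h => h r (Submodule.mem_span_singleton_self r)
  · intro h v hv
    obtain ⟨c, rfl⟩ := Submodule.mem_span_singleton.1 hv
    rw [herm_smul_right, h, mul_zero]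

theorem mem_perpSubmodule {n : ℕ} {p : Proj n} {w : Vec n} :
    w ∈ perpSubmodule p ↔ herm w p.rep = 0 := by
  conv_lhs => rw [← p.mk_rep]
  exact mem_perpSubmodule_mk p.rep_nonzero

theorem perp_submodule {n : ℕ} (p : Proj n) : (perp p).submodule = perpSubmodule p :=
  OrderIso.apply_symm_apply _ _

theorem mk_mem_perp {n : ℕ} {p : Proj n} {w : Vec n} (hw : w ≠ 0) :
    Projectivization.mk ℂ w hw ∈ perp p ↔ herm w p.rep = 0 :=
  mem_perpSubmodule

theorem mem_perp {n : ℕ} {p q : Proj n} : q ∈ perp p ↔ herm q.rep p.rep = 0 := by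
  conv_lhs => rw [← q.mk_rep]
  exact mk_mem_perp _

theorem rep_mem_submodule {n : ℕ} {q : Proj n} {s : Projectivization.Subspace ℂ (Vec n)} :
    q.rep ∈ s.submodule ↔ q ∈ s := by
  rw [Projectivization.Subspace.mem_submodule_iff s q.rep_nonzero, q.mk_rep]

theorem mk_eq_of_smul {n : ℕ} {v w : Vec n} {hv : v ≠ 0} {hw : w ≠ 0} {c : ℂ} (h : v = c • w) :
    (Projectivization.mk ℂ v hv : Proj n) = Projectivization.mk ℂ w hw :=
  (Projectivization.mk_eq_mk_iff' ℂ v w hv hw).2 ⟨c, h.symm⟩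

theorem eq_of_rep_eq_smul {n : ℕ} {p q : Proj n} {c : ℂ} (h : p.rep = c • q.rep) : p = q := by
  rw [← p.mk_rep, ← q.mk_rep]
  exact mk_eq_of_smul h

namespace Pencil

variable {n : ℕ} {p : Proj n}

theorem rep_mem (ℓ : Pencil p) : p.rep ∈ ℓ.1.submodule := rep_mem_submodule.2 ℓ.2.2.1

theorem herm_eq_zero (ℓ : Pencil p) {w : Vec n} (hw : w ∈ ℓ.1.submodule) : herm w p.rep = 0 := by
  have h : ℓ.1.submodule ≤ (perp p).submodule :=
    Projectivization.Subspace.submodule.monotone ℓ.2.2.2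
  rw [perp_submodule] at h
  exact mem_perpSubmodule.1 (h hw)

/-- A line of the pencil is spanned by its vertex and any other of its points. -/
theorem mem_iff (ℓ : Pencil p) {u : Vec n} (hu : u ∈ ℓ.1.submodule) (hne : ∀ c : ℂ, u ≠ c • p.rep)
    {v : Vec n} : v ∈ ℓ.1.submodule ↔ ∃ a b : ℂ, v = a • p.rep + b • u := by
  have hind : LinearIndependent ℂ ![p.rep, u] := by
    rw [LinearIndependent.pair_iff' p.rep_nonzero]
    exact fun a h => hne a h.symm
  have h : Submodule.span ℂ {p.rep, u} = ℓ.1.submodule := by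
    refine Submodule.eq_of_le_of_finrank_eq ?_ ?_
    · rw [Submodule.span_le]
      rintro v (rfl | rfl)
      · exact ℓ.rep_mem
      · exact hu
    · rw [ℓ.2.1]
      have := finrank_span_eq_card hind
      rw [Matrix.range_cons_cons_empty] at this
      rw [this, Fintype.card_fin]
  rw [← h, Submodule.mem_span_pair]
  exact ⟨fun ⟨a, b, h⟩ => ⟨a, b, h.symm⟩, fun ⟨a, b, h⟩ => ⟨a, b, h.symm⟩⟩

theorem exists_ne (ℓ : Pencil p) : ∃ u ∈ ℓ.1.submodule, ∀ c : ℂ, u ≠ c • p.rep := by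
  by_contra! h
  have h1 : ℓ.1.submodule ≤ Submodule.span ℂ {p.rep} := by
    intro u hu
    obtain ⟨c, rfl⟩ := h u hu
    exact Submodule.smul_mem _ _ (Submodule.mem_span_singleton_self _)
  have h2 := Submodule.finrank_mono h1
  rw [ℓ.2.1, finrank_span_singleton p.rep_nonzero] at h2
  omega

end Pencil

/-! ### The dynamics of a sequence with convergent Cartan decompositions -/

theorem toPGL_smul_mk {n : ℕ} (g : GLn n) {v : Vec n} (hv : v ≠ 0) :
    toPGL g • (Projectivization.mk ℂ v hv : Proj n) =
      Projectivization.mk ℂ (g • v) ((smul_ne_zero_iff_ne g).2 hv) := rfl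

theorem mem_dynSet_of_tendsto {n : ℕ} {G : ℕ → GLn n} {w q : Vec n} (hw : w ≠ 0) (hq : q ≠ 0)
    {v : ℕ → Vec n} {c : ℕ → ℂ} (hv : Tendsto v atTop (𝓝 w))
    (hc : Tendsto (fun m => c m • G m • v m) atTop (𝓝 q)) :
    (Projectivization.mk ℂ q hq : Proj n) ∈
      dynSet (fun m => toPGL (G m)) (Projectivization.mk ℂ w hw) := by
  classical
  -- Projective points need nonzero lifts at every index. The replacement changes nothing for large
  -- `m`, because the limit is nonzero.
  let v' : ℕ → Vec n := fun m => if h : v m = 0 then w else v m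
  have hv'0 : ∀ m, v' m ≠ 0 := by
    intro m
    by_cases h : v m = 0
    · simpa only [v', dif_pos h] using hw
    · simpa only [v', dif_neg h] using h
  have hvv' : ∀ᶠ m in atTop, v m = v' m := by
    filter_upwards [hv.eventually_ne hw] with m hm
    simp only [v', dif_neg hm]
  let s : ℕ → Vec n := fun m => if h : c m • G m • v m = 0 then q else c m • G m • v m
  have hs0 : ∀ m, s m ≠ 0 := by
    intro m
    by_cases h : c m • G m • v m = 0
    · simpa only [s, dif_pos h] using hq
    · simpa only [s, dif_neg h] using h
  have hss : ∀ᶠ m in atTop, c m • G m • v m = s m := by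
    filter_upwards [hc.eventually_ne hq] with m hm
    simp only [s, dif_neg hm]
  refine ⟨fun m => Projectivization.mk ℂ (v' m) (hv'0 m), tendsto_mk hv'0 hw (hv.congr' hvv'), ?_⟩
  refine Tendsto.mapClusterPt ?_
  refine (tendsto_mk hs0 hq (hc.congr' hss)).congr' ?_
  filter_upwards [hvv', hss] with m h1 h2
  rw [toPGL_smul_mk]
  refine mk_eq_of_smul (c := c m) ?_
  rw [← h2, h1]

namespace CartanSeq

variable {n : ℕ} {G : ℕ → GLn n}

theorem convergesOff (hn : 2 ≤ n) (C : CartanSeq G) {x y : Proj n} {a b : ℂ}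
    (hx : x.rep = a • C.attr) (hy : y.rep = b • C.rep) :
    ConvergesOff (fun m => toPGL (G m)) y x := by
  have hb : b ≠ 0 := by
    rintro rfl
    exact y.rep_nonzero (by rw [hy, zero_smul])
  -- Convergence jointly in the index and in the point. It gives uniformity on a neighbourhood of
  -- each `p`, which compactness then spreads over `K`.
  have key : ∀ p : Proj n, p ∉ perp y →
      Tendsto (fun q : ℕ × Proj n => toPGL (G q.1) • q.2) (atTop ×ˢ 𝓝 p) (𝓝 x) := by
    intro p hp
    have hpr : herm p.rep C.rep ≠ 0 := by
      intro h
      rw [mem_perp, hy, herm_smul_right, h, mul_zero] at hp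
      exact hp rfl
    have h1 : Tendsto (fun q : ℕ × Proj n => q.2) (atTop ×ˢ 𝓝 p)
        (𝓝 (Projectivization.mk ℂ p.rep p.rep_nonzero)) := by
      rw [p.mk_rep]; exact tendsto_snd
    obtain ⟨u, hu0, hu, hlim⟩ := exists_lift_tendsto p.rep_nonzero h1
    have h2 := C.tendsto_rescaled hn (tendsto_fst (f := (atTop : Filter ℕ)) (g := 𝓝 p)) hlim
    have hc0 : ∀ q : ℕ × Proj n,
        ((Real.exp (-C.t q.1) : ℝ) : ℂ) • G q.1 • u q ≠ 0 := by
      intro q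
      refine smul_ne_zero ?_ ((smul_ne_zero_iff_ne _).2 (hu0 q))
      exact_mod_cast (Real.exp_pos _).ne'
    have h3 := tendsto_mk hc0 (smul_ne_zero hpr C.attr_ne_zero) h2
    have h4 : (Projectivization.mk ℂ _ (smul_ne_zero hpr C.attr_ne_zero) : Proj n) = x := by
      rw [← x.mk_rep]
      refine mk_eq_of_smul (c := herm p.rep C.rep * a⁻¹) ?_
      have ha : a ≠ 0 := by
        rintro rfl
        exact x.rep_nonzero (by rw [hx, zero_smul])
      rw [hx, smul_smul, inv_mul_cancel_right₀ ha]
    rw [h4] at h3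
    refine h3.congr fun q => ?_
    conv_rhs => rw [hu q, toPGL_smul_mk]
    exact mk_eq_of_smul rfl
  intro K hK hKy U hU
  refine hK.induction_on (p := fun s => ∀ᶠ m in atTop, ∀ p ∈ s, toPGL (G m) • p ∈ U) ?_ ?_ ?_ ?_
  · exact Eventually.of_forall fun m p hp => absurd hp (Set.notMem_empty p)
  · intro s t hst ht
    filter_upwards [ht] with m hm p hp using hm p (hst hp)
  · intro s t hs ht
    filter_upwards [hs, ht] with m h1 h2 p hp using hp.elim (h1 p) (h2 p)
  · intro p hp
    obtain ⟨pa, hpa, pb, hpb, h⟩ := eventually_prod_iff.1 ((key p (hKy p hp)).eventually_mem hU)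
    refine ⟨{q | pb q}, mem_nhdsWithin_of_mem_nhds hpb, ?_⟩
    filter_upwards [hpa] with m hm q hq using h hm hq

/-- The relation has the attracting line as fibre over `0`, so the possible limits over `[w]` fill
the span of that line and one image `u`. The attracting point itself is reached only after a
rescaling. -/
theorem dynSet_eq (hn : 2 ≤ n) (C : CartanSeq G) {w u : Vec n} (hw : w ≠ 0)
    (hwr : ∀ c : ℂ, w ≠ c • C.rep) (hwu : (w, u) ∈ limGraph atTop G) {q : Vec n} (hq : q ≠ 0) :
    (Projectivization.mk ℂ q hq : Proj n) ∈
      dynSet (fun m => toPGL (G m)) (Projectivization.mk ℂ w hw) ↔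
      ∃ a b : ℂ, q = a • C.attr + b • u := by
  constructor
  · rintro ⟨p, hp, hpq⟩
    obtain ⟨U, hU, hlim⟩ := mapClusterPt_iff_ultrafilter.1 hpq
    obtain ⟨v, hv0, hv, hvw⟩ := exists_lift_tendsto hw hp
    obtain ⟨s, hs0, hs, hsq⟩ := exists_lift_tendsto hq hlim
    have h1 : ∀ m, ∃ a : ℂ, a • G m • v m = s m := by
      intro m
      have h2 := hs m
      rw [hv m, toPGL_smul_mk] at h2
      exact (Projectivization.mk_eq_mk_iff' ℂ _ _ _ _).1 h2.symm
    choose a ha using h1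
    have hvU := hvw.mono_left hU
    -- If the scalars `a m` stay bounded along the ultrafilter, a limit `ρ` gives `(ρ w, q)` in the
    -- relation, and subtracting `ρ (w, u)` leaves an element of the fibre over `0`. Otherwise their
    -- inverses tend to zero, so `(w, 0)` is in the relation and `w` lies on the excluded repelling
    -- line.
    by_cases hbd : ∃ R : ℝ, ∀ᶠ m in (U : Filter ℕ), ‖a m‖ ≤ R
    · obtain ⟨R, hR⟩ := hbd
      obtain ⟨ρ, -, hρ⟩ := (isCompact_closedBall (0 : ℂ) R).ultrafilter_le_nhds (U.map a) (by
        rw [le_principal_iff, Ultrafilter.coe_map, mem_map]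
        filter_upwards [hR] with m hm
        simpa using hm)
      have hρ : Tendsto a U (𝓝 ρ) := hρ
      have h2 : (ρ • w, q) ∈ limGraph U G := by
        refine ⟨fun m => a m • v m, hρ.smul hvU, ?_⟩
        refine hsq.congr fun m => ?_
        rw [← ha, smul_comm]
      have h3 : (0, q - ρ • u) ∈ limGraph U G := by
        have := Submodule.sub_mem _ h2
          (Submodule.smul_mem _ ρ (limGraph_mono hU G hwu))
        simpa using this
      obtain ⟨b, hb⟩ := C.exists_smul_attr hn hU h3
      exact ⟨b, ρ, by rw [← hb, sub_add_cancel]⟩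
    · exfalso
      have h2 : Tendsto (fun m => (a m)⁻¹) U (𝓝 0) := by
        refine tendsto_inv₀_cobounded.comp ?_
        rw [← tendsto_norm_atTop_iff_cobounded, tendsto_atTop]
        intro R
        have h3 : ¬ ∀ᶠ m in (U : Filter ℕ), ‖a m‖ ≤ R := fun h => hbd ⟨R, h⟩
        filter_upwards [Ultrafilter.eventually_not.2 h3] with m hm
        exact (not_le.1 hm).le
      have h3 : (w, 0) ∈ limGraph U G := by
        refine ⟨v, hvU, ?_⟩
        have h4 := h2.smul hsq
        rw [zero_smul] at h4
        refine h4.congr fun m => ?_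
        have ham : a m ≠ 0 := by
          intro h
          apply hs0 m
          rw [← ha, h, zero_smul]
        rw [← ha, smul_smul, inv_mul_cancel₀ ham, one_smul]
      obtain ⟨c, hc⟩ := C.exists_smul_rep hn hU h3
      exact hwr c hc
  · rintro ⟨a, b, hab⟩
    by_cases hb : b = 0
    · rw [hb, zero_smul, add_zero] at hab
      have ha : a ≠ 0 := by
        rintro rfl
        exact hq (by rw [hab, zero_smul])
      obtain ⟨v, hv, hvu⟩ := hwu
      set d : Vec n := C.κ'⁻¹ • Pi.single 0 1 with hd
      have hdr : herm d C.rep = 1 := by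
        rw [herm_rep, hd, smul_inv_smul]
        simp
      -- Perturbing by `ε d` with `ε = e^{-t/2}` and rescaling by `ε` suppresses the bounded images
      -- `G m • v m`. The perturbation contributes `e^{-t} G m • d`, which tends to the attracting
      -- vector.
      let ε : ℕ → ℂ := fun m => ((Real.exp (-(C.t m / 2)) : ℝ) : ℂ)
      have hε : Tendsto ε atTop (𝓝 0) := by
        have h := Real.tendsto_exp_neg_atTop_nhds_zero.comp
          (C.t_tendsto.atTop_div_const (zero_lt_two' ℝ))
        rw [← Complex.ofReal_zero]
        exact (Complex.continuous_ofReal.tendsto 0).comp h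
      have hεε : ∀ m, ε m * ε m = ((Real.exp (-C.t m) : ℝ) : ℂ) := by
        intro m
        simp only [ε]
        rw [← Complex.ofReal_mul, ← Real.exp_add]
        congr 2
        ring
      refine mem_dynSet_of_tendsto (v := fun m => v m + ε m • d) (c := fun m => a * ε m) hw hq ?_ ?_
      · simpa using hv.add (hε.smul_const d)
      · have h1 := C.tendsto_rescaled hn tendsto_id (tendsto_const_nhds (x := d) (f := atTop))
        rw [hdr, one_smul] at h1
        have h2 := ((hε.smul hvu).add h1).const_smul a
        rw [zero_smul, zero_add, ← hab] at h2
        refine h2.congr fun m => ?_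
        simp only [id, ← hεε, smul_add, smul_smul, smul_comm (G m)]
        simp only [mul_assoc]
    · have h1 : (w, b⁻¹ • q) ∈ limGraph atTop G := by
        have h2 := Submodule.add_mem _ hwu
          (Submodule.smul_mem _ (b⁻¹ * a) (C.attr_mem_limGraph hn))
        have h3 : b⁻¹ • q = u + (b⁻¹ * a) • C.attr := by
          rw [hab, smul_add, smul_smul, smul_smul, inv_mul_cancel₀ hb, one_smul, add_comm]
        rw [h3]
        simpa using h2
      obtain ⟨v, hv, hvq⟩ := h1
      refine mem_dynSet_of_tendsto (c := fun _ => b) hw hq hv ?_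
      have h2 := hvq.const_smul b
      simp only [smul_smul, mul_inv_cancel₀ hb, one_smul] at h2
      exact h2

end CartanSeq

/-! ### From limit graphs to Cartan maps -/

/-- The images of short vectors staying long prevents the classes from being repeated forever. -/
theorem eventually_toPGL_ne {n : ℕ} (hn : 2 ≤ n) {G : ℕ → GLn n} (hG : ∀ m, G m ∈ unitary1n n)
    {x : Vec n} (hx : x ≠ 0) (h : (0, x) ∈ limGraph atTop G) (m₀ : ℕ) :
    ∀ᶠ m in atTop, toPGL (G m) ≠ toPGL (G m₀) := by
  obtain ⟨a, ha, ha'⟩ := h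
  have h1 : Tendsto (fun m => ‖G m₀ • a m‖) atTop (𝓝 0) := by
    have := (tendsto_smul_vec (tendsto_const_nhds (x := G m₀)) ha).norm
    simpa using this
  have hx' : 0 < ‖x‖ := norm_pos_iff.2 hx
  filter_upwards [h1.eventually_lt_const (half_pos hx'),
    ha'.norm.eventually_const_lt (half_lt_self hx')] with m h2 h3 heq
  obtain ⟨u, hu⟩ := Matrix.ProjGenLinGroup.mk_eq_mk_iff.1 heq.symm
  have hsm : ∀ v : Vec n, G m • v = (u : ℂ) • G m₀ • v := by
    intro v
    rw [← hu, smul_vec_def, smul_vec_def, Units.val_mul, ← Matrix.mulVec_mulVec,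
      Matrix.GeneralLinearGroup.coe_scalar, ← Matrix.mulVec_smul]
    congr 1
    simp
  -- A scalar relating two unitary lifts is unimodular, as seen on a vector with nonzero form. So `G
  -- m • a m` would be as short as `G m₀ • a m`, which tends to zero.
  have hun : ‖(u : ℂ)‖ = 1 := by
    have h4 := herm_smul_smul (hG m) (baseVec n) (baseVec n)
    have h5 : herm (baseVec n) (baseVec n) ≠ 0 := by
      rw [herm_baseVec, baseVec_zero hn, baseVec_last hn]; norm_num
    rw [hsm, herm_smul_left, herm_smul_right, herm_smul_smul (hG m₀), ← mul_assoc,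
      mul_eq_right₀ h5, Complex.star_def, Complex.mul_conj] at h4
    have h6 : Complex.normSq (u : ℂ) = 1 := by exact_mod_cast h4
    rw [Complex.normSq_eq_norm_sq] at h6
    exact (pow_eq_one_iff_of_nonneg (norm_nonneg _) two_ne_zero).1 h6
  rw [hsm, norm_smul, hun, one_mul] at h3
  linarith

theorem exists_injective_subseq {α : Type*} {γ : ℕ → α}
    (h : ∀ m₀, ∀ᶠ m in atTop, γ m ≠ γ m₀) :
    ∃ φ : ℕ → ℕ, StrictMono φ ∧ Function.Injective (γ ∘ φ) := by
  have h1 : ∀ N, ∃ N' > N, ∀ k ≥ N', γ k ≠ γ N := by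
    intro N
    obtain ⟨M, hM⟩ := eventually_atTop.1 (h N)
    exact ⟨max M (N + 1), lt_of_lt_of_le (Nat.lt_succ_self N) (le_max_right _ _),
      fun k hk => hM k (le_trans (le_max_left _ _) hk)⟩
  choose F hF hF' using h1
  let φ : ℕ → ℕ := fun m => F^[m] 0
  have hφs : ∀ m, φ (m + 1) = F (φ m) := fun m => Function.iterate_succ_apply' F m 0
  have hφ : StrictMono φ := strictMono_nat_of_lt_succ fun m => by rw [hφs]; exact hF _
  have hlt : ∀ i j, i < j → γ (φ j) ≠ γ (φ i) := by
    intro i j hij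
    refine hF' (φ i) (φ j) ?_
    rw [← hφs]
    exact hφ.monotone hij
  refine ⟨φ, hφ, fun i j hij => ?_⟩
  rcases lt_trichotomy i j with hlt' | heq | hlt'
  · exact absurd hij.symm (hlt i j hlt')
  · exact heq
  · exact absurd hij (hlt j i hlt')

namespace CartanSeq

variable {n : ℕ} {G : ℕ → GLn n}

/-- The Cartan decomposition of a subsequence. -/
def comp (C : CartanSeq G) {φ : ℕ → ℕ} (hφ : StrictMono φ) : CartanSeq (G ∘ φ) where
  k := C.k ∘ φ
  k' := C.k' ∘ φ
  κ := C.κ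
  κ' := C.κ'
  t := C.t ∘ φ
  k_mem _ := C.k_mem _
  k'_mem _ := C.k'_mem _
  t_nonneg _ := C.t_nonneg _
  eq _ := C.eq _
  κ_mem := C.κ_mem
  κ'_mem := C.κ'_mem
  k_tendsto := C.k_tendsto.comp hφ.tendsto_atTop
  k'_tendsto := C.k'_tendsto.comp hφ.tendsto_atTop
  t_tendsto := C.t_tendsto.comp hφ.tendsto_atTop

theorem tendsSimplyToInfinity (C : CartanSeq G)
    (h : Function.Injective fun m => toPGL (G m)) :
    TendsSimplyToInfinity fun m => toPGL (G m) :=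
  ⟨h, C.k, C.k', C.κ, C.κ', C.t, fun m => ⟨C.k_mem m, C.k'_mem m, C.t_nonneg m, G m, rfl, by
    conv_lhs => rw [C.eq m]
    rfl⟩, C.κ_mem, C.κ'_mem, C.k_tendsto, C.k'_tendsto, C.t_tendsto⟩

/-- By `dynSet_eq` the limit set is the line through `x` and `u`. This is a genuine line: if `u`
were on `x`, subtracting from `(w, u)` a multiple of `(0, x)` would put `w` on the repelling line.
-/
theorem dynSet_eq_pencil (hn : 2 ≤ n) (C : CartanSeq G) {x y : Proj n}
    (hx : (0, x.rep) ∈ limGraph atTop G) (hy : (y.rep, 0) ∈ limGraph atTop G)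
    {ℓ : Pencil y} {ℓ' : Pencil x}
    (h : ∀ w ∈ ℓ.1.submodule, ∃ u ∈ ℓ'.1.submodule, (w, u) ∈ limGraph atTop G)
    {w : Proj n} (hw : w ∈ ℓ.1) (hwy : w ≠ y) :
    dynSet (fun m => toPGL (G m)) w = (ℓ'.1 : Set (Proj n)) := by
  obtain ⟨a, ha⟩ := C.exists_smul_attr hn le_rfl hx
  obtain ⟨b, hb⟩ := C.exists_smul_rep hn le_rfl hy
  have ha0 : a ≠ 0 := by
    rintro rfl
    exact x.rep_nonzero (by rw [ha, zero_smul])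
  have hb0 : b ≠ 0 := by
    rintro rfl
    exact y.rep_nonzero (by rw [hb, zero_smul])
  obtain ⟨u, hu, hwu⟩ := h w.rep (rep_mem_submodule.2 hw)
  have hwr : ∀ c : ℂ, w.rep ≠ c • C.rep := by
    intro c hc
    refine hwy (eq_of_rep_eq_smul (c := c * b⁻¹) ?_)
    rw [hb, smul_smul, inv_mul_cancel_right₀ hb0, hc]
  have hux : ∀ c : ℂ, u ≠ c • x.rep := by
    rintro c rfl
    have h1 := Submodule.sub_mem _ hwu (Submodule.smul_mem _ c hx)
    obtain ⟨d, hd⟩ := C.exists_smul_rep hn le_rfl (w := w.rep) (by simpa using h1)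
    exact hwr d hd
  ext q
  have h1 := C.dynSet_eq hn w.rep_nonzero hwr hwu q.rep_nonzero
  rw [w.mk_rep, q.mk_rep] at h1
  rw [h1, SetLike.mem_coe, ← rep_mem_submodule, ℓ'.mem_iff hu hux, ha]
  constructor
  · rintro ⟨c, d, hcd⟩
    exact ⟨c * a⁻¹, d, by rw [smul_smul, inv_mul_cancel_right₀ ha0, hcd]⟩
  · rintro ⟨c, d, hcd⟩
    exact ⟨c * a, d, by rw [hcd, smul_smul]⟩

end CartanSeq

/-- A bijection of pencils that is compatible with the limit of the graphs of a sequence of lifts of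
elements of `Γ` is a Cartan map of `Γ`. -/
theorem mem_cartanMaps_of_limGraph {n : ℕ} (hn : 2 ≤ n) {Γ : Subgroup (PGLn n)} {G : ℕ → GLn n}
    (hG : ∀ m, G m ∈ unitary1n n) (hΓ : ∀ m, toPGL (G m) ∈ Γ) {x y : Proj n}
    (hx : (0, x.rep) ∈ limGraph atTop G) (hy : (y.rep, 0) ∈ limGraph atTop G)
    (f : Pencil y ≃ Pencil x)
    (hf : ∀ ℓ : Pencil y, ∀ w ∈ ℓ.1.submodule, ∃ u ∈ (f ℓ).1.submodule,
      (w, u) ∈ limGraph atTop G) : f ∈ cartanMaps Γ y x := by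
  obtain ⟨φ, hφ, ⟨C₀⟩⟩ := exists_cartanSeq hn hG x.rep_nonzero hx
  obtain ⟨ψ, hψ, hinj⟩ := exists_injective_subseq (γ := fun m => toPGL ((G ∘ φ) m))
    (eventually_toPGL_ne hn (fun m => hG _) x.rep_nonzero
      (limGraph_comp hφ.tendsto_atTop G hx))
  have hsub := limGraph_comp (hφ.comp hψ).tendsto_atTop G
  have C : CartanSeq (G ∘ (φ ∘ ψ)) := C₀.comp hψ
  set D := G ∘ (φ ∘ ψ) with hD
  have hx' := hsub hx
  have hy' := hsub hy
  obtain ⟨a, ha⟩ := C.exists_smul_attr hn le_rfl hx'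
  obtain ⟨b, hb⟩ := C.exists_smul_rep hn le_rfl hy'
  have hxi : (x.rep, 0) ∈ limGraph atTop fun m => (D m)⁻¹ := mem_limGraph_inv.2 hx'
  have hyi : (0, y.rep) ∈ limGraph atTop fun m => (D m)⁻¹ := mem_limGraph_inv.2 hy'
  obtain ⟨a', ha'⟩ := (C.inv hn).exists_smul_attr hn le_rfl hyi
  obtain ⟨b', hb'⟩ := (C.inv hn).exists_smul_rep hn le_rfl hxi
  have hinv : (fun m => (toPGL (D m))⁻¹) = fun m => toPGL (D m)⁻¹ :=
    funext fun m => (map_inv _ _).symm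
  refine ⟨fun m => toPGL (D m), fun m => hΓ _, C.tendsSimplyToInfinity hinj,
    C.convergesOff hn ha hb, ?_, ?_, ?_⟩
  · rw [hinv]
    exact (C.inv hn).convergesOff hn ha' hb'
  · intro ℓ w hw hwy
    refine C.dynSet_eq_pencil hn hx' hy' (fun v hv => ?_) hw hwy
    obtain ⟨u, hu, hvu⟩ := hf ℓ v hv
    exact ⟨u, hu, hsub hvu⟩
  · intro ℓ w hw hwx
    rw [hinv]
    refine (C.inv hn).dynSet_eq_pencil hn hyi hxi (fun u hu => ?_) hw hwx
    -- Compatibility in the forward direction suffices: `ℓ` is spanned by `x` and the image `u₀` of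
    -- one point off `y`, and both vectors have preimages in the relation.
    obtain ⟨w₀, hw₀, hw₀y⟩ := (f.symm ℓ).exists_ne
    obtain ⟨u₀, hu₀, hwu⟩ := hf (f.symm ℓ) w₀ hw₀
    rw [Equiv.apply_symm_apply] at hu₀
    have hwu := hsub hwu
    have hu₀x : ∀ c : ℂ, u₀ ≠ c • x.rep := by
      rintro c rfl
      have h1 := Submodule.sub_mem _ hwu (Submodule.smul_mem _ c hx')
      obtain ⟨d, hd⟩ := C.exists_smul_rep hn le_rfl (w := w₀) (by simpa using h1)
      have hb0 : b ≠ 0 := by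
        rintro rfl
        exact y.rep_nonzero (by rw [hb, zero_smul])
      refine hw₀y (d * b⁻¹) ?_
      rw [hb, smul_smul, inv_mul_cancel_right₀ hb0, hd]
    obtain ⟨s, r, hsr⟩ := (ℓ.mem_iff hu₀ hu₀x).1 hu
    refine ⟨r • w₀, Submodule.smul_mem _ _ hw₀, mem_limGraph_inv.2 ?_⟩
    have h1 := Submodule.add_mem _ (Submodule.smul_mem _ s hx') (Submodule.smul_mem _ r hwu)
    rw [hsr]
    simpa using h1

/-! ### Composition of limit graphs -/

/-- If the vectors that are limits of images of short vectors, together with the domain of the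
second limit graph, span the space, then limit graphs can be composed. -/
theorem limGraph_mul {n : ℕ} {G D : ℕ → GLn n}
    (hspan : ∀ e : Vec n, ∃ a b : Vec n, e = a + b ∧ (0, a) ∈ limGraph atTop G ∧
      ∃ c, (b, c) ∈ limGraph atTop D)
    {w u v : Vec n} (hG : (w, u) ∈ limGraph atTop G) (hD : (u, v) ∈ limGraph atTop D) :
    (w, v) ∈ limGraph atTop fun m => D m * G m := by
  have hcol : ∀ j : Fin (n + 1), ∃ p q : ℕ → Vec n, Tendsto p atTop (𝓝 0) ∧
      Tendsto (fun m => G m • p m + q m) atTop (𝓝 (Pi.single j 1)) ∧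
      ∃ c, Tendsto (fun m => D m • q m) atTop (𝓝 c) := by
    intro j
    obtain ⟨a, b, hab, ⟨p, hp, hp'⟩, c, q, hq, hq'⟩ := hspan (Pi.single j 1)
    refine ⟨p, q, hp, ?_, c, hq'⟩
    rw [hab]
    exact hp'.add hq
  choose p q hp hpq c hc using hcol
  -- The columns approximate the standard basis, each split into an image under `G m` of a short
  -- vector plus a vector on which `D m` converges. As `B m → 1`, any error tending to zero can be
  -- expanded in these columns with coefficients tending to zero.
  let B : ℕ → Matrix (Fin (n + 1)) (Fin (n + 1)) ℂ := fun m =>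
    Matrix.of fun i j => (G m • p j m + q j m) i
  have hB : Tendsto B atTop (𝓝 1) := by
    refine tendsto_pi_nhds.2 fun i => tendsto_pi_nhds.2 fun j => ?_
    have h1 := tendsto_pi_nhds.1 (hpq j) i
    rw [Pi.single_apply] at h1
    rw [Matrix.one_apply]
    exact h1
  have hdet : Tendsto (fun m => (B m).det) atTop (𝓝 1) := by
    have h1 := (continuous_id (X := Matrix (Fin (n + 1)) (Fin (n + 1)) ℂ)).matrix_det.tendsto 1
    rw [id, Matrix.det_one] at h1
    exact h1.comp hB
  have hadj : Tendsto (fun m => (B m).adjugate) atTop (𝓝 1) := by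
    have h1 := (continuous_id (X := Matrix (Fin (n + 1)) (Fin (n + 1)) ℂ)).matrix_adjugate.tendsto 1
    rw [id, Matrix.adjugate_one] at h1
    exact h1.comp hB
  obtain ⟨r, hr, hr'⟩ := hG
  obtain ⟨s, hs, hs'⟩ := hD
  let ε : ℕ → Vec n := fun m => G m • r m - s m
  have hε : Tendsto ε atTop (𝓝 0) := by simpa using hr'.sub hs
  let d : ℕ → Vec n := fun m => (B m).det⁻¹ • ((B m).adjugate *ᵥ ε m)
  have hd : Tendsto d atTop (𝓝 0) := by
    have h1 := (hdet.inv₀ one_ne_zero).smul (tendsto_mulVec hadj hε)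
    simpa using h1
  have hdj := fun j => tendsto_pi_nhds.1 hd j
  have hBd : ∀ᶠ m in atTop, B m *ᵥ d m = ε m := by
    filter_upwards [hdet.eventually_ne one_ne_zero] with m hm
    simp only [d]
    rw [Matrix.mulVec_smul, Matrix.mulVec_mulVec, Matrix.mul_adjugate, Matrix.smul_mulVec,
      Matrix.one_mulVec, smul_smul, inv_mul_cancel₀ hm, one_smul]
  have hBd' : ∀ m, B m *ᵥ d m = G m • (∑ j, d m j • p j m) + ∑ j, d m j • q j m := by
    intro m
    have h1 : B m *ᵥ d m = ∑ j, d m j • (G m • p j m + q j m) := by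
      ext i
      simp only [B, Matrix.mulVec, dotProduct, Matrix.of_apply, Finset.sum_apply, Pi.smul_apply,
        smul_eq_mul, mul_comm]
    rw [h1, Finset.smul_sum, ← Finset.sum_add_distrib]
    refine Finset.sum_congr rfl fun j _ => ?_
    rw [smul_add, smul_comm (G m)]
  -- The two approximations `G m • r m` and `s m` of `u` differ by `ε m`, which `D m` could blow up.
  -- The correction absorbs the dangerous part of `ε m` into the argument of `G m`, leaving only a
  -- part that `D m` keeps small.
  refine ⟨fun m => r m - ∑ j, d m j • p j m, ?_, ?_⟩
  · have h1 := hr.sub (tendsto_finsetSum Finset.univ fun j _ => (hdj j).smul (hp j))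
    simpa using h1
  · have h1 := hs'.add (tendsto_finsetSum Finset.univ fun j _ => (hdj j).smul (hc j))
    simp only [Pi.zero_apply, zero_smul, Finset.sum_const_zero, add_zero] at h1
    refine h1.congr' ?_
    filter_upwards [hBd] with m hm
    rw [hBd'] at hm
    have h2 : G m • (r m - ∑ j, d m j • p j m) = s m + ∑ j, d m j • q j m := by
      rw [smul_sub, sub_eq_iff_eq_add, add_assoc, add_comm (∑ j, d m j • q j m), hm]
      simp only [ε]
      abel
    rw [mul_smul, h2, smul_add, Finset.smul_sum]
    congr 1
    exact Finset.sum_congr rfl fun j _ => (smul_comm _ _ _).symm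

/-! ### Lifts of the elements of the group, and sequences attracted to limit points -/

/-- The group of all lifts to `U(1,n)` of the elements of `Γ`. -/
def liftGroup {n : ℕ} (Γ : Subgroup (PGLn n)) : Subgroup (GLn n) :=
  unitary1n n ⊓ Γ.comap Matrix.ProjGenLinGroup.mk

/-- Lifts of the orbit points converging to `y.rep` have the form `a m • G m • o`. The form is
preserved and tends to zero, whereas it is negative at `o`, so `a m → 0`. Thus the short vectors `a
m • o` have images tending to `y.rep`. -/
theorem exists_seq_of_mem_limitSet {n : ℕ} {Γ : Subgroup (PGLn n)} (hΓ : Γ ≤ PU1n n)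
    {y : Proj n} (hy : y ∈ limitSet Γ) :
    ∃ G : ℕ → GLn n, (∀ m, G m ∈ liftGroup Γ) ∧ (0, y.rep) ∈ limGraph atTop G := by
  obtain ⟨hfr, o, ho, hacc⟩ := hy
  have hyy := herm_self_of_mem_frontier hfr
  have hne : (𝓝[≠] y ⊓ 𝓟 {q | ∃ g ∈ Γ, q = g • o}).NeBot := hacc
  obtain ⟨x, hx⟩ := exists_seq_tendsto (𝓝[≠] y ⊓ 𝓟 {q | ∃ g ∈ Γ, q = g • o})
  have hx1 : Tendsto x atTop (𝓝 y) := hx.mono_right (inf_le_left.trans nhdsWithin_le_nhds)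
  have hx2 : ∀ᶠ m in atTop, ∃ g ∈ Γ, x m = g • o := by
    have := hx.mono_right inf_le_right
    rwa [tendsto_principal] at this
  obtain ⟨N, hN⟩ := eventually_atTop.1 hx2
  choose g hg hgx using fun m : ℕ => hN (m + N) (Nat.le_add_left N m)
  have hlift : ∀ m, ∃ A ∈ unitary1n n, toPGL A = g m := fun m => Subgroup.mem_map.1 (hΓ (hg m))
  choose G hG hGg using hlift
  have hx3 : Tendsto (fun m => x (m + N)) atTop (𝓝 (Projectivization.mk ℂ y.rep y.rep_nonzero)) := by
    rw [y.mk_rep]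
    exact hx1.comp (tendsto_add_atTop_nat N)
  obtain ⟨u, hu0, hu, hlim⟩ := exists_lift_tendsto y.rep_nonzero hx3
  have ha : ∀ m, ∃ a : ℂ, a • G m • o.rep = u m := by
    intro m
    have h1 := hu m
    rw [hgx, ← hGg, ← o.mk_rep, toPGL_smul_mk] at h1
    exact (Projectivization.mk_eq_mk_iff' ℂ _ _ _ _).1 h1.symm
  choose a ha using ha
  have ho' : (herm o.rep o.rep).re < 0 := ho
  have hna : ∀ m, ‖a m‖ ^ 2 = (herm (u m) (u m)).re / (herm o.rep o.rep).re := by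
    intro m
    rw [← ha, herm_smul_left, herm_smul_right, herm_smul_smul (hG m), ← mul_assoc,
      Complex.star_def, Complex.mul_conj, Complex.re_ofReal_mul, mul_div_cancel_right₀ _ ho'.ne,
      Complex.normSq_eq_norm_sq]
  have ha0 : Tendsto a atTop (𝓝 0) := by
    rw [tendsto_zero_iff_norm_tendsto_zero]
    have h1 : Tendsto (fun m => ‖a m‖ ^ 2) atTop (𝓝 0) := by
      simp only [hna]
      have h2 := ((Complex.continuous_re.tendsto _).comp (tendsto_herm hlim hlim)).div_const
        (herm o.rep o.rep).re
      rw [hyy, Complex.zero_re, zero_div] at h2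
      exact h2
    have h3 := (Real.continuous_sqrt.tendsto 0).comp h1
    rw [Real.sqrt_zero] at h3
    refine h3.congr fun m => ?_
    exact Real.sqrt_sq (norm_nonneg _)
  refine ⟨G, fun m => ⟨hG m, ?_⟩, fun m => a m • o.rep, ?_, ?_⟩
  · change toPGL (G m) ∈ Γ
    rw [hGg]
    exact hg m
  · simpa using ha0.smul_const o.rep
  · refine hlim.congr fun m => ?_
    rw [← ha, smul_comm]

/-- A bounded sequence of lifts of elements of a discrete group repeats a class. -/
theorem exists_toPGL_eq_of_bounded {n : ℕ} {Γ : Subgroup (PGLn n)} (hdisc : DiscreteTopology Γ)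
    {B : ℕ → GLn n} (hB : ∀ m, B m ∈ liftGroup Γ) {R : ℝ} (hR : ∀ m i j, ‖(B m).1 i j‖ ≤ R) :
    ∃ m m', m < m' ∧ toPGL (B m) = toPGL (B m') := by
  obtain ⟨g, -, φ, hφ, hlim⟩ := exists_subseq_tendsto_of_bounded (fun m => (hB m).1) hR
  -- Quotients of consecutive terms stay in the group and tend to the identity, so discreteness
  -- makes one of their classes trivial. The limit `g` itself need not be a lift of an element of
  -- `Γ`.
  have h1 : Tendsto (fun m => (B (φ m))⁻¹ * B (φ (m + 1))) atTop (𝓝 1) := by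
    have := hlim.inv.mul (hlim.comp (tendsto_add_atTop_nat 1))
    rw [inv_mul_cancel] at this
    exact this
  have h2 : Tendsto (fun m => toPGL ((B (φ m))⁻¹ * B (φ (m + 1)))) atTop (𝓝 (toPGL 1)) :=
    ((continuous_coinduced_rng (f := (toPGL : GLn n → PGLn n))).tendsto 1).comp h1
  let s : ℕ → Γ := fun m => ⟨toPGL ((B (φ m))⁻¹ * B (φ (m + 1))),
    (mul_mem (inv_mem (hB _)) (hB _) : _ ∈ liftGroup Γ).2⟩
  have h3 : Tendsto s atTop (𝓝 1) := tendsto_subtype_rng.2 h2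
  rw [nhds_discrete, tendsto_pure] at h3
  obtain ⟨m, hm⟩ := h3.exists
  refine ⟨φ m, φ (m + 1), hφ (Nat.lt_succ_self m), ?_⟩
  have h4 : toPGL ((B (φ m))⁻¹ * B (φ (m + 1))) = 1 := congrArg Subtype.val hm
  have h5 : (toPGL (B (φ m)))⁻¹ * toPGL (B (φ (m + 1))) = 1 := by
    rw [← h4]
    simp [toPGL]
  exact inv_mul_eq_one.1 h5

/-! ### Common fixed points on the boundary -/

theorem exists_herm_ne_zero {n : ℕ} {p : Vec n} (hp : p ≠ 0) : ∃ v, herm v p ≠ 0 := by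
  obtain ⟨i, hi⟩ := Function.ne_iff.1 hp
  refine ⟨Pi.single (Equiv.swap 0 (Fin.last n) i) 1, ?_⟩
  rw [herm_eq, Finset.sum_eq_single (Equiv.swap 0 (Fin.last n) i)]
  · simpa using hi
  · intro j _ hj
    simp [hj]
  · simp

/-- Invariance of the form gives `star (μ m) * ⟨G m a_m, p⟩ = ⟨a_m, p⟩`. The right side tends to
zero, while the pairing on the left tends to `⟨y, p⟩ ≠ 0`. -/
theorem tendsto_eigenvalue_zero {n : ℕ} {G : ℕ → GLn n} (hG : ∀ m, G m ∈ unitary1n n)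
    {y p : Vec n} (hy : (0, y) ∈ limGraph atTop G) (hyp : herm y p ≠ 0) {μ : ℕ → ℂ}
    (hμ : ∀ m, G m • p = μ m • p) : Tendsto μ atTop (𝓝 0) := by
  obtain ⟨a, ha, ha'⟩ := hy
  have h1 := tendsto_herm ha (tendsto_const_nhds (x := p))
  have h2 := tendsto_herm ha' (tendsto_const_nhds (x := p))
  have h3 := (h1.div h2 hyp).star
  rw [herm_zero_left, zero_div, star_zero] at h3
  refine h3.congr' ?_
  filter_upwards [h2.eventually_ne hyp] with m hm
  rw [Pi.div_apply, ← herm_smul_smul (hG m) (a m), hμ, herm_smul_right, mul_div_cancel_right₀ _ hm,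
    star_star]

/-- A boundary fixed point at which the multiplier is not unitary comes with a second one. -/
theorem exists_second_eigenvector {n : ℕ} (hn : 2 ≤ n) {g : GLn n} (hg : g ∈ unitary1n n)
    {p : Vec n} (hp : p ≠ 0) (hpp : herm p p = 0) {μ : ℂ} (hμ : g • p = μ • p)
    (hμ1 : μ * star μ ≠ 1) :
    ∃ q : Vec n, herm q q = 0 ∧ herm q p ≠ 0 ∧ g • q = (star μ)⁻¹ • q := by
  have hμ0 : μ ≠ 0 := by
    rintro rfl
    rw [zero_smul, smul_eq_zero_iff_eq] at hμ
    exact hp hμ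
  have hμ0' : star μ ≠ 0 := star_ne_zero.2 hμ0
  let T : Vec n →ₗ[ℂ] Vec n :=
    { toFun := fun v => g • v - (star μ)⁻¹ • v
      map_add' := fun v w => by rw [smul_add, smul_add]; abel
      map_smul' := fun c v => by
        rw [smul_comm g, smul_comm _ c, RingHom.id_apply, smul_sub] }
  have hT : ∀ v, herm (T v) p = 0 := by
    intro v
    have h1 : herm (g • v) p = (star μ)⁻¹ * herm v p := by
      have h2 := herm_smul_smul hg v p
      rw [hμ, herm_smul_right] at h2
      rw [← h2, inv_mul_cancel_left₀ hμ0']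
    change herm (g • v - (star μ)⁻¹ • v) p = 0
    rw [herm_sub_left, herm_smul_left, h1, sub_self]
  -- The image of `T` lies in the proper subspace `p^⊥`, so in finite dimension `T` has a kernel,
  -- which provides the second eigenvector.
  have hninj : ¬ Function.Injective T := by
    rw [LinearMap.injective_iff_surjective]
    intro hs
    obtain ⟨v, hv⟩ := exists_herm_ne_zero hp
    obtain ⟨w, rfl⟩ := hs v
    exact hv (hT w)
  rw [injective_iff_map_eq_zero] at hninj
  push Not at hninj
  obtain ⟨q, hq, hq0⟩ := hninj
  have hgq : g • q = (star μ)⁻¹ • q := sub_eq_zero.1 hq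
  have hqq : herm q q = 0 := by
    have h1 := herm_smul_smul hg q q
    rw [hgq, herm_smul_left, herm_smul_right, ← mul_assoc, star_inv₀, star_star] at h1
    by_contra h
    rw [mul_eq_right₀ h, ← mul_inv, inv_eq_one, mul_comm] at h1
    exact hμ1 h1
  refine ⟨q, hqq, fun h => ?_, hgq⟩
  obtain ⟨c, rfl⟩ := (herm_self_perp_null hn hp hpp h).2 hqq
  rw [smul_comm, hμ, smul_comm] at hgq
  have h1 := smul_left_injective ℂ hq0 hgq
  apply hμ1
  change μ = (star μ)⁻¹ at h1
  calc μ * star μ = (star μ)⁻¹ * star μ := by rw [← h1]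
    _ = 1 := inv_mul_cancel₀ hμ0'

/-- On the complement of two distinct boundary points the form dominates the norm. -/
theorem exists_norm_sq_le_herm {n : ℕ} (hn : 2 ≤ n) {p q : Vec n} (hpp : herm p p = 0)
    (hpq : herm p q ≠ 0) :
    ∃ K : ℝ, ∀ v : Vec n, herm v p = 0 → herm v q = 0 → ‖v‖ ^ 2 ≤ K * (herm v v).re := by
  have hcont : ∀ r : Vec n, Continuous fun v : Vec n => herm v r := by
    intro r
    simp only [herm_eq]
    fun_prop
  have hcont2 : Continuous fun v : Vec n => (herm v v).re := by
    simp only [herm_eq]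
    fun_prop
  -- The constant is the inverse of the minimum of the form on this compact set, positive by
  -- `herm_self_pos`.
  let S : Set (Vec n) := {v | herm v p = 0 ∧ herm v q = 0} ∩ Metric.sphere 0 1
  have hS : IsCompact S := (isCompact_sphere 0 1).inter_left
    ((isClosed_eq (hcont p) continuous_const).inter (isClosed_eq (hcont q) continuous_const))
  rcases S.eq_empty_or_nonempty with hemp | hne
  · refine ⟨0, fun v hvp hvq => ?_⟩
    by_cases hv : v = 0
    · simp [hv]
    · exfalso
      have hmem : ((‖v‖⁻¹ : ℝ) : ℂ) • v ∈ S := by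
        refine ⟨⟨by rw [herm_smul_left, hvp, mul_zero], by rw [herm_smul_left, hvq, mul_zero]⟩, ?_⟩
        rw [mem_sphere_zero_iff_norm, norm_smul, Complex.norm_real, norm_inv, norm_norm,
          inv_mul_cancel₀ (norm_ne_zero_iff.2 hv)]
      rw [hemp] at hmem
      exact hmem
  · obtain ⟨v₀, hv₀, hmin⟩ := hS.exists_isMinOn hne hcont2.continuousOn
    have hv₀0 : v₀ ≠ 0 := by
      rintro rfl
      simpa using hv₀.2
    have hδ := herm_self_pos hn hpp hpq hv₀.1.1 hv₀.1.2 hv₀0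
    refine ⟨(herm v₀ v₀).re⁻¹, fun v hvp hvq => ?_⟩
    by_cases hv : v = 0
    · simp [hv, herm_zero_left]
    · have hv' : 0 < ‖v‖ := norm_pos_iff.2 hv
      have hmem : ((‖v‖⁻¹ : ℝ) : ℂ) • v ∈ S := by
        refine ⟨⟨by rw [herm_smul_left, hvp, mul_zero], by rw [herm_smul_left, hvq, mul_zero]⟩, ?_⟩
        rw [mem_sphere_zero_iff_norm, norm_smul, Complex.norm_real, norm_inv, norm_norm,
          inv_mul_cancel₀ hv'.ne']
      have h1 : (herm v₀ v₀).re ≤ (herm (((‖v‖⁻¹ : ℝ) : ℂ) • v) (((‖v‖⁻¹ : ℝ) : ℂ) • v)).re :=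
        hmin hmem
      rw [herm_smul_left, herm_smul_right, Complex.star_def, Complex.conj_ofReal,
        Complex.re_ofReal_mul, Complex.re_ofReal_mul] at h1
      rw [inv_mul_eq_div, le_div_iff₀ hδ]
      have h2 : ‖v‖ ^ 2 * (‖v‖⁻¹ * (‖v‖⁻¹ * (herm v v).re)) = (herm v v).re := by
        field_simp
      rw [← h2]
      exact mul_le_mul_of_nonneg_left h1 (by positivity)

theorem pow_smul_eigenvector {n : ℕ} {g : GLn n} {v : Vec n} {μ : ℂ} (h : g • v = μ • v) (m : ℕ) :
    g ^ m • v = μ ^ m • v := by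
  induction m with
  | zero => simp
  | succ m ih => rw [pow_succ, mul_smul, h, smul_comm, ih, smul_smul, ← pow_succ']

theorem inv_smul_eigenvector {n : ℕ} {g : GLn n} {v : Vec n} {μ : ℂ} (h : g • v = μ • v)
    (hμ : μ ≠ 0) : g⁻¹ • v = μ⁻¹ • v := by
  rw [inv_smul_eq_iff, smul_comm, h, smul_smul, inv_mul_cancel₀ hμ, one_smul]

/-- In a discrete group, an element that acts trivially at one fixed point of a loxodromic element
also fixes the other one. -/
theorem smul_eq_of_discrete {n : ℕ} (hn : 2 ≤ n) {Γ : Subgroup (PGLn n)}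
    (hdisc : DiscreteTopology Γ) {g c : GLn n} (hg : g ∈ liftGroup Γ) (hc : c ∈ liftGroup Γ)
    {p q : Vec n} (hpp : herm p p = 0) (hqq : herm q q = 0) (hqp : herm q p ≠ 0) {μ : ℂ}
    (hμ0 : μ ≠ 0) (hμ1 : ‖μ‖ < 1) (hgp : g • p = μ • p) (hgq : g • q = (star μ)⁻¹ • q)
    (hcp : c • p = p) : c • q = q := by
  have hpq : herm p q ≠ 0 := fun h => hqp (herm_eq_zero_comm.1 h)
  have hμ0' : star μ ≠ 0 := star_ne_zero.2 hμ0
  have hμs : ‖star μ‖ < 1 := by rwa [norm_star]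
  have hgm : ∀ m, g ^ m ∈ unitary1n n := fun m => pow_mem hg.1 m
  have hgmp := pow_smul_eigenvector hgp
  have hgmq := pow_smul_eigenvector hgq
  have hMp : ∀ {h : GLn n} {a : ℂ}, h ∈ unitary1n n → a ≠ 0 → ∀ {r v : Vec n}, h • r = a • r →
      herm v r = 0 → herm (h • v) r = 0 := by
    intro h a hh ha r v hr hv
    have h1 := herm_smul_smul hh v r
    rw [hr, herm_smul_right, hv] at h1
    exact (mul_eq_zero.1 h1).resolve_left (star_ne_zero.2 ha)
  obtain ⟨K, hK⟩ := exists_norm_sq_le_herm hn hpp hpq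
  have hKb : ∀ v : Vec n, herm v p = 0 → herm v q = 0 → ∀ h ∈ unitary1n n,
      herm (h • v) p = 0 → herm (h • v) q = 0 → ‖h • v‖ ≤ Real.sqrt (K * (herm v v).re) := by
    intro v _ _ h hh h1 h2
    refine Real.le_sqrt_of_sq_le ?_
    have h3 := hK _ h1 h2
    rwa [herm_smul_smul hh] at h3
  -- Since `c` fixes `p`, the component of `c • q` along `q` is exactly `q`, and `c` maps `p^⊥` to
  -- itself. The components that conjugation by `g ^ m` would expand are therefore absent, so the
  -- conjugates stay bounded and discreteness makes them repeat.
  let B : ℕ → GLn n := fun m => g ^ m * c * (g ^ m)⁻¹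
  have hB : ∀ m, B m ∈ liftGroup Γ := fun m =>
    mul_mem (mul_mem (pow_mem hg m) hc) (inv_mem (pow_mem hg m))
  have hBs : ∀ m (v : Vec n), B m • v = g ^ m • c • (g ^ m)⁻¹ • v := fun m v => by
    simp only [B, mul_smul]
  let Bd : Vec n → Prop := fun v => ∃ R : ℝ, ∀ m, ‖B m • v‖ ≤ R
  have hBd_add : ∀ v w, Bd v → Bd w → Bd (v + w) := by
    rintro v w ⟨R, hR⟩ ⟨R', hR'⟩
    refine ⟨R + R', fun m => ?_⟩
    rw [smul_add]
    exact (norm_add_le _ _).trans (add_le_add (hR m) (hR' m))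
  have hBd_smul : ∀ (a : ℂ) v, Bd v → Bd (a • v) := by
    rintro a v ⟨R, hR⟩
    refine ⟨‖a‖ * R, fun m => ?_⟩
    rw [smul_comm, norm_smul]
    exact mul_le_mul_of_nonneg_left (hR m) (norm_nonneg _)
  have hdecomp : ∀ v : Vec n, ∃ w, herm w p = 0 ∧ herm w q = 0 ∧
      v = (herm v p / herm q p) • q + (herm v q / herm p q) • p + w := by
    intro v
    refine ⟨v - ((herm v p / herm q p) • q + (herm v q / herm p q) • p), ?_, ?_, by abel⟩
    · rw [herm_sub_left, herm_add_left, herm_smul_left, herm_smul_left, hpp,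
        div_mul_cancel₀ _ hqp]
      ring
    · rw [herm_sub_left, herm_add_left, herm_smul_left, herm_smul_left, hqq,
        div_mul_cancel₀ _ hpq]
      ring
  have hginvp : ∀ m, (g ^ m)⁻¹ • p = (μ ^ m)⁻¹ • p := fun m =>
    inv_smul_eigenvector (hgmp m) (pow_ne_zero _ hμ0)
  have hginvq : ∀ m, (g ^ m)⁻¹ • q = (star μ) ^ m • q := fun m => by
    rw [inv_smul_eigenvector (hgmq m) (pow_ne_zero _ (inv_ne_zero hμ0')), inv_pow, inv_inv]
  have hBp : Bd p := by
    refine ⟨‖p‖, fun m => ?_⟩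
    rw [hBs, hginvp, smul_comm c, hcp, smul_comm, hgmp, smul_smul,
      inv_mul_cancel₀ (pow_ne_zero _ hμ0), one_smul]
  have hgM : ∀ m v, herm v p = 0 → herm v q = 0 →
      herm (g ^ m • v) p = 0 ∧ herm (g ^ m • v) q = 0 := fun m v h1 h2 =>
    ⟨hMp (hgm m) (pow_ne_zero _ hμ0) (hgmp m) h1,
      hMp (hgm m) (pow_ne_zero _ (inv_ne_zero hμ0')) (hgmq m) h2⟩
  have hgM' : ∀ m v, herm v p = 0 → herm v q = 0 →
      herm ((g ^ m)⁻¹ • v) p = 0 ∧ herm ((g ^ m)⁻¹ • v) q = 0 := fun m v h1 h2 =>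
    ⟨hMp (inv_mem (hgm m)) (inv_ne_zero (pow_ne_zero _ hμ0)) (hginvp m) h1,
      hMp (inv_mem (hgm m)) (pow_ne_zero _ hμ0') (hginvq m) h2⟩
  have hμm : ∀ m, ‖μ ^ m‖ ≤ 1 := fun m => by
    rw [norm_pow]; exact pow_le_one₀ (norm_nonneg _) hμ1.le
  have hμm' : ∀ m, ‖(star μ) ^ m‖ ≤ 1 := fun m => by
    rw [norm_pow]; exact pow_le_one₀ (norm_nonneg _) hμs.le
  have hBq : Bd q := by
    obtain ⟨w, hwp, hwq, hw⟩ := hdecomp (c • q)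
    have h1 : herm (c • q) p = herm q p := by
      conv_lhs => rw [← hcp]
      rw [herm_smul_smul hc.1]
    rw [h1, div_self hqp, one_smul] at hw
    set β := herm (c • q) q / herm p q
    refine ⟨‖q‖ + (‖β‖ * ‖p‖ + Real.sqrt (K * (herm w w).re)), fun m => ?_⟩
    -- The coefficient of `p` is contracted on both sides, and `g ^ m` moves `w` isometrically
    -- inside the positive definite complement of `p` and `q`.
    have h2 : B m • q = q + ((star μ) ^ m * β * μ ^ m) • p + (star μ) ^ m • g ^ m • w := by
      rw [hBs, hginvq, smul_comm c, hw, smul_comm, smul_add, smul_add, smul_add, smul_add, hgmq,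
        smul_comm (g ^ m) β, hgmp, smul_smul, smul_smul, smul_smul, ← mul_pow, mul_inv_cancel₀ hμ0',
        one_pow, one_smul, mul_assoc]
    obtain ⟨h3, h4⟩ := hgM m w hwp hwq
    rw [h2, add_assoc]
    refine (norm_add_le _ _).trans (add_le_add le_rfl ((norm_add_le _ _).trans (add_le_add ?_ ?_)))
    · rw [norm_smul, norm_mul, norm_mul]
      refine mul_le_mul_of_nonneg_right ?_ (norm_nonneg _)
      calc ‖(star μ) ^ m‖ * ‖β‖ * ‖μ ^ m‖ ≤ 1 * ‖β‖ * 1 := by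
            gcongr
            · exact hμm' m
            · exact hμm m
        _ = ‖β‖ := by ring
    · rw [norm_smul]
      calc ‖(star μ) ^ m‖ * ‖g ^ m • w‖ ≤ 1 * ‖g ^ m • w‖ :=
            mul_le_mul_of_nonneg_right (hμm' m) (norm_nonneg _)
        _ ≤ _ := by rw [one_mul]; exact hKb w hwp hwq _ (hgm m) h3 h4
  have hBw : ∀ w : Vec n, herm w p = 0 → herm w q = 0 → Bd w := by
    intro w hwp hwq
    have hcont : Continuous fun v : Vec n => ‖herm (c • v) q / herm p q‖ := by
      simp only [herm_eq, smul_vec_def]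
      fun_prop
    obtain ⟨A, hA⟩ := (isCompact_closedBall (0 : Vec n)
      (Real.sqrt (K * (herm w w).re))).bddAbove_image hcont.continuousOn
    refine ⟨A * ‖p‖ + Real.sqrt (K * (herm w w).re), fun m => ?_⟩
    obtain ⟨h1, h2⟩ := hgM' m w hwp hwq
    set v := (g ^ m)⁻¹ • w with hv
    have hvn : ‖v‖ ≤ Real.sqrt (K * (herm w w).re) := hKb w hwp hwq _ (inv_mem (hgm m)) h1 h2
    obtain ⟨u, hup, huq, hu⟩ := hdecomp (c • v)
    have h3 : herm (c • v) p = 0 := by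
      conv_lhs => rw [← hcp]
      rw [herm_smul_smul hc.1, h1]
    rw [h3, zero_div, zero_smul, zero_add] at hu
    have hα : ‖herm (c • v) q / herm p q‖ ≤ A :=
      hA ⟨v, by simpa using hvn, rfl⟩
    set α := herm (c • v) q / herm p q
    have h4 : herm u u = herm w w := by
      have h5 : herm (c • v) (c • v) = herm w w := by
        rw [herm_smul_smul hc.1, hv, herm_smul_smul (inv_mem (hgm m))]
      rw [hu, herm_add_left, herm_add_right, herm_add_right, herm_smul_left, herm_smul_left,
        herm_smul_right, herm_smul_right, hpp, hup, herm_eq_zero_comm.1 hup] at h5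
      rw [← h5]
      ring
    rw [hBs, ← hv, hu, smul_add, smul_comm, hgmp]
    refine (norm_add_le _ _).trans (add_le_add ?_ ?_)
    · rw [norm_smul, norm_smul]
      have : ‖μ ^ m‖ * ‖p‖ ≤ ‖p‖ := mul_le_of_le_one_left (norm_nonneg _) (hμm m)
      exact mul_le_mul hα this (by positivity) ((norm_nonneg _).trans hα)
    · obtain ⟨h5, h6⟩ := hgM m u hup huq
      have := hKb u hup huq _ (hgm m) h5 h6
      rwa [h4] at this
  have hBall : ∀ v, Bd v := by
    intro v
    obtain ⟨w, hwp, hwq, hw⟩ := hdecomp v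
    rw [hw]
    exact hBd_add _ _ (hBd_add _ _ (hBd_smul _ _ hBq) (hBd_smul _ _ hBp)) (hBw w hwp hwq)
  choose R hR using fun j : Fin (n + 1) => hBall (Pi.single j 1)
  obtain ⟨m, m', hmm, heq⟩ := exists_toPGL_eq_of_bounded hdisc hB (R := ∑ j, |R j|)
    (fun m i j => by
      have h1 : (B m).1 i j = (B m • (Pi.single j 1 : Vec n)) i := by
        rw [smul_vec_def, Matrix.mulVec_single_one]
        rfl
      rw [h1]
      exact (norm_le_pi_norm _ i).trans ((hR j m).trans ((le_abs_self _).trans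
        (Finset.single_le_sum (f := fun j => |R j|) (fun _ _ => abs_nonneg _)
          (Finset.mem_univ j)))))
  set r := c • q with hr
  have hq0 : q ≠ 0 := by
    rintro rfl
    exact hqp (herm_zero_left p)
  obtain ⟨k, rfl⟩ := Nat.exists_eq_add_of_lt hmm
  -- Two conjugates with the same class act alike on `[q]`. Cancelling `g ^ m` makes `c • q` an
  -- eigenvector of a positive power of `g`.
  obtain ⟨ν, hν⟩ : ∃ ν : ℂ, g ^ (k + 1) • r = ν • r := by
    have h1 := congrArg (fun x : PGLn n => x • (Projectivization.mk ℂ q hq0 : Proj n)) heq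
    simp only [toPGL_smul_mk] at h1
    obtain ⟨a, ha⟩ := (Projectivization.mk_eq_mk_iff' ℂ _ _ _ _).1 h1.symm
    rw [hBs, hBs, hginvq, hginvq, smul_comm c, smul_comm c, ← hr, smul_comm _ (star μ ^ m),
      smul_comm _ (star μ ^ (m + k + 1)), add_assoc, pow_add g, mul_smul, smul_smul] at ha
    refine ⟨(star μ ^ (m + (k + 1)))⁻¹ * (a * star μ ^ m), ?_⟩
    have h2 : g ^ m • ((a * star μ ^ m) • r) =
        g ^ m • (star μ ^ (m + (k + 1)) • g ^ (k + 1) • r) := by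
      rw [smul_comm (g ^ m) (a * star μ ^ m) r, ha, smul_comm (g ^ m) (star μ ^ (m + (k + 1)))]
    have h3 := smul_left_cancel _ h2
    rw [mul_smul _ (a * star μ ^ m), h3, inv_smul_smul₀ (pow_ne_zero _ hμ0')]
  have hrp : herm r p = herm q p := by
    conv_lhs => rw [← hcp]
    rw [hr, herm_smul_smul hc.1]
  have hν1 : ν * star μ ^ (k + 1) = 1 := by
    have h1 := herm_smul_smul (hgm (k + 1)) r p
    rw [hν, hgmp, herm_smul_left, herm_smul_right, ← mul_assoc, star_pow, hrp,
      mul_eq_right₀ hqp] at h1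
    exact h1
  -- Pairing with `p` determines `ν`. A nonzero pairing with `q` would prescribe a value of a
  -- different modulus, because `‖μ‖ < 1`. So `r` is null and orthogonal to `q`, hence a multiple of
  -- it.
  have hrq : herm r q = 0 := by
    have h1 := herm_smul_smul (hgm (k + 1)) r q
    rw [hν, hgmq, herm_smul_left, herm_smul_right, ← mul_assoc] at h1
    by_contra h
    rw [mul_eq_right₀ h, star_pow, star_inv₀, star_star] at h1
    have h2 : star μ ^ (k + 1) = μ⁻¹ ^ (k + 1) := by
      have hν0 : ν ≠ 0 := left_ne_zero_of_mul_eq_one hν1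
      exact mul_left_cancel₀ hν0 (hν1.trans h1.symm)
    have h3 := congrArg norm h2
    rw [norm_pow, norm_pow, norm_inv, norm_star] at h3
    have h4 : ‖μ‖ = ‖μ‖⁻¹ :=
      (pow_left_inj₀ (norm_nonneg _) (inv_nonneg.2 (norm_nonneg _)) (Nat.succ_ne_zero k)).1 h3
    have h5 : 0 < ‖μ‖ := norm_pos_iff.2 hμ0
    have h6 := one_lt_inv₀ h5 |>.2 hμ1
    linarith
  obtain ⟨a, ha⟩ := (herm_self_perp_null hn hq0 hqq hrq).2
    (by rw [hr, herm_smul_smul hc.1, hqq])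
  rw [ha, herm_smul_left, mul_eq_right₀ hqp] at hrp
  rw [ha, hrp, one_smul]

theorem rep_herm_ne_zero {n : ℕ} (hn : 2 ≤ n) {x y : Proj n} (hx : herm x.rep x.rep = 0)
    (hy : herm y.rep y.rep = 0) (hxy : x ≠ y) : herm x.rep y.rep ≠ 0 :=
  herm_ne_zero_of_null hn y.rep_nonzero hy hx fun _ hc => hxy (eq_of_rep_eq_smul hc)

theorem herm_rep_mk_ne_zero {n : ℕ} (hn : 2 ≤ n) {y : Proj n} (hy : herm y.rep y.rep = 0)
    {p : Vec n} (hp : p ≠ 0) (hpp : herm p p = 0) (hne : y ≠ Projectivization.mk ℂ p hp) :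
    herm y.rep p ≠ 0 := by
  refine herm_ne_zero_of_null hn hp hpp hy fun c hc => hne ?_
  rw [← y.mk_rep]
  exact mk_eq_of_smul hc

/-- A discrete group with infinite limit set has no fixed point on the boundary. -/
theorem not_forall_eigenvector {n : ℕ} (hn : 2 ≤ n) {Γ : Subgroup (PGLn n)} (hΓ : Γ ≤ PU1n n)
    (hdisc : DiscreteTopology Γ) (hinf : (limitSet Γ).Infinite) {p : Vec n} (hp : p ≠ 0)
    (hpp : herm p p = 0) : ¬ ∀ g ∈ liftGroup Γ, ∃ μ : ℂ, g • p = μ • p := by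
  intro hfix
  choose! μ hμ using hfix
  have hμ0 : ∀ g ∈ liftGroup Γ, μ g ≠ 0 := by
    intro g hg h
    have h1 := hμ g hg
    rw [h, zero_smul, smul_eq_zero_iff_eq] at h1
    exact hp h1
  obtain ⟨y, hy, hyp⟩ := hinf.exists_notMem_finset {Projectivization.mk ℂ p hp}
  rw [Finset.mem_singleton] at hyp
  obtain ⟨G, hG, hGy⟩ := exists_seq_of_mem_limitSet hΓ hy
  have hyp' := herm_rep_mk_ne_zero hn (herm_self_of_mem_frontier hy.1) hp hpp hyp
  have hlim := tendsto_eigenvalue_zero (fun m => (hG m).1) hGy hyp' (fun m => hμ _ (hG m))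
  -- A limit point other than `p` makes the multipliers at `p` tend to zero, which yields a
  -- loxodromic element fixing `p`.
  obtain ⟨m, hm⟩ := (hlim.norm.eventually_lt_const (by simp : ‖(0 : ℂ)‖ < 1)).exists
  set g := G m with hg
  have hgΓ : g ∈ liftGroup Γ := hG m
  have hgp := hμ g hgΓ
  have hg0 := hμ0 g hgΓ
  have hμ1 : μ g * star (μ g) ≠ 1 := by
    intro h
    have h1 := congrArg norm h
    rw [norm_mul, norm_star, norm_one] at h1
    have h2 := norm_nonneg (μ g)
    nlinarith
  obtain ⟨q, hqq, hqp, hgq⟩ := exists_second_eigenvector hn hgΓ.1 hp hpp hgp hμ1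
  have hq0 : q ≠ 0 := by
    rintro rfl
    exact hqp (herm_zero_left p)
  have hs0 : star (μ g) ≠ 0 := star_ne_zero.2 hg0
  have hfixq : ∀ h ∈ liftGroup Γ, ∃ ν : ℂ, h • q = ν • q := by
    intro h hh
    -- The multipliers at `p` cancel in the commutator, so it fixes the vector `p` and, by
    -- `smul_eq_of_discrete`, also `q`. Then `h⁻¹ • q` is an eigenvector of `g` with the eigenvalue
    -- of `q`, which forces it onto the line of `q`.
    have hc : h * g * h⁻¹ * g⁻¹ ∈ liftGroup Γ :=
      mul_mem (mul_mem (mul_mem hh hgΓ) (inv_mem hh)) (inv_mem hgΓ)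
    have hhp := hμ h hh
    have hh0 := hμ0 h hh
    have hcp : (h * g * h⁻¹ * g⁻¹) • p = p := by
      rw [mul_smul, mul_smul, mul_smul, inv_smul_eigenvector hgp hg0, smul_comm h⁻¹,
        inv_smul_eigenvector hhp hh0, smul_comm g, smul_comm g, hgp, smul_comm h, smul_comm h,
        smul_comm h, hhp, smul_smul, smul_smul, smul_smul]
      have : (μ g)⁻¹ * (μ h)⁻¹ * μ g * μ h = 1 := by field_simp
      rw [this, one_smul]
    have hcq := smul_eq_of_discrete hn hdisc hgΓ hc hpp hqq hqp hg0 hm hgp hgq hcp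
    set s := h⁻¹ • q with hs
    have hgs : g • s = (star (μ g))⁻¹ • s := by
      have h1 : h • g • s = (star (μ g))⁻¹ • q := by
        conv_rhs => rw [← hcq]
        rw [mul_smul, mul_smul, mul_smul, inv_smul_eigenvector hgq (inv_ne_zero hs0), inv_inv,
          smul_comm h⁻¹ (star (μ g)), smul_comm g (star (μ g)), smul_comm h (star (μ g)),
          inv_smul_smul₀ hs0]
      rw [← inv_smul_smul h (g • s), h1, smul_comm]
    have hss : herm s s = 0 := by rw [hs, herm_smul_smul (inv_mem hh.1), hqq]
    have hsq : herm s q = 0 := by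
      have h1 := herm_smul_smul hgΓ.1 s q
      rw [hgs, hgq, herm_smul_left, herm_smul_right, ← mul_assoc, star_inv₀, star_star] at h1
      by_contra hne
      rw [mul_eq_right₀ hne, ← mul_inv, inv_eq_one, mul_comm] at h1
      exact hμ1 h1
    obtain ⟨a, ha⟩ := (herm_self_perp_null hn hq0 hqq hsq).2 hss
    have ha0 : a ≠ 0 := by
      rintro rfl
      rw [zero_smul, hs, smul_eq_zero_iff_eq] at ha
      exact hq0 ha
    refine ⟨a⁻¹, ?_⟩
    rw [hs, inv_smul_eq_iff, smul_comm] at ha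
    conv_rhs => rw [ha]
    rw [inv_smul_smul₀ ha0]
  choose! ν hν using hfixq
  classical
  -- The whole group now fixes both `p` and `q`. A limit point different from them makes both
  -- multipliers tend to zero, although `⟨q, p⟩ ≠ 0` forces the product of one with the conjugate of
  -- the other to be `1`.
  obtain ⟨y', hy', hy'n⟩ := hinf.exists_notMem_finset
    {Projectivization.mk ℂ p hp, Projectivization.mk ℂ q hq0}
  rw [Finset.mem_insert, Finset.mem_singleton, not_or] at hy'n
  obtain ⟨D, hD, hDy⟩ := exists_seq_of_mem_limitSet hΓ hy'
  have hnull := herm_self_of_mem_frontier hy'.1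
  have h1 := tendsto_eigenvalue_zero (fun m => (hD m).1) hDy
    (herm_rep_mk_ne_zero hn hnull hp hpp hy'n.1) (fun m => hμ _ (hD m))
  have h2 := tendsto_eigenvalue_zero (fun m => (hD m).1) hDy
    (herm_rep_mk_ne_zero hn hnull hq0 hqq hy'n.2) (fun m => hν _ (hD m))
  have h3 := h2.mul h1.star
  rw [zero_mul] at h3
  refine zero_ne_one (tendsto_nhds_unique h3 (tendsto_const_nhds.congr fun m => ?_))
  have h4 := herm_smul_smul (hD m).1 q p
  rw [hμ _ (hD m), hν _ (hD m), herm_smul_left, herm_smul_right, ← mul_assoc,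
    mul_eq_right₀ hqp] at h4
  exact h4.symm

/-! ### Sequences with prescribed attracting and repelling points -/

theorem CartanSeq.herm_rep_rep {n : ℕ} (hn : 2 ≤ n) {G : ℕ → GLn n} (C : CartanSeq G) :
    herm C.rep C.rep = 0 := by
  rw [C.herm_rep, CartanSeq.rep, smul_inv_smul]
  simp [zero_ne_last hn]

/-- The domain of the limit graph and a vector outside it span the whole space. -/
theorem CartanSeq.exists_decomposition {n : ℕ} (hn : 2 ≤ n) {G : ℕ → GLn n} (C : CartanSeq G)
    {F : ℕ → GLn n} {r : Vec n} (hr : (0, r) ∈ limGraph atTop F) (hrC : herm r C.rep ≠ 0)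
    (e : Vec n) : ∃ a b : Vec n, e = a + b ∧ (0, a) ∈ limGraph atTop F ∧
      ∃ c, (b, c) ∈ limGraph atTop G := by
  refine ⟨(herm e C.rep / herm r C.rep) • r, e - (herm e C.rep / herm r C.rep) • r, by abel, ?_,
    _, C.lift_mem_limGraph hn ?_⟩
  · have := Submodule.smul_mem _ (herm e C.rep / herm r C.rep) hr
    simpa using this
  · rw [herm_sub_left, herm_smul_left, div_mul_cancel₀ _ hrC, sub_self]

/-- Any pair of limit points is the attracting and the repelling point of a sequence. -/
theorem exists_seq_attr_rep {n : ℕ} (hn : 2 ≤ n) {Γ : Subgroup (PGLn n)} (hΓ : Γ ≤ PU1n n)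
    (hdisc : DiscreteTopology Γ) (hinf : (limitSet Γ).Infinite) {y z : Proj n}
    (hy : y ∈ limitSet Γ) (hz : z ∈ limitSet Γ) :
    ∃ G : ℕ → GLn n, (∀ m, G m ∈ liftGroup Γ) ∧ (0, y.rep) ∈ limGraph atTop G ∧
      (z.rep, 0) ∈ limGraph atTop G := by
  obtain ⟨G, hG, hGy⟩ := exists_seq_of_mem_limitSet hΓ hy
  obtain ⟨F, hF, hFz⟩ := exists_seq_of_mem_limitSet hΓ hz
  obtain ⟨φ, hφ, ⟨C⟩⟩ := exists_cartanSeq hn (fun m => (hG m).1) y.rep_nonzero hGy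
  obtain ⟨ψ, hψ, ⟨E⟩⟩ := exists_cartanSeq hn (fun m => (hF m).1) z.rep_nonzero hFz
  have hGy' := limGraph_comp hφ.tendsto_atTop G hGy
  have hFz' := limGraph_comp hψ.tendsto_atTop F hFz
  have hC := C.herm_rep_rep hn
  have hE := E.herm_rep_rep hn
  -- Orthogonal null vectors are proportional. So if no such `f` existed, every element would send
  -- the repelling line of the second sequence to that of the first, and taking `f = 1` shows that
  -- the group would fix this line.
  obtain ⟨f, hf, hfr⟩ : ∃ f ∈ liftGroup Γ, herm (f • E.rep) C.rep ≠ 0 := by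
    by_contra! h
    have hprop : ∀ f ∈ liftGroup Γ, ∃ c : ℂ, f • E.rep = c • C.rep := fun f hf =>
      (herm_self_perp_null hn C.rep_ne_zero hC (h f hf)).2 (by rw [herm_smul_smul hf.1, hE])
    obtain ⟨c, hc⟩ := hprop 1 (one_mem _)
    rw [one_smul] at hc
    have hc0 : c ≠ 0 := by
      rintro rfl
      exact E.rep_ne_zero (by rw [hc, zero_smul])
    refine not_forall_eigenvector hn hΓ hdisc hinf C.rep_ne_zero hC fun f hf => ?_
    obtain ⟨d, hd⟩ := hprop f hf
    refine ⟨c⁻¹ * d, ?_⟩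
    rw [mul_smul, ← hd, hc, smul_comm f, inv_smul_smul₀ hc0]
  -- Inversion exchanges the roles of the two points: this sequence is repelled from `z` and
  -- attracted to `f • E.rep`, which avoids the repelling hyperplane of `G ∘ φ`.
  set F' : ℕ → GLn n := fun m => f * ((F ∘ ψ) m)⁻¹ with hF'
  have hconst : ∀ {w u : Vec n}, (u, w) ∈ limGraph atTop (F ∘ ψ) → (w, f • u) ∈ limGraph atTop F' := by
    intro w u h
    obtain ⟨v, hv, hv'⟩ := mem_limGraph_inv.2 h
    refine ⟨v, hv, ?_⟩
    simp only [hF', mul_smul]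
    exact tendsto_smul_vec tendsto_const_nhds hv'
  have h1 : (0, f • E.rep) ∈ limGraph atTop F' := hconst (E.rep_mem_limGraph hn)
  have h2 : (z.rep, 0) ∈ limGraph atTop F' := by
    have := hconst hFz'
    rwa [smul_zero] at this
  have hspan := C.exists_decomposition hn h1 hfr
  refine ⟨fun m => (G ∘ φ) m * F' m, fun m => mul_mem (hG _) (mul_mem hf (inv_mem (hF _))), ?_, ?_⟩
  · exact limGraph_mul hspan (zero_mem _) hGy'
  · exact limGraph_mul hspan h2 (zero_mem _)

/-! ### Powers of sequences -/

/-- A diagonal sequence whose limit graph contains finitely many prescribed limits of elements of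
limit graphs. -/
theorem exists_diagonal_limGraph {n : ℕ} {κ : Type*} [Finite κ] {H : ℕ → ℕ → GLn n}
    {p : κ → ℕ → Vec n × Vec n} {p₀ : κ → Vec n × Vec n}
    (hp : ∀ k i, p k i ∈ limGraph atTop (H i)) (hlim : ∀ k, Tendsto (p k) atTop (𝓝 (p₀ k))) :
    ∃ μ : ℕ → ℕ, ∀ k, p₀ k ∈ limGraph atTop fun i => H i (μ i) := by
  have h1 : ∀ i : ℕ, ∃ m, ∀ k, ∃ w : Vec n, dist w (p k i).1 < 1 / ((i : ℝ) + 1) ∧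
      dist (H i m • w) (p k i).2 < 1 / ((i : ℝ) + 1) := by
    intro i
    have hpos : 0 < 1 / ((i : ℝ) + 1) := Nat.one_div_pos_of_nat
    have h2 : ∀ᶠ m in atTop, ∀ k, ∃ w : Vec n, dist w (p k i).1 < 1 / ((i : ℝ) + 1) ∧
        dist (H i m • w) (p k i).2 < 1 / ((i : ℝ) + 1) := by
      rw [eventually_all]
      intro k
      obtain ⟨w, hw, hw'⟩ := hp k i
      filter_upwards [hw.eventually (Metric.ball_mem_nhds _ hpos),
        hw'.eventually (Metric.ball_mem_nhds _ hpos)] with m h3 h4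
      exact ⟨w m, h3, h4⟩
    exact h2.exists
  choose μ w hw hw' using h1
  refine ⟨μ, fun k => ⟨fun i => w i k, ?_, ?_⟩⟩
  · refine ((continuous_fst.tendsto _).comp (hlim k)).congr_dist ?_
    exact squeeze_zero (fun _ => dist_nonneg) (fun i => by
      rw [dist_comm]; exact (hw i k).le) tendsto_one_div_add_atTop_nhds_zero_nat
  · refine ((continuous_snd.tendsto _).comp (hlim k)).congr_dist ?_
    exact squeeze_zero (fun _ => dist_nonneg) (fun i => by
      rw [dist_comm]; exact (hw' i k).le) tendsto_one_div_add_atTop_nhds_zero_nat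

/-- The projection to the complement of two non-orthogonal null vectors. -/
def perpProj {n : ℕ} (y z : Vec n) : Vec n →ₗ[ℂ] Vec n :=
  LinearMap.id - ((herm z y)⁻¹ • hermLeft y).smulRight z - ((herm y z)⁻¹ • hermLeft z).smulRight y

theorem perpProj_apply {n : ℕ} (y z v : Vec n) : perpProj y z v =
    v - ((herm z y)⁻¹ * herm v y) • z - ((herm y z)⁻¹ * herm v z) • y := rfl

theorem herm_perpProj_left {n : ℕ} {y z : Vec n} (hy : herm y y = 0) (hyz : herm y z ≠ 0)
    (v : Vec n) : herm (perpProj y z v) y = 0 := by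
  have hzy : herm z y ≠ 0 := fun h => hyz (herm_eq_zero_comm.1 h)
  rw [perpProj_apply, herm_sub_left, herm_sub_left, herm_smul_left, herm_smul_left, hy]
  field_simp
  ring

theorem herm_perpProj_right {n : ℕ} {y z : Vec n} (hz : herm z z = 0) (hyz : herm y z ≠ 0)
    (v : Vec n) : herm (perpProj y z v) z = 0 := by
  rw [perpProj_apply, herm_sub_left, herm_sub_left, herm_smul_left, herm_smul_left, hz]
  field_simp
  ring

theorem perpProj_eq_self {n : ℕ} {y z v : Vec n} (hy : herm v y = 0) (hz : herm v z = 0) :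
    perpProj y z v = v := by
  rw [perpProj_apply, hy, hz, mul_zero, mul_zero, zero_smul, zero_smul, sub_zero, sub_zero]

/-- An isometry of a positive definite complement has powers that are close to the identity. -/
theorem exists_pow_tendsto_id {n : ℕ} (hn : 2 ≤ n) {y z : Vec n} (hy : herm y y = 0)
    (hz : herm z z = 0) (hyz : herm y z ≠ 0) {U : Vec n →ₗ[ℂ] Vec n}
    (hU : ∀ w, herm w y = 0 → herm w z = 0 →
      herm (U w) y = 0 ∧ herm (U w) z = 0 ∧ herm (U w) (U w) = herm w w) :
    ∃ d : ℕ → ℕ, ∀ v, Tendsto (fun i => (U ^ (d i + 1)) (perpProj y z v)) atTop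
      (𝓝 (perpProj y z v)) := by
  obtain ⟨K, hK⟩ := exists_norm_sq_le_herm hn hy hyz
  have hUp : ∀ j w, herm w y = 0 → herm w z = 0 →
      herm ((U ^ j) w) y = 0 ∧ herm ((U ^ j) w) z = 0 ∧
        herm ((U ^ j) w) ((U ^ j) w) = herm w w := by
    intro j w h1 h2
    induction j with
    | zero => exact ⟨h1, h2, rfl⟩
    | succ j ih =>
      rw [pow_succ', Module.End.mul_apply]
      obtain ⟨h3, h4, h5⟩ := hU _ ih.1 ih.2.1
      exact ⟨h3, h4, h5.trans ih.2.2⟩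
  let P := perpProj y z
  have hPy : ∀ v, herm (P v) y = 0 := herm_perpProj_left hy hyz
  have hPz : ∀ v, herm (P v) z = 0 := herm_perpProj_right hz hyz
  let A : ℕ → Fin (n + 1) → Vec n := fun j k => (U ^ j) (P (Pi.single k 1))
  let R : ℝ := ∑ k, Real.sqrt (K * (herm (P (Pi.single k 1)) (P (Pi.single k 1))).re)
  have hA : ∀ j, A j ∈ Metric.closedBall (0 : Fin (n + 1) → Vec n) R := by
    intro j
    rw [mem_closedBall_zero_iff]
    refine (pi_norm_le_iff_of_nonneg (Finset.sum_nonneg fun _ _ => Real.sqrt_nonneg _)).2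
      fun k => ?_
    obtain ⟨h3, h4, h5⟩ := hUp j _ (hPy (Pi.single k 1)) (hPz (Pi.single k 1))
    have h6 := hK _ h3 h4
    rw [h5] at h6
    exact (Real.le_sqrt_of_sq_le h6).trans (Finset.single_le_sum
      (f := fun k => Real.sqrt (K * (herm (P (Pi.single k 1)) (P (Pi.single k 1))).re))
      (fun _ _ => Real.sqrt_nonneg _) (Finset.mem_univ k))
  obtain ⟨L, -, φ, hφ, hL⟩ := (isCompact_closedBall _ _).tendsto_subseq hA
  have hconv : ∀ v, ∃ u, Tendsto (fun i => (U ^ φ i) (P v)) atTop (𝓝 u) := by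
    intro v
    refine ⟨∑ k, v k • L k, ?_⟩
    have h1 : ∀ i, (U ^ φ i) (P v) = ∑ k, v k • A (φ i) k := by
      intro i
      conv_lhs => rw [pi_eq_sum_univ' v]
      simp only [map_sum, map_smul, A]
    simp only [h1]
    exact tendsto_finsetSum _ fun k _ => (tendsto_pi_nhds.1 hL k).const_smul (v k)
  -- The exponent is kept positive because the zeroth power of a sequence attracts nothing.
  have hd : ∀ i, ∃ d, φ (i + 1) = φ i + (d + 1) := fun i =>
    ⟨φ (i + 1) - φ i - 1, by have := hφ (Nat.lt_succ_self i); simp only [Nat.succ_eq_add_one] at this; omega⟩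
  choose d hd using hd
  refine ⟨d, fun v => ?_⟩
  obtain ⟨u, hu⟩ := hconv v
  -- This difference is `U ^ φ i` applied to `U ^ (d i + 1) (P v) - P v`. Powers of `U` preserve the
  -- form, and the form controls the norm, so the latter vector tends to zero as well.
  have h1 : Tendsto (fun i => (U ^ φ (i + 1)) (P v) - (U ^ φ i) (P v)) atTop (𝓝 0) := by
    have := (hu.comp (tendsto_add_atTop_nat 1)).sub hu
    rwa [sub_self] at this
  have h2 : Tendsto (fun i => K * (herm ((U ^ φ (i + 1)) (P v) - (U ^ φ i) (P v))
      ((U ^ φ (i + 1)) (P v) - (U ^ φ i) (P v))).re) atTop (𝓝 0) := by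
    have := ((Complex.continuous_re.tendsto _).comp (tendsto_herm h1 h1)).const_mul K
    rw [herm_zero_left, Complex.zero_re, mul_zero] at this
    exact this
  rw [tendsto_iff_norm_sub_tendsto_zero]
  have h3 := (Real.continuous_sqrt.tendsto 0).comp h2
  rw [Real.sqrt_zero] at h3
  refine squeeze_zero (fun _ => norm_nonneg _) (fun i => ?_) h3
  obtain ⟨h4, h5, -⟩ := hUp (d i + 1) _ (hPy v) (hPz v)
  have h6 : herm ((U ^ (d i + 1)) (P v) - P v) y = 0 := by
    rw [herm_sub_left, h4, hPy, sub_zero]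
  have h7 : herm ((U ^ (d i + 1)) (P v) - P v) z = 0 := by
    rw [herm_sub_left, h5, hPz, sub_zero]
  refine Real.le_sqrt_of_sq_le ((hK _ h6 h7).trans_eq ?_)
  rw [← (hUp (φ i) _ h6 h7).2.2, map_sub, ← Module.End.mul_apply, ← pow_add, ← hd]

/-- For two distinct limit points there is a sequence attracted to the first and repelled from the
second one that induces the projection in the limit. -/
theorem exists_seq_projection {n : ℕ} (hn : 2 ≤ n) {Γ : Subgroup (PGLn n)} (hΓ : Γ ≤ PU1n n)
    (hdisc : DiscreteTopology Γ) (hinf : (limitSet Γ).Infinite) {y z : Proj n}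
    (hy : y ∈ limitSet Γ) (hz : z ∈ limitSet Γ) (hyz : y ≠ z) :
    ∃ D : ℕ → GLn n, (∀ m, D m ∈ liftGroup Γ) ∧ (0, y.rep) ∈ limGraph atTop D ∧
      (z.rep, 0) ∈ limGraph atTop D ∧
      ∀ w, herm w y.rep = 0 → herm w z.rep = 0 → (w, w) ∈ limGraph atTop D := by
  have hyy := herm_self_of_mem_frontier hy.1
  have hzz := herm_self_of_mem_frontier hz.1
  have hne := rep_herm_ne_zero hn hyy hzz hyz
  obtain ⟨G₀, hG₀, hG₀y, hG₀z⟩ := exists_seq_attr_rep hn hΓ hdisc hinf hy hz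
  obtain ⟨φ, hφ, ⟨C⟩⟩ := exists_cartanSeq hn (fun m => (hG₀ m).1) y.rep_nonzero hG₀y
  set G := G₀ ∘ φ with hGdef
  have hG : ∀ m, G m ∈ liftGroup Γ := fun m => hG₀ _
  have hGy : (0, y.rep) ∈ limGraph atTop G := limGraph_comp hφ.tendsto_atTop G₀ hG₀y
  have hGz : (z.rep, 0) ∈ limGraph atTop G := limGraph_comp hφ.tendsto_atTop G₀ hG₀z
  obtain ⟨a, ha⟩ := C.exists_smul_attr hn le_rfl hGy
  obtain ⟨b, hb⟩ := C.exists_smul_rep hn le_rfl hGz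
  have hb0 : b ≠ 0 := by
    rintro rfl
    exact z.rep_nonzero (by rw [hb, zero_smul])
  have hrep : C.rep = b⁻¹ • z.rep := by rw [hb, inv_smul_smul₀ hb0]
  have hyC : herm y.rep C.rep ≠ 0 := by
    rw [hrep, herm_smul_right]
    exact mul_ne_zero (star_ne_zero.2 (inv_ne_zero hb0)) hne
  -- The limiting map is determined only modulo the attracting vector `y`. Subtracting the right
  -- multiple of `y` makes the value orthogonal to `z`, giving an isometry of `{y, z}^⊥`.
  let U : Vec n →ₗ[ℂ] Vec n :=
    C.lift - ((herm y.rep z.rep)⁻¹ • (hermLeft z.rep ∘ₗ C.lift)).smulRight y.rep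
  have hUapp : ∀ w, U w = C.lift w -
      ((herm y.rep z.rep)⁻¹ * herm (C.lift w) z.rep) • y.rep := fun w => rfl
  have hUmem : ∀ w, herm w z.rep = 0 → (w, U w) ∈ limGraph atTop G := by
    intro w hw
    have h1 := C.lift_mem_limGraph hn (w := w) (by rw [hrep, herm_smul_right, hw, mul_zero])
    have h2 := Submodule.sub_mem _ h1
      (Submodule.smul_mem _ ((herm y.rep z.rep)⁻¹ * herm (C.lift w) z.rep) hGy)
    rw [hUapp]
    simpa using h2
  have hU : ∀ w, herm w y.rep = 0 → herm w z.rep = 0 →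
      herm (U w) y.rep = 0 ∧ herm (U w) z.rep = 0 ∧ herm (U w) (U w) = herm w w := by
    intro w _ hwz
    have h1 := hUmem w hwz
    refine ⟨?_, ?_, herm_limGraph (fun m => (hG m).1) h1 h1⟩
    · rw [ha, herm_smul_right, C.herm_attr_of_mem hn le_rfl h1, mul_zero]
    · rw [hUapp, herm_sub_left, herm_smul_left]
      field_simp
      ring
  obtain ⟨d, hd⟩ := exists_pow_tendsto_id hn hyy hzz hne hU
  have hpow : ∀ j : ℕ, (0, y.rep) ∈ limGraph atTop (fun m => G m ^ (j + 1)) ∧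
      (z.rep, 0) ∈ limGraph atTop (fun m => G m ^ (j + 1)) ∧
      ∀ w, herm w y.rep = 0 → herm w z.rep = 0 → (w, (U ^ (j + 1)) w) ∈
        limGraph atTop (fun m => G m ^ (j + 1)) ∧
          herm ((U ^ (j + 1)) w) z.rep = 0 ∧ herm ((U ^ (j + 1)) w) y.rep = 0 := by
    intro j
    induction j with
    | zero =>
      simp only [zero_add, pow_one]
      exact ⟨hGy, hGz, fun w h1 h2 => ⟨hUmem w h2, (hU w h1 h2).2.1, (hU w h1 h2).1⟩⟩
    | succ j ih =>
      obtain ⟨h1, h2, h3⟩ := ih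
      have hspan := C.exists_decomposition hn h1 hyC
      simp only [pow_succ' _ (j + 1)]
      refine ⟨limGraph_mul hspan (zero_mem _) hGy, limGraph_mul hspan h2 (zero_mem _),
        fun w hwy hwz => ?_⟩
      obtain ⟨h4, h5, h6⟩ := h3 w hwy hwz
      rw [Module.End.mul_apply]
      exact ⟨limGraph_mul hspan h4 (hUmem _ h5), (hU _ h6 h5).2.1, (hU _ h6 h5).1⟩
  have hPy := herm_perpProj_left hyy hne
  have hPz := herm_perpProj_right hzz hne
  -- Limit graphs are linear subspaces, so it suffices to control the attracting pair, the repelling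
  -- pair and the pairs coming from projected standard basis vectors. This finite family allows a
  -- diagonal choice.
  let p : Option (Option (Fin (n + 1))) → ℕ → Vec n × Vec n
    | none, _ => (0, y.rep)
    | some none, _ => (z.rep, 0)
    | some (some k), i => (perpProj y.rep z.rep (Pi.single k 1),
        (U ^ (d i + 1)) (perpProj y.rep z.rep (Pi.single k 1)))
  let p₀ : Option (Option (Fin (n + 1))) → Vec n × Vec n
    | none => (0, y.rep)
    | some none => (z.rep, 0)
    | some (some k) => (perpProj y.rep z.rep (Pi.single k 1),
        perpProj y.rep z.rep (Pi.single k 1))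
  obtain ⟨μ, hμ⟩ := exists_diagonal_limGraph (H := fun i m => G m ^ (d i + 1)) (p := p) (p₀ := p₀)
    (by
      rintro (_ | _ | k) i
      · exact (hpow (d i)).1
      · exact (hpow (d i)).2.1
      · exact ((hpow (d i)).2.2 _ (hPy _) (hPz _)).1)
    (by
      rintro (_ | _ | k)
      · exact tendsto_const_nhds
      · exact tendsto_const_nhds
      · exact tendsto_const_nhds.prodMk_nhds (hd _))
  refine ⟨fun i => G (μ i) ^ (d i + 1), fun m => pow_mem (hG _) _, hμ none, hμ (some none), ?_⟩
  intro w hwy hwz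
  have h1 : (w, w) = ∑ k, w k • (perpProj y.rep z.rep (Pi.single k 1),
      perpProj y.rep z.rep (Pi.single k 1)) := by
    have h2 : w = ∑ k, w k • perpProj y.rep z.rep (Pi.single k 1) := by
      conv_lhs => rw [← perpProj_eq_self hwy hwz, pi_eq_sum_univ' w]
      simp only [map_sum, map_smul]
    rw [Prod.ext_iff, Prod.fst_sum, Prod.snd_sum]
    exact ⟨h2, h2⟩
  rw [h1]
  exact Submodule.sum_mem _ fun k _ => Submodule.smul_mem _ _ (hμ (some (some k)))

/-! ### The complex reflection induced by three boundary points -/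

/-- The component of `Y` orthogonal to `X` and `Z` is multiplied by the reflection
`v ↦ v + c ⟨v, η⟩ η`. -/
def reflMap {n : ℕ} (X Y Z : Vec n) : Vec n →ₗ[ℂ] Vec n :=
  LinearMap.id + ((herm Z X / (herm Z Y * herm Y X)) • hermLeft (perpProj X Z Y)).smulRight
    (perpProj X Z Y)

theorem reflMap_apply {n : ℕ} (X Y Z v : Vec n) : reflMap X Y Z v =
    v + (herm Z X / (herm Z Y * herm Y X) * herm v (perpProj X Z Y)) • perpProj X Z Y := rfl

/-- Three vectors that lift distinct points of the boundary. -/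
structure NullTriple {n : ℕ} (X Y Z : Vec n) : Prop where
  hX : herm X X = 0
  hY : herm Y Y = 0
  hZ : herm Z Z = 0
  hXY : herm X Y ≠ 0
  hYZ : herm Y Z ≠ 0
  hXZ : herm X Z ≠ 0

namespace NullTriple

variable {n : ℕ} {X Y Z : Vec n}

theorem hYX (h : NullTriple X Y Z) : herm Y X ≠ 0 := fun h' => h.hXY (herm_eq_zero_comm.1 h')
theorem hZY (h : NullTriple X Y Z) : herm Z Y ≠ 0 := fun h' => h.hYZ (herm_eq_zero_comm.1 h')
theorem hZX (h : NullTriple X Y Z) : herm Z X ≠ 0 := fun h' => h.hXZ (herm_eq_zero_comm.1 h')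

theorem herm_perpProj_Y {v : Vec n} (hvX : herm v X = 0)
    (hvZ : herm v Z = 0) : herm v (perpProj X Z Y) = herm v Y := by
  rw [perpProj_apply, herm_sub_right, herm_sub_right, herm_smul_right, herm_smul_right, hvX, hvZ]
  ring

theorem herm_right_Z (h : NullTriple X Y Z) : herm Z (perpProj X Z Y) = 0 :=
  herm_eq_zero_comm.1 (herm_perpProj_right h.hZ h.hXZ Y)

theorem reflMap_Z (h : NullTriple X Y Z) : reflMap X Y Z Z = Z := by
  rw [reflMap_apply, h.herm_right_Z, mul_zero, zero_smul, add_zero]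

theorem herm_reflMap_X (h : NullTriple X Y Z) (v : Vec n) :
    herm (reflMap X Y Z v) X = herm v X := by
  rw [reflMap_apply, herm_add_left, herm_smul_left, herm_perpProj_left h.hX h.hXZ, mul_zero,
    add_zero]

theorem herm_reflMap_Z (h : NullTriple X Y Z) (v : Vec n) :
    herm (reflMap X Y Z v) Z = herm v Z := by
  rw [reflMap_apply, herm_add_left, herm_smul_left, herm_perpProj_right h.hZ h.hXZ, mul_zero,
    add_zero]

/-- For `η = perpProj X Z Y` the value `⟨η, η⟩ = ⟨η, Y⟩` can be expanded in the pairings of the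
three null vectors. The denominator on the right is the conjugate of the triple product in the
numerator, so the factor is unimodular. -/
theorem reflMap_factor (h : NullTriple X Y Z) :
    1 + herm Z X / (herm Z Y * herm Y X) * herm (perpProj X Z Y) (perpProj X Z Y) =
      -(herm X Y * herm Y Z * herm Z X) / (herm Y X * herm X Z * herm Z Y) := by
  have h1 := herm_perpProj_Y (Y := Y) (herm_perpProj_left h.hX h.hXZ Y) (herm_perpProj_right h.hZ h.hXZ Y)
  have h2 := h.hXZ
  have h3 := h.hZX
  have h4 := h.hZY
  have h5 := h.hYX
  rw [h1, perpProj_apply, herm_sub_left, herm_sub_left, herm_smul_left, herm_smul_left, h.hY]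
  field_simp
  ring

/-- Pairing with `η = perpProj X Z Y` multiplies by the nonzero factor of `reflMap_factor`. So a
vector in the kernel is orthogonal to `η`, where the map is the identity. -/
theorem reflMap_injective (h : NullTriple X Y Z) : Function.Injective (reflMap X Y Z) := by
  rw [injective_iff_map_eq_zero]
  intro v hv
  have h1 : herm (reflMap X Y Z v) (perpProj X Z Y) =
      (1 + herm Z X / (herm Z Y * herm Y X) * herm (perpProj X Z Y) (perpProj X Z Y)) *
        herm v (perpProj X Z Y) := by
    rw [reflMap_apply, herm_add_left, herm_smul_left]
    ring
  rw [hv, herm_zero_left, h.reflMap_factor, eq_comm, mul_eq_zero] at h1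
  have h2 : herm v (perpProj X Z Y) = 0 := h1.resolve_left (div_ne_zero (neg_ne_zero.2
    (mul_ne_zero (mul_ne_zero h.hXY h.hYZ) h.hZX)) (mul_ne_zero (mul_ne_zero h.hYX h.hXZ) h.hZY))
  rwa [reflMap_apply, h2, mul_zero, zero_smul, add_zero] at hv

/-- The reflection as a composition of three projections. -/
theorem exists_steps (h : NullTriple X Y Z) {w : Vec n} (hwX : herm w X = 0)
    (hwZ : herm w Z = 0) : ∃ w₁ w₂ : Vec n,
      w₁ = w - (herm w Y / herm Z Y) • Z ∧ w₂ = w₁ - (herm w₁ X / herm Y X) • Y ∧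
      reflMap X Y Z w = w₂ - (herm w₂ Z / herm X Z) • X ∧
      herm w₁ Y = 0 ∧ herm w₁ Z = 0 ∧ herm w₂ X = 0 := by
  refine ⟨_, _, rfl, rfl, ?_, ?_, ?_, ?_⟩
  · set w₁ := w - (herm w Y / herm Z Y) • Z with hw₁
    set w₂ := w₁ - (herm w₁ X / herm Y X) • Y with hw₂
    set w₃ := w₂ - (herm w₂ Z / herm X Z) • X with hw₃
    have h2X : herm w₂ X = 0 := by
      rw [hw₂, herm_sub_left, herm_smul_left, div_mul_cancel₀ _ h.hYX, sub_self]
    have h3X : herm w₃ X = 0 := by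
      rw [hw₃, herm_sub_left, herm_smul_left, h.hX, h2X, mul_zero, sub_zero]
    have h3Z : herm w₃ Z = 0 := by
      rw [hw₃, herm_sub_left, herm_smul_left, div_mul_cancel₀ _ h.hXZ, sub_self]
    have hPX : perpProj X Z X = 0 := by
      rw [perpProj_apply, h.hX, inv_mul_cancel₀ h.hXZ, mul_zero, zero_smul, one_smul, sub_zero,
        sub_self]
    have hPZ : perpProj X Z Z = 0 := by
      rw [perpProj_apply, h.hZ, inv_mul_cancel₀ h.hZX, mul_zero, zero_smul, one_smul, sub_self,
        sub_zero]
    have h1X : herm w₁ X = -(herm w Y / herm Z Y) * herm Z X := by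
      rw [hw₁, herm_sub_left, herm_smul_left, hwX]
      ring
    have h4 : w₃ = w - (herm w₁ X / herm Y X) • perpProj X Z Y := by
      -- Projecting to `{X, Z}^⊥` fixes `w₃` and `w` and kills the multiples of `X` and `Z`, so only
      -- the middle step contributes.
      calc w₃ = perpProj X Z (w - (herm w Y / herm Z Y) • Z - (herm w₁ X / herm Y X) • Y -
            (herm w₂ Z / herm X Z) • X) := (perpProj_eq_self h3X h3Z).symm
        _ = _ := by
          rw [map_sub, map_sub, map_sub, map_smul, map_smul, map_smul, hPX, hPZ, smul_zero,
            smul_zero, sub_zero, sub_zero, perpProj_eq_self hwX hwZ]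
    rw [h1X] at h4
    rw [h4, reflMap_apply, herm_perpProj_Y hwX hwZ, sub_eq_add_neg, ← neg_smul]
    congr 2
    have h5 := h.hYX
    have h6 := h.hZY
    field_simp
  · rw [herm_sub_left, herm_smul_left, div_mul_cancel₀ _ h.hZY, sub_self]
  · rw [herm_sub_left, herm_smul_left, h.hZ, hwZ, mul_zero, sub_zero]
  · rw [herm_sub_left, herm_smul_left, div_mul_cancel₀ _ h.hYX, sub_self]

/-- The limit graph of the product of two sequences that induce projections. -/
theorem mem_limGraph_mul (h : NullTriple X Y Z) {D E : ℕ → GLn n}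
    (hDY : (0, Y) ∈ limGraph atTop D) (hDZ : (Z, 0) ∈ limGraph atTop D)
    (hD : ∀ w, herm w Y = 0 → herm w Z = 0 → (w, w) ∈ limGraph atTop D)
    (hEZ : (0, Z) ∈ limGraph atTop E) (hEX : (X, 0) ∈ limGraph atTop E)
    (hE : ∀ w, herm w Z = 0 → herm w X = 0 → (w, w) ∈ limGraph atTop E) :
    (0, Z) ∈ limGraph atTop (fun m => E m * D m) ∧ (Z, 0) ∈ limGraph atTop (fun m => E m * D m) ∧
      ∀ v, herm v Z = 0 → (v, reflMap X Y Z v) ∈ limGraph atTop (fun m => E m * D m) := by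
  have hEX' : ∀ b, herm b X = 0 → (b, b - (herm b Z / herm X Z) • X) ∈ limGraph atTop E := by
    intro b hb
    have h1 : (b - (herm b Z / herm X Z) • X, b - (herm b Z / herm X Z) • X) ∈ limGraph atTop E := by
      refine hE _ ?_ ?_
      · rw [herm_sub_left, herm_smul_left, div_mul_cancel₀ _ h.hXZ, sub_self]
      · rw [herm_sub_left, herm_smul_left, h.hX, hb, mul_zero, sub_zero]
    have h2 := Submodule.add_mem _ h1 (Submodule.smul_mem _ (herm b Z / herm X Z) hEX)
    simpa using h2
  -- Transversality for `limGraph_mul`: the attracting vector `Y` of `D` lies outside the repelling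
  -- hyperplane `X^⊥` of `E`.
  have hspan : ∀ e : Vec n, ∃ a b : Vec n, e = a + b ∧ (0, a) ∈ limGraph atTop D ∧
      ∃ c, (b, c) ∈ limGraph atTop E := by
    intro e
    refine ⟨(herm e X / herm Y X) • Y, e - (herm e X / herm Y X) • Y, by abel, ?_, _, hEX' _ ?_⟩
    · have := Submodule.smul_mem _ (herm e X / herm Y X) hDY
      simpa using this
    · rw [herm_sub_left, herm_smul_left, div_mul_cancel₀ _ h.hYX, sub_self]
  have h1 : (0, Z) ∈ limGraph atTop (fun m => E m * D m) := limGraph_mul hspan (zero_mem _) hEZ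
  have h2 : (Z, 0) ∈ limGraph atTop (fun m => E m * D m) := limGraph_mul hspan hDZ (zero_mem _)
  have h3 : ∀ w, herm w X = 0 → herm w Z = 0 →
      (w, reflMap X Y Z w) ∈ limGraph atTop (fun m => E m * D m) := by
    intro w hwX hwZ
    obtain ⟨w₁, w₂, hw₁, hw₂, hw₃, h1Y, h1Z, h2X⟩ := h.exists_steps hwX hwZ
    have h4 : (w₁, w₂) ∈ limGraph atTop D := by
      have h5 := Submodule.sub_mem _ (hD w₁ h1Y h1Z)
        (Submodule.smul_mem _ (herm w₁ X / herm Y X) hDY)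
      rw [hw₂]
      simpa using h5
    have h6 : (w, w₂) ∈ limGraph atTop D := by
      have h7 := Submodule.add_mem _ h4 (Submodule.smul_mem _ (herm w Y / herm Z Y) hDZ)
      have h8 : w = w₁ + (herm w Y / herm Z Y) • Z := by rw [hw₁, sub_add_cancel]
      simpa [← h8] using h7
    rw [hw₃]
    exact limGraph_mul hspan h6 (hEX' w₂ h2X)
  -- A vector of `Z^⊥` is a multiple of `Z` plus a vector of `{X, Z}^⊥`. On the multiple of `Z` the
  -- pair `(Z, Z)` is the sum of `(0, Z)` and `(Z, 0)`, in agreement with `reflMap_Z`.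
  refine ⟨h1, h2, fun v hv => ?_⟩
  set s := herm v X / herm Z X
  have h4 := h3 (v - s • Z)
    (by rw [herm_sub_left, herm_smul_left, div_mul_cancel₀ _ h.hZX, sub_self])
    (by rw [herm_sub_left, herm_smul_left, h.hZ, hv, mul_zero, sub_zero])
  rw [map_sub, map_smul, h.reflMap_Z] at h4
  have h5 := Submodule.add_mem _ h4 (Submodule.add_mem _ (Submodule.smul_mem _ s h1)
    (Submodule.smul_mem _ s h2))
  simpa using h5

end NullTriple

/-! ### The composed projection and the induced map of pencils -/

theorem submodule_span_singleton {n : ℕ} (p : Proj n) :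
    (Projectivization.Subspace.span {p}).submodule = Submodule.span ℂ {p.rep} := by
  refine le_antisymm ?_ ?_
  · rw [← OrderIso.le_symm_apply, Projectivization.Subspace.span_le_subspace_iff,
      Set.singleton_subset_iff, SetLike.mem_coe, Submodule.mem_projectivization_iff_submodule_le,
      Projectivization.submodule_eq]
  · rw [Submodule.span_singleton_le_iff_mem, rep_mem_submodule]
    exact Projectivization.Subspace.subset_span _ (Set.mem_singleton p)

theorem submodule_span_union_singleton {n : ℕ} (T : Projectivization.Subspace ℂ (Vec n))
    (p : Proj n) : (Projectivization.Subspace.span ((T : Set (Proj n)) ∪ {p})).submodule =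
      T.submodule ⊔ Submodule.span ℂ {p.rep} := by
  rw [Projectivization.Subspace.span_union, Projectivization.Subspace.span_coe, OrderIso.map_sup,
    submodule_span_singleton]

theorem submodule_inf {n : ℕ} (S T : Projectivization.Subspace ℂ (Vec n)) :
    (S ⊓ T).submodule = S.submodule ⊓ T.submodule :=
  Submodule.ext fun _ =>
    ⟨fun h => ⟨fun hv => (h hv).1, fun hv => (h hv).2⟩, fun h hv => ⟨h.1 hv, h.2 hv⟩⟩

/-- The intersection of a line with a hyperplane. -/
theorem submodule_inf_perp {n : ℕ} {T : Projectivization.Subspace ℂ (Vec n)} {a b : Vec n}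
    {p : Proj n} (hT : T.submodule = Submodule.span ℂ {a} ⊔ Submodule.span ℂ {b})
    (hb : herm b p.rep ≠ 0) : (T ⊓ perp p).submodule =
      Submodule.span ℂ {a - (herm a p.rep / herm b p.rep) • b} := by
  rw [submodule_inf, hT, perp_submodule]
  refine le_antisymm ?_ ?_
  · rintro v ⟨hv, hp⟩
    obtain ⟨v₁, h₁, v₂, h₂, rfl⟩ := Submodule.mem_sup.1 hv
    obtain ⟨c, rfl⟩ := Submodule.mem_span_singleton.1 h₁
    obtain ⟨d, rfl⟩ := Submodule.mem_span_singleton.1 h₂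
    have h := mem_perpSubmodule.1 hp
    rw [herm_add_left, herm_smul_left, herm_smul_left] at h
    rw [Submodule.mem_span_singleton]
    refine ⟨c, ?_⟩
    have hd : d = -(c * (herm a p.rep / herm b p.rep)) := by
      field_simp
      linear_combination h
    rw [hd, smul_sub, smul_smul, neg_smul, sub_eq_add_neg]
  · rw [Submodule.span_singleton_le_iff_mem]
    refine ⟨Submodule.sub_mem _ (Submodule.mem_sup_left (Submodule.mem_span_singleton_self a))
      (Submodule.smul_mem _ _ (Submodule.mem_sup_right (Submodule.mem_span_singleton_self b))),
      mem_perpSubmodule.2 ?_⟩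
    rw [herm_sub_left, herm_smul_left, div_mul_cancel₀ _ hb, sub_self]

/-- Every step cuts a line, spanned by the current point and a null vector, with a hyperplane not
containing that vector. Three uses of `submodule_inf_perp` give the vectors of `exists_steps`. -/
theorem submodule_projChain {n : ℕ} {x y z : Proj n} (h : NullTriple x.rep y.rep z.rep)
    {w : Proj n} (hwx : herm w.rep x.rep = 0) (hwz : herm w.rep z.rep = 0) :
    (projChain x y z w).submodule = Submodule.span ℂ {reflMap x.rep y.rep z.rep w.rep} := by
  obtain ⟨w₁, w₂, hw₁, hw₂, hw₃, -⟩ := h.exists_steps hwx hwz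
  rw [hw₃]
  refine submodule_inf_perp ?_ h.hXZ
  rw [submodule_span_union_singleton]
  congr 1
  rw [hw₂]
  refine submodule_inf_perp ?_ h.hYX
  rw [submodule_span_union_singleton]
  congr 1
  rw [hw₁]
  refine submodule_inf_perp ?_ h.hZY
  rw [Set.insert_eq, Projectivization.Subspace.span_union, OrderIso.map_sup,
    submodule_span_singleton, submodule_span_singleton]

/-- The map of `x^⊥ ∩ z^⊥` induced by the reflection. -/
def reflPoint {n : ℕ} {x y z : Proj n} (h : NullTriple x.rep y.rep z.rep)
    (w : {w : Proj n // w ∈ perp x ⊓ perp z}) : {w : Proj n // w ∈ perp x ⊓ perp z} :=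
  ⟨Projectivization.mk ℂ (reflMap x.rep y.rep z.rep w.1.rep)
      ((map_ne_zero_iff _ h.reflMap_injective).2 w.1.rep_nonzero),
    (mk_mem_perp _).2 ((h.herm_reflMap_X _).trans (mem_perp.1 w.2.1)),
    (mk_mem_perp _).2 ((h.herm_reflMap_Z _).trans (mem_perp.1 w.2.2))⟩

theorem isComposedProjection_reflPoint {n : ℕ} {x y z : Proj n}
    (h : NullTriple x.rep y.rep z.rep) : IsComposedProjection x y z (reflPoint h) := by
  intro w
  ext q
  rw [SetLike.mem_coe, ← rep_mem_submodule,
    submodule_projChain h (mem_perp.1 w.2.1) (mem_perp.1 w.2.2), Set.mem_singleton_iff,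
    Submodule.mem_span_singleton]
  constructor
  · rintro ⟨c, hc⟩
    rw [← q.mk_rep]
    exact mk_eq_of_smul hc.symm
  · rintro rfl
    obtain ⟨a, ha⟩ := Projectivization.exists_smul_eq_mk_rep ℂ
      (reflMap x.rep y.rep z.rep w.1.rep)
      ((map_ne_zero_iff _ h.reflMap_injective).2 w.1.rep_nonzero)
    exact ⟨a, ha⟩

theorem reflPoint_of_eq_mk {n : ℕ} {x y z : Proj n} (h : NullTriple x.rep y.rep z.rep)
    (w : {w : Proj n // w ∈ perp x ⊓ perp z}) {v : Vec n} (hv : v ≠ 0)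
    (hw : w.1 = Projectivization.mk ℂ v hv) :
    (reflPoint h w).1 = Projectivization.mk ℂ (reflMap x.rep y.rep z.rep v)
      ((map_ne_zero_iff _ h.reflMap_injective).2 hv) := by
  obtain ⟨a, ha⟩ := Projectivization.exists_smul_eq_mk_rep ℂ v hv
  refine mk_eq_of_smul (c := (a : ℂ)) ?_
  rw [hw, ← ha, ← map_smul]
  rfl

/-- A linear automorphism that fixes `p` and preserves products with `p` permutes the lines through
`p` contained in `p^⊥`. -/
def Pencil.mapLine {n : ℕ} {p : Proj n} (f : Vec n ≃ₗ[ℂ] Vec n) (hf : f p.rep = p.rep)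
    (hf' : ∀ v, herm (f v) p.rep = herm v p.rep) (ℓ : Pencil p) : Pencil p :=
  ⟨(ℓ.1.submodule.map (f : Vec n →ₗ[ℂ] Vec n)).projectivization, by
    refine ⟨?_, ?_, ?_⟩
    · rw [OrderIso.apply_symm_apply, LinearEquiv.finrank_map_eq]
      exact ℓ.2.1
    · rw [← rep_mem_submodule, OrderIso.apply_symm_apply]
      exact ⟨p.rep, ℓ.rep_mem, hf⟩
    · refine (OrderIso.le_iff_le Submodule.projectivization).2 ?_
      rintro _ ⟨v, hv, rfl⟩
      exact mem_perpSubmodule.2 ((hf' v).trans (ℓ.herm_eq_zero hv))⟩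

theorem Pencil.submodule_mapLine {n : ℕ} {p : Proj n} (f : Vec n ≃ₗ[ℂ] Vec n)
    (hf : f p.rep = p.rep) (hf' : ∀ v, herm (f v) p.rep = herm v p.rep) (ℓ : Pencil p) :
    (Pencil.mapLine f hf hf' ℓ).1.submodule = ℓ.1.submodule.map (f : Vec n →ₗ[ℂ] Vec n) :=
  OrderIso.apply_symm_apply _ _

theorem Pencil.ext_submodule {n : ℕ} {p : Proj n} {ℓ ℓ' : Pencil p}
    (h : ℓ.1.submodule = ℓ'.1.submodule) : ℓ = ℓ' :=
  Subtype.ext (Projectivization.Subspace.submodule.injective h)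

/-- The permutation of the pencil induced by a linear automorphism. -/
def Pencil.mapEquiv {n : ℕ} {p : Proj n} (f : Vec n ≃ₗ[ℂ] Vec n) (hf : f p.rep = p.rep)
    (hf' : ∀ v, herm (f v) p.rep = herm v p.rep) : Pencil p ≃ Pencil p where
  toFun := Pencil.mapLine f hf hf'
  invFun := Pencil.mapLine f.symm (f.symm_apply_eq.2 hf.symm)
    fun v => by rw [← hf', f.apply_symm_apply]
  left_inv ℓ := Pencil.ext_submodule (by
    rw [Pencil.submodule_mapLine, Pencil.submodule_mapLine, ← Submodule.map_comp,
      LinearEquiv.symm_comp, Submodule.map_id])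
  right_inv ℓ := Pencil.ext_submodule (by
    rw [Pencil.submodule_mapLine, Pencil.submodule_mapLine, ← Submodule.map_comp,
      LinearEquiv.comp_symm, Submodule.map_id])

/-- The permutation of `z^⊥(z)` induced by the reflection. -/
def reflPencil {n : ℕ} {x y z : Proj n} (h : NullTriple x.rep y.rep z.rep) :
    Pencil z ≃ Pencil z :=
  Pencil.mapEquiv (LinearEquiv.ofInjectiveEndo (reflMap x.rep y.rep z.rep) h.reflMap_injective)
    h.reflMap_Z h.herm_reflMap_Z

theorem submodule_reflPencil {n : ℕ} {x y z : Proj n} (h : NullTriple x.rep y.rep z.rep)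
    (ℓ : Pencil z) : (reflPencil h ℓ).1.submodule =
      ℓ.1.submodule.map (reflMap x.rep y.rep z.rep) :=
  Pencil.submodule_mapLine _ h.reflMap_Z h.herm_reflMap_Z ℓ

theorem isInducedOnPencil_reflPencil {n : ℕ} {x y z : Proj n}
    (h : NullTriple x.rep y.rep z.rep) :
    IsInducedOnPencil x z (reflPoint h) (reflPencil h) := by
  intro ℓ
  refine le_antisymm ?_ ?_
  · refine Projectivization.Subspace.submodule.le_iff_le.1 ?_
    rw [submodule_reflPencil]
    rintro _ ⟨v, hv, rfl⟩
    set T := Projectivization.Subspace.span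
      ({q : Proj n | ∃ w, w.1 ∈ ℓ.1 ⊓ perp x ∧ q = (reflPoint h w).1} ∪ {z}) with hT
    set s := herm v x.rep / herm z.rep x.rep with hs
    have hzT : z.rep ∈ T.submodule :=
      rep_mem_submodule.2 (Projectivization.Subspace.subset_span _ (Or.inr rfl))
    have hv' : v - s • z.rep ∈ ℓ.1.submodule :=
      Submodule.sub_mem _ hv (Submodule.smul_mem _ _ ℓ.rep_mem)
    have hvx : herm (v - s • z.rep) x.rep = 0 := by
      rw [herm_sub_left, herm_smul_left, hs, div_mul_cancel₀ _ h.hZX, sub_self]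
    have hmem : reflMap x.rep y.rep z.rep (v - s • z.rep) ∈ T.submodule := by
      -- This vector spans `ℓ ∩ x^⊥` unless `v` is a multiple of `z.rep`, in which case it
      -- represents no point and there is nothing to prove.
      by_cases h0 : v - s • z.rep = 0
      · rw [h0, map_zero]
        exact zero_mem _
      · have hw : Projectivization.mk ℂ _ h0 ∈ perp x ⊓ perp z :=
          ⟨(mk_mem_perp h0).2 hvx, (mk_mem_perp h0).2 (ℓ.herm_eq_zero hv')⟩
        rw [Projectivization.Subspace.mem_submodule_iff T
          ((map_ne_zero_iff _ h.reflMap_injective).2 h0), ← reflPoint_of_eq_mk h ⟨_, hw⟩ h0 rfl]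
        refine Projectivization.Subspace.subset_span _ (Or.inl ⟨⟨_, hw⟩, ⟨?_, hw.1⟩, rfl⟩)
        exact (Projectivization.Subspace.mem_submodule_iff ℓ.1 h0).1 hv'
    have h1 := Submodule.add_mem _ hmem (Submodule.smul_mem _ s hzT)
    rwa [map_sub, map_smul, h.reflMap_Z, sub_add_cancel] at h1
  · rw [Projectivization.Subspace.span_le_subspace_iff]
    rintro q (⟨w, hw, rfl⟩ | hq)
    · rw [SetLike.mem_coe, reflPoint, ← Projectivization.Subspace.mem_submodule_iff,
        submodule_reflPencil]
      exact ⟨_, rep_mem_submodule.2 hw.1, rfl⟩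
    · rw [Set.mem_singleton_iff.1 hq]
      exact (reflPencil h ℓ).2.2.1

/-- The witnessing sequence comes from `E m * D m`, where `D` carries the projection from `z` to `y`
and `E` the one from `x` to `z`. The change from `y` to `x` in between happens because vectors of
`y^⊥` matter only modulo `y`. -/
theorem reflPencil_mem_cartanMaps {n : ℕ} (hn : 2 ≤ n) {Γ : Subgroup (PGLn n)} (hΓ : Γ ≤ PU1n n)
    (hdisc : DiscreteTopology Γ) (hinf : (limitSet Γ).Infinite) {x y z : Proj n}
    (hx : x ∈ limitSet Γ) (hy : y ∈ limitSet Γ) (hz : z ∈ limitSet Γ) (hyz : y ≠ z) (hxz : x ≠ z)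
    (h : NullTriple x.rep y.rep z.rep) : reflPencil h ∈ cartanMaps Γ z z := by
  obtain ⟨D, hDΓ, hDY, hDZ, hD⟩ := exists_seq_projection hn hΓ hdisc hinf hy hz hyz
  obtain ⟨E, hEΓ, hEZ, hEX, hE⟩ := exists_seq_projection hn hΓ hdisc hinf hz hx hxz.symm
  obtain ⟨h1, h2, h3⟩ := h.mem_limGraph_mul hDY hDZ hD hEZ hEX hE
  have hED := fun m => (liftGroup Γ).mul_mem (hEΓ m) (hDΓ m)
  refine mem_cartanMaps_of_limGraph hn (fun m => (hED m).1) (fun m => (hED m).2) h1 h2 _ ?_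
  intro ℓ v hv
  refine ⟨reflMap x.rep y.rep z.rep v, ?_, h3 v (ℓ.herm_eq_zero hv)⟩
  rw [submodule_reflPencil]
  exact ⟨v, hv, rfl⟩

/-! ### A basis of eigenvectors of the reflection -/

theorem finrank_of_mem_iff {n : ℕ} {X Z : Vec n} (hX : herm X X = 0) (hZ : herm Z Z = 0)
    (hXZ : herm X Z ≠ 0) {M : Submodule ℂ (Vec n)}
    (hM : ∀ v, v ∈ M ↔ herm v X = 0 ∧ herm v Z = 0) : Module.finrank ℂ M + 2 = n + 1 := by
  have hZX : herm Z X ≠ 0 := fun h => hXZ (herm_eq_zero_comm.1 h)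
  have h1 := ((hermLeft X).prod (hermLeft Z)).finrank_range_add_finrank_ker
  have h2 : M = LinearMap.ker ((hermLeft X).prod (hermLeft Z)) := by
    ext v
    rw [hM, LinearMap.mem_ker]
    exact Prod.mk_eq_zero.symm
  have h3 : LinearMap.range ((hermLeft X).prod (hermLeft Z)) = ⊤ := by
    rw [LinearMap.range_eq_top]
    rintro ⟨a, b⟩
    refine ⟨(a / herm Z X) • Z + (b / herm X Z) • X, ?_⟩
    change (herm _ X, herm _ Z) = (a, b)
    rw [herm_add_left, herm_add_left,
      herm_smul_left, herm_smul_left, herm_smul_left, herm_smul_left, hX, hZ, mul_zero, mul_zero,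
      zero_add, add_zero, div_mul_cancel₀ _ hZX, div_mul_cancel₀ _ hXZ]
  rw [h3, finrank_top, Module.finrank_prod, Module.finrank_self, ← h2, Module.finrank_fin_fun] at h1
  omega

namespace NullTriple

variable {n : ℕ} {X Y Z : Vec n}

/-- The last basis vector spans a line containing `perpProj X Z Y`, and the others span its
orthogonal complement in `M`, where the reflection is the identity. Positivity of the form on `M`
makes the two complementary. -/
theorem exists_basis (h : NullTriple X Y Z) (hn : 2 ≤ n) {M : Submodule ℂ (Vec n)}
    (hM : ∀ v, v ∈ M ↔ herm v X = 0 ∧ herm v Z = 0) :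
    ∃ b : Module.Basis (Fin (n - 1)) ℂ M, ∀ j, reflMap X Y Z (b j : Vec n) =
      (if (j : ℕ) + 1 = n - 1 then
        -(herm X Y * herm Y Z * herm Z X) / (herm Y X * herm X Z * herm Z Y) else 1) •
        (b j : Vec n) := by
  have hfin := finrank_of_mem_iff h.hX h.hZ h.hXZ hM
  -- If `Y` lies in the span of `X` and `Z`, its component in `M` is zero. The reflection is then
  -- the identity and any nonzero vector of `M` will do.
  obtain ⟨e, he, he0, heη⟩ : ∃ e ∈ M, e ≠ 0 ∧ ∃ c : ℂ, perpProj X Z Y = c • e := by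
    by_cases h0 : perpProj X Z Y = 0
    · have : Nontrivial M := Module.nontrivial_of_finrank_pos (R := ℂ) (by omega)
      obtain ⟨e, he⟩ := exists_ne (0 : M)
      exact ⟨e, e.2, fun h' => he (Subtype.ext h'), 0, by rw [h0, zero_smul]⟩
    · exact ⟨_, (hM _).2 ⟨herm_perpProj_left h.hX h.hXZ Y, herm_perpProj_right h.hZ h.hXZ Y⟩, h0, 1,
        (one_smul _ _).symm⟩
  obtain ⟨d, hd⟩ := heη
  have hee : herm e e ≠ 0 := fun h' => by
    have := herm_self_pos hn h.hX h.hXZ ((hM e).1 he).1 ((hM e).1 he).2 he0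
    rw [h', Complex.zero_re] at this
    exact lt_irrefl _ this
  have hSe : reflMap X Y Z e =
      (-(herm X Y * herm Y Z * herm Z X) / (herm Y X * herm X Z * herm Z Y)) • e := by
    rw [← h.reflMap_factor, reflMap_apply, hd, herm_smul_right, herm_smul_left, herm_smul_right,
      smul_smul, add_smul, one_smul]
    congr 2
    ring
  have hSN : ∀ v, herm v e = 0 → reflMap X Y Z v = v := by
    intro v hv
    rw [reflMap_apply, hd, herm_smul_right, hv, mul_zero, mul_zero, zero_smul, add_zero]
  let N : Submodule ℂ (Vec n) := M ⊓ LinearMap.ker (hermLeft e)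
  have hNe : ∀ v ∈ N, herm v e = 0 := fun v hv => hv.2
  have hli : ∀ c : ℂ, ∀ v ∈ N, c • e + v = 0 → c = 0 := by
    intro c v hv hc
    have h1 := congrArg (fun u => herm u e) hc
    simp only [herm_add_left, herm_smul_left, hNe v hv, add_zero, herm_zero_left] at h1
    exact (mul_eq_zero.1 h1).resolve_right hee
  have hsp : ∀ v ∈ M, ∃ c : ℂ, v + c • e ∈ N := by
    intro v hv
    refine ⟨-(herm v e / herm e e), Submodule.add_mem _ hv (Submodule.smul_mem _ _ he), ?_⟩
    change herm _ e = 0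
    rw [herm_add_left, herm_smul_left, neg_mul,
      div_mul_cancel₀ _ hee, add_neg_cancel]
  -- Makes `n - 1` definitionally `m + 1`, so that a basis of `N` can be extended by a last vector.
  obtain ⟨m, rfl⟩ : ∃ m, n = m + 2 := ⟨n - 2, by omega⟩
  have hN : Module.finrank ℂ N = m := by
    have := Module.finrank_eq_card_basis
      (Module.Basis.mkFinSnocOfLE (Module.finBasis ℂ N) inf_le_left e he hli hsp)
    rw [Fintype.card_fin] at this
    omega
  let bN := Module.finBasisOfFinrankEq ℂ N hN
  let b : Module.Basis (Fin (m + 1)) ℂ M := Module.Basis.mkFinSnocOfLE bN inf_le_left e he hli hsp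
  have hb : (b : Fin (m + 1) → M) = Fin.snoc (Submodule.inclusion inf_le_left ∘ bN) ⟨e, he⟩ :=
    Module.Basis.coe_mkFinSnocOfLE _ _ _ _ _ _
  refine ⟨b, fun j => ?_⟩
  refine Fin.lastCases ?_ (fun i => ?_) (j : Fin (m + 1))
  · rw [hb, Fin.snoc_last, if_pos (by simp)]
    exact hSe
  · have hi := i.2
    rw [hb, Fin.snoc_castSucc, if_neg (by rw [Fin.val_castSucc]; omega), one_smul]
    exact hSN _ (hNe _ (bN i).2)

end NullTriple

theorem exp_I_mul_arg {k : ℂ} (hk : k ≠ 0) :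
    Complex.exp (Complex.I * Complex.arg k) = k / (‖k‖ : ℂ) := by
  have h : (‖k‖ : ℂ) ≠ 0 := by exact_mod_cast norm_ne_zero_iff.2 hk
  rw [eq_div_iff h, mul_comm, mul_comm Complex.I]
  exact Complex.norm_mul_exp_arg_mul_I k

/-- With `k` the triple product, the angles `A(x,y,z)` and `A(y,x,z)` are the arguments of `-k` and
`-k̄`. The two exponentials are thus `-k / |k|` and `-k̄ / |k|`, and the quotient of the first by
minus the second is `-k / k̄`. -/
theorem exp_cartanAngle {n : ℕ} {x y z : Proj n} (h : NullTriple x.rep y.rep z.rep) :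
    Complex.exp (Complex.I * cartanAngle x y z) = -Complex.exp (Complex.I * cartanAngle y x z) *
      (-(herm x.rep y.rep * herm y.rep z.rep * herm z.rep x.rep) /
        (herm y.rep x.rep * herm x.rep z.rep * herm z.rep y.rep)) := by
  have h1 : herm x.rep y.rep * herm y.rep z.rep * herm z.rep x.rep ≠ 0 :=
    mul_ne_zero (mul_ne_zero h.hXY h.hYZ) h.hZX
  have h2 : herm y.rep x.rep * herm x.rep z.rep * herm z.rep y.rep ≠ 0 :=
    mul_ne_zero (mul_ne_zero h.hYX h.hXZ) h.hZY
  have h3 : ‖herm x.rep y.rep * herm y.rep z.rep * herm z.rep x.rep‖ =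
      ‖herm y.rep x.rep * herm x.rep z.rep * herm z.rep y.rep‖ := by
    have hs : ∀ u v : Vec n, ‖herm u v‖ = ‖herm v u‖ := fun u v => by
      rw [← star_herm, norm_star]
    rw [norm_mul, norm_mul, norm_mul, norm_mul, hs y.rep x.rep, hs x.rep z.rep, hs z.rep y.rep]
    ring
  have h4 : (‖herm y.rep x.rep * herm x.rep z.rep * herm z.rep y.rep‖ : ℂ) ≠ 0 := by
    exact_mod_cast norm_ne_zero_iff.2 h2
  rw [cartanAngle, cartanAngle, exp_I_mul_arg (neg_ne_zero.2 h1), exp_I_mul_arg (neg_ne_zero.2 h2),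
    norm_neg, norm_neg, h3]
  generalize herm x.rep y.rep * herm y.rep z.rep * herm z.rep x.rep = k at *
  generalize herm y.rep x.rep * herm x.rep z.rep * herm z.rep y.rep = k' at *
  field_simp

end CHyp

end

/-! ### The theorem -/

theorem mainTheorem5 (n : ℕ) (hn : 2 ≤ n) (Γ : Subgroup (CHyp.PGLn n)) (hΓ : Γ ≤ CHyp.PU1n n)
    (hdisc : DiscreteTopology Γ) (hne : (CHyp.limitSet Γ).Infinite)
    (x y z : CHyp.Proj n) (hx : x ∈ CHyp.limitSet Γ) (hy : y ∈ CHyp.limitSet Γ)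
    (hz : z ∈ CHyp.limitSet Γ) (hxy : x ≠ y) (hyz : y ≠ z) (hxz : x ≠ z) :
    ∃ (φ : {w : CHyp.Proj n // w ∈ CHyp.perp x ⊓ CHyp.perp z} →
          {w : CHyp.Proj n // w ∈ CHyp.perp x ⊓ CHyp.perp z})
      (Φ : CHyp.Pencil z ≃ CHyp.Pencil z),
      CHyp.IsComposedProjection x y z φ ∧ CHyp.IsInducedOnPencil x z φ Φ ∧
      (∃ v : Module.Basis (Fin (n - 1)) ℂ ((CHyp.perp x ⊓ CHyp.perp z).submodule),
        ∀ (w : {w : CHyp.Proj n // w ∈ CHyp.perp x ⊓ CHyp.perp z}) (α : Fin (n - 1) → ℂ)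
          (h : ∑ j, α j • (v j : CHyp.Vec n) ≠ 0),
          w.1 = Projectivization.mk ℂ (∑ j, α j • (v j : CHyp.Vec n)) h →
          ∃ h' : ∑ j, (CHyp.cartanEigenvalue x y z j * α j) • (v j : CHyp.Vec n) ≠ 0,
            (φ w).1 = Projectivization.mk ℂ
              (∑ j, (CHyp.cartanEigenvalue x y z j * α j) • (v j : CHyp.Vec n)) h') ∧
      Φ ∈ CHyp.cartanMaps Γ z z := by
  have hxx := CHyp.herm_self_of_mem_frontier hx.1
  have hyy := CHyp.herm_self_of_mem_frontier hy.1
  have hzz := CHyp.herm_self_of_mem_frontier hz.1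
  have hNT : CHyp.NullTriple x.rep y.rep z.rep :=
    ⟨hxx, hyy, hzz, CHyp.rep_herm_ne_zero hn hxx hyy hxy, CHyp.rep_herm_ne_zero hn hyy hzz hyz,
      CHyp.rep_herm_ne_zero hn hxx hzz hxz⟩
  refine ⟨CHyp.reflPoint hNT, CHyp.reflPencil hNT, CHyp.isComposedProjection_reflPoint hNT,
    CHyp.isInducedOnPencil_reflPencil hNT, ?_,
    CHyp.reflPencil_mem_cartanMaps hn hΓ hdisc hne hx hy hz hyz hxz hNT⟩
  have hM : ∀ v : CHyp.Vec n, v ∈ (CHyp.perp x ⊓ CHyp.perp z).submodule ↔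
      CHyp.herm v x.rep = 0 ∧ CHyp.herm v z.rep = 0 := by
    intro v
    rw [CHyp.submodule_inf, CHyp.perp_submodule, CHyp.perp_submodule, Submodule.mem_inf,
      CHyp.mem_perpSubmodule, CHyp.mem_perpSubmodule]
  obtain ⟨b, hb⟩ := hNT.exists_basis hn hM
  refine ⟨b, fun w α h hw => ?_⟩
  -- The eigenvalues in the statement are those of the reflection times the common scalar
  -- `-e^{iA(y,x,z)}`, which is invisible projectively.
  have hsum : ∑ j, (CHyp.cartanEigenvalue x y z j * α j) • (b j : CHyp.Vec n) =
      -Complex.exp (Complex.I * CHyp.cartanAngle y x z) •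
        CHyp.reflMap x.rep y.rep z.rep (∑ j, α j • (b j : CHyp.Vec n)) := by
    rw [map_sum, Finset.smul_sum]
    refine Finset.sum_congr rfl fun j _ => ?_
    rw [map_smul, hb, smul_smul, smul_smul, CHyp.cartanEigenvalue]
    congr 1
    split_ifs
    · rw [CHyp.exp_cartanAngle hNT]
      ring
    · ring
  have h0 := (map_ne_zero_iff _ hNT.reflMap_injective).2 h
  have hE : -Complex.exp (Complex.I * CHyp.cartanAngle y x z) ≠ 0 :=
    neg_ne_zero.2 (Complex.exp_ne_zero _)
  refine ⟨hsum ▸ smul_ne_zero hE h0, ?_⟩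
  rw [CHyp.reflPoint_of_eq_mk hNT w h hw]
  exact (CHyp.mk_eq_of_smul hsum).symm
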